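/- A partially-labeled graph $(G,v_0)$ is a finite simple undirected graph $G=(V,E)$ with edge lengths $\ell:E\to(0,\infty)$ and a partial assignment $v_0:V\to\mathbb R\cup\{*\}$; its terminals are $T(v_0)=\{t: v_0(t)\ne *\}$. Write $n=|V|$, $m=|E|$. For $v\in\mathbb R^V$ let $\mathrm{grad}_G[v](x,y)=(v(x)-v(y))/\ell(x,y)$ on the oriented edges, and let $\|\mathrm{grad}_G[v]\|_\infty$ be its maximum absolute value ($0$ if $E=\emptyset$). For $T=T(v_0)$ let $\|v(T)-v_0(T)\|_0=|\{t\in T: v(t)\neq v_0(t)\}|$. For an integer $k\ge 1$, the $k$-outlier problem is $$\alpha^*=\min\{\|\mathrm{grad}_G[v]\|_\infty : v\in\mathbb R^V,\ \|v(T)-v_0(T)\|_0\le k\}.$$ A terminal path is a path whose end points $s,t$ are terminals; its gradient is $(v_0(s)-v_0(t))$ divided by its length. The pressure of a vertex is the largest gradient of a terminal path through it (with walks allowed as paths, and $0$ if there is no such path). For $U\subseteq V$ let $v_U$ be $v_0$ with the labels on $U$ replaced by $*$. Algorithm Approx-Outlier, on input $(G,v_0)$ and $k$: (0) let $U=\emptyset$;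 (1) with SteepestPath find a steepest terminal path of $G$ with respect to $v_U$; if no terminal path has positive gradient, go to (4); (2) add its two end points to $U$; (3) if $|U|\le 2k-2$, go to (1); (4) output the assignment computed by CompInfMin on $(G,v_U)$. Its subroutines are as follows. * SteepestPath (randomized): if there are no edges, report that there is no path. Otherwise pick a uniformly random edge $\{x_1,x_2\}$ and a uniformly random vertex $x_3$; for each $x_i$ compute a steepest terminal path through $x_i$. Let $\alpha$ be the largest of the three gradients; compute the subgraph $G'$ induced by the vertices of pressure larger than $\alpha$; if $G'$ has no edge, return the best of the three paths, otherwise recurse on $G'$. * The steepest terminal path through $x$ is found from the distances $d(t)$ of the terminals $t$ to $x$, computed by Dijkstra's algorithm: if $x$ is a terminal, by maximizing $|v_0(x)-v_0(t)|/d(t)$ over the other reachable terminals $t$; otherwise, by maximizing $(v_0(s)-v_0(t))/(d(s)+d(t))$ over reachable terminals $s,t$, through random sampling: pick a uniformly random terminal $s$, let $\beta$ be the maximum of $|v_0(s)-v_0(t)|/(d(s)+d(t))$ over $t$, keep the terminals that belong to a pair of quotient larger than $\beta$, and recurse on these until none is left. * The vertices of pressure larger than $\alpha$ are those with $\mathrm{vHigh}[\alpha](x)>\mathrm{vLow}[\alpha](x)$,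 where $\mathrm{vLow}[\alpha](x)=\min_t\{v_0(t)+\alpha\,\mathrm{dist}(x,t)\}$ and $\mathrm{vHigh}[\alpha](x)=\max_t\{v_0(t)-\alpha\,\mathrm{dist}(t,x)\}$, over terminals $t$, are computed by a modification of Dijkstra's algorithm. * CompInfMin: delete the edges between terminals; let $\alpha$ be the maximum of the absolute gradients of these edges and of the gradient of a path returned by SteepestPath on the remaining graph ($0$ where there is none); keep the given values at terminals, and set $v(x)=\frac12(\mathrm{vLow}[\alpha](x)+\mathrm{vHigh}[\alpha](x))$ at the other vertices (computed in the remaining graph), and $v(x)=0$ at those that cannot reach a terminal. All priority queues are Fibonacci heaps. Running time is the number of elementary steps on a unit-cost real RAM that can draw uniformly random elements of an array. Theorem. For every partially-labeled graph $(G,v_0)$ and every integer $k\ge1$, the minimum $\alpha^*$ exists, and every assignment $v$ that Approx-Outlier can output satisfies $$\|v(T)-v_0(T)\|_0\le 2k\qquad\text{and}\qquad \|\mathrm{grad}_G[v]\|_\infty\le\alpha^*.$$ Moreover, there is an absolute constant $C$ such that, whenever $n\ge2$, the expected running time of Approx-Outlier on $(G,v_0)$ and $k$ is at most $C\,k\,(m+n\log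 n)$. -/

import Mathlib

noncomputable section

open scoped Classical ENNReal

namespace Outlier

/-! ## Step counting

Programs are written in two monads.  `Timed` is deterministic, `RTimed` may in addition sample
uniformly from a finite set.  One unit of time is charged for each executed program line
performing a bounded number of elementary operations of a unit-cost real RAM: an access to an
array entry, an arithmetic operation or a comparison of reals, insertion or deletion of an item in a
doubly linked list, or drawing one uniformly random element of an array.  Arrays are functions;
writing to an array is `Function.update`. -/

/-- The result of a deterministic computation, with the number of steps it took. -/
structure Timed (α : Type) where
  val : α
  steps : ℕ

instance : Monad Timed where
  pure a := ⟨a, 0⟩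
  bind x f := ⟨(f x.val).val, x.steps + (f x.val).steps⟩

/-- A randomized computation: the joint law of its result and its number of steps. -/
def RTimed (α : Type) : Type := PMF (Timed α)

instance : Monad RTimed where
  pure a := PMF.pure ⟨a, 0⟩
  bind p f := PMF.bind p fun x => PMF.map (fun y => ⟨y.val, x.steps + y.steps⟩) (f x.val)

instance : MonadLift Timed RTimed where
  monadLift x := PMF.pure x

namespace RTimed

/-- The results which occur with positive probability. -/
def outputs {α : Type} (p : RTimed α) : Set α := Timed.val '' PMF.support p

/-- The expected number of steps. -/
def expectedSteps {α : Type} (p : RTimed α) : ℝ≥0∞ :=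
  ∑' x : Timed α, (show PMF (Timed α) from p) x * (x.steps : ℝ≥0∞)

end RTimed

/-- `c` elementary steps. -/
def ticks (c : ℕ) : Timed Unit := ⟨(), c⟩

/-- One elementary step. -/
def tick : Timed Unit := ticks 1

/-- `FOR a ∈ l`: run `body`, which updates the program state; one step of overhead per round. -/
def forEach {α σ : Type} : List α → σ → (σ → α → Timed σ) → Timed σ
  | [], s, _ => do tick; pure s
  | a :: l, s, body => do
      tick
      let s' ← body s a
      forEach l s' body

/-- Fill an array over the index set `s`, its entries being given by a constant-time expression. -/
def fillArray {α β : Type} (s : Finset α) (f : α → β) : Timed (α → β) := ⟨f, s.card + 1⟩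

/-- The elements of `s` that pass a constant-time test, found by one scan. -/
def select {α : Type} (s : Finset α) (p : α → Prop) : Timed (Finset α) :=
  ⟨s.filter p, s.card + 1⟩

/-- A maximizer of `f` over `s`, found by one scan. -/
def argmax {α : Type} (s : Finset α) (hs : s.Nonempty) (f : α → ℝ) : Timed α :=
  ⟨(s.exists_max_image f hs).choose, s.card + 1⟩

/-- The minimum of `f` over `s`, found by one scan. -/
def minOver {α : Type} (s : Finset α) (hs : s.Nonempty) (f : α → ℝ) : Timed ℝ :=
  ⟨s.inf' hs f, s.card + 1⟩

/-- The maximum of `f` over `s`, found by one scan. -/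
def maxOver {α : Type} (s : Finset α) (hs : s.Nonempty) (f : α → ℝ) : Timed ℝ :=
  ⟨s.sup' hs f, s.card + 1⟩

/-- A uniformly random element of `s`, in one step. -/
def sample {α : Type} (s : Finset α) (hs : s.Nonempty) : RTimed α :=
  PMF.map (fun a => (⟨a, 1⟩ : Timed α)) (PMF.uniformOfFinset s hs)

/-! ## Fibonacci heaps -/

/-- A Fibonacci heap: a forest of heap-ordered trees, with parent pointers, lists of children,
marks, and the list of roots.  The lists are doubly linked and know their lengths, so that `erase`
at a given item is one elementary operation. -/
structure FibHeap (V : Type) where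
  key : V → EReal
  parent : V → Option V
  children : V → List V
  mark : V → Bool
  roots : List V

namespace FibHeap

variable {V : Type} [DecidableEq V]

/-- The empty heap (the arrays hold meaningless values until an item is inserted). -/
def empty : FibHeap V where
  key _ := ⊤
  parent _ := none
  children _ := []
  mark _ := false
  roots := []

/-- Insert the item `x` with key `a` as a new root. -/
def insert (h : FibHeap V) (x : V) (a : EReal) : Timed (FibHeap V) := do
  tick
  pure
    { key := Function.update h.key x a
      parent := Function.update h.parent x none
      children := Function.update h.children x []
      mark := Function.update h.mark x false
      roots := x :: h.roots }

/-- Cut the item `x` from its parent `p` and make it an unmarked root. -/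
def cut (h : FibHeap V) (x p : V) : Timed (FibHeap V) := do
  tick
  pure
    { h with
      parent := Function.update h.parent x none
      children := Function.update h.children p ((h.children p).erase x)
      mark := Function.update h.mark x false
      roots := x :: h.roots }

/-- Cascading cut, starting at `p`, which has just lost a child: cut marked nodes until reaching a
root or an unmarked node, and mark the latter.  The first argument only bounds the recursion. -/
def cascadingCut : ℕ → FibHeap V → V → Timed (FibHeap V)
  | 0, h, _ => pure h
  | f + 1, h, p => do
      tick
      match h.parent p with
      | none => pure h
      | some q =>
          if h.mark p = true then do
            let h' ← h.cut p q
            cascadingCut f h' q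
          else pure { h with mark := Function.update h.mark p true }

/-- Decrease the key of the item `x` to `a`. -/
def decreaseKey [Fintype V] (h : FibHeap V) (x : V) (a : EReal) : Timed (FibHeap V) := do
  tick
  let h₁ : FibHeap V := { h with key := Function.update h.key x a }
  match h.parent x with
  | none => pure h₁
  | some p =>
      if a < h.key p then do
        let h₂ ← h₁.cut x p
        cascadingCut (Fintype.card V) h₂ p
      else pure h₁

/-- Make the root `y` a child of the root `x`. -/
def link (h : FibHeap V) (y x : V) : Timed (FibHeap V) := do
  tick
  pure
    { h with
      parent := Function.update h.parent y (some x)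
      children := Function.update h.children x (y :: h.children x)
      mark := Function.update h.mark y false
      roots := h.roots.erase y }

/-- Consolidation: link roots of equal rank until all ranks are distinct.  The list holds the roots
that still have to be entered into the table `A`, which is indexed by ranks.  The first argument
only bounds the recursion. -/
def consolidate : ℕ → List V → FibHeap V → (ℕ → Option V) → Timed (FibHeap V)
  | 0, _, h, _ => pure h
  | _ + 1, [], h, _ => pure h
  | f + 1, x :: w, h, A => do
      tick
      match A (h.children x).length with
      | none => consolidate f w h (Function.update A (h.children x).length (some x))
      | some y =>
          let A' := Function.update A (h.children x).length none
          if h.key x ≤ h.key y then do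
            let h' ← h.link y x
            consolidate f (x :: w) h' A'
          else do
            let h' ← h.link x y
            consolidate f (y :: w) h' A'

/-- Remove an item of minimum key; returns it with the remaining heap (`none` if the heap is
empty).  The minimum is found by scanning the roots; its children become roots, and the heap is
consolidated. -/
def popMin (h : FibHeap V) : Timed (Option (V × FibHeap V)) := do
  tick
  match h.roots with
  | [] => pure none
  | r :: rs => do
      let x ← forEach rs r fun b a => pure (if h.key a < h.key b then a else b)
      let h₁ ← forEach (h.children x) { h with roots := h.roots.erase x } fun g c =>
        pure { g with parent := Function.update g.parent c none, roots := c :: g.roots }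
      let h₂ : FibHeap V := { h₁ with children := Function.update h₁.children x [] }
      let h₃ ← consolidate (2 * h₂.roots.length) h₂.roots h₂ (fun _ => none)
      -- the time for emptying the used entries of the table of the consolidation
      ticks h₃.roots.length
      pure (some (x, h₃))

end FibHeap

/-! ## Partially labeled graphs and shortest paths -/

variable {V : Type} [Fintype V] [DecidableEq V]

/-- A weighted undirected graph as the programs handle it (vertices, edges, edge lengths). -/
structure WGraph (V : Type) where
  verts : Finset V
  edges : Finset (Sym2 V)
  len : Sym2 V → ℝ

/-- The adjacency list of `x`. -/
def WGraph.adj (G : WGraph V) (x : V) : List V :=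
  (G.verts.filter fun y => s(x, y) ∈ G.edges).toList

/-- The value of a partial assignment (`none` is `*`) at a terminal. -/
def volt (v₀ : V → Option ℝ) (x : V) : ℝ := (v₀ x).getD 0

/-- The main loop of `modDijkstra`, with the heap, the voltages, and the flags `finished`.
There are at most as many rounds as vertices. -/
def dijkstraLoop (G : WGraph V) (α : ℝ) :
    ℕ → FibHeap V → (V → EReal) → (V → Bool) → Timed (V → EReal)
  | 0, _, v, _ => pure v
  | f + 1, h, v, finished => do
      match ← h.popMin with
      | none => pure v
      | some (x, h₁) => do
          let v' := Function.update v x (h₁.key x)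
          let finished' := Function.update finished x true
          let h₂ ← forEach (G.adj x) h₁ fun g y =>
            if finished' y = false ∧ v' x + ((α * G.len s(x, y) : ℝ) : EReal) < g.key y then
              g.decreaseKey y (v' x + ((α * G.len s(x, y) : ℝ) : EReal))
            else pure g
          dijkstraLoop G α f h₂ v' finished'

/-- ModDijkstra: computes `x ↦ min {v₀ t + α * dist x t | t terminal}`, which is `⊤` at the vertices
from which no terminal can be reached. -/
def modDijkstra (G : WGraph V) (v₀ : V → Option ℝ) (α : ℝ) : Timed (V → EReal) := do
  let h₀ ← forEach G.verts.toList FibHeap.empty fun h x => h.insert x ⊤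
  let h₁ ← forEach G.verts.toList h₀ fun h x =>
    match v₀ x with
    | none => pure h
    | some a => h.decreaseKey x (a : EReal)
  dijkstraLoop G α G.verts.card h₁ (fun _ => ⊤) (fun _ => false)

/-- CompVLow. -/
def compVLow (G : WGraph V) (v₀ : V → Option ℝ) (α : ℝ) : Timed (V → EReal) :=
  modDijkstra G v₀ α

/-- CompVHigh: computes `x ↦ max {v₀ t - α * dist t x | t terminal}`, which is `⊥` at the vertices
from which no terminal can be reached. -/
def compVHigh (G : WGraph V) (v₀ : V → Option ℝ) (α : ℝ) : Timed (V → EReal) := do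
  let v₁ ← fillArray G.verts fun x => (v₀ x).map fun a => -a
  let temp ← modDijkstra G v₁ α
  fillArray G.verts fun x => -temp x

/-! ## Steepest terminal paths -/

/-- A terminal path, recorded by its two end points and its length. -/
structure TermPath (V : Type) where
  src : V
  dst : V
  len : ℝ

/-- The gradient of a terminal path; `none`, for no path, counts as gradient `0`. -/
def pathGrad (v₀ : V → Option ℝ) : Option (TermPath V) → ℝ
  | none => 0
  | some P => (volt v₀ P.src - volt v₀ P.dst) / P.len

/-- StarSteepestPath: the steepest path between two terminals of a star with terminal set `T`,
voltages `v`, and distances `d` to the center.  The first argument only bounds the recursion. -/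
def starSteepestPath (v d : V → ℝ) : ℕ → Finset V → RTimed (Option (V × V))
  | 0, _ => pure none
  | f + 1, T =>
      if hT : T.Nonempty then do
        let t₁ ← sample T hT
        let t₂ ← argmax T hT fun t => |v t₁ - v t| / (d t₁ + d t)
        let α := |v t₁ - v t₂| / (d t₁ + d t₂)
        let vlow ← minOver T hT fun t => v t + α * d t
        let Tlow ← select T fun t => vlow + α * d t < v t
        let vhigh ← maxOver T hT fun t => v t - α * d t
        let Thigh ← select T fun t => v t < vhigh - α * d t
        let T' ← select T fun t => t ∈ Tlow ∨ t ∈ Thigh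
        if T' = ∅ then
          if v t₂ ≤ v t₁ then pure (some (t₁, t₂)) else pure (some (t₂, t₁))
        else starSteepestPath v d f T'
      else do
        tick
        pure none

/-- VertexSteepestPath: a steepest terminal path through the vertex `x` (`none` if there is no
such path of positive length). -/
def vertexSteepestPath (G : WGraph V) (v₀ : V → Option ℝ) (x : V) :
    RTimed (Option (TermPath V)) := do
  let source ← fillArray G.verts fun y => if y = x then some (0 : ℝ) else none
  let dist ← modDijkstra G source 1
  let T ← select G.verts fun t => (v₀ t).isSome = true ∧ dist t ≠ ⊤
  let d ← fillArray G.verts fun t => (dist t).toReal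
  if (v₀ x).isSome = true then do
    let S ← select T fun t => t ≠ x
    if hS : S.Nonempty then do
      let y ← argmax S hS fun y => |volt v₀ x - volt v₀ y| / d y
      if volt v₀ y ≤ volt v₀ x then pure (some ⟨x, y, d y⟩) else pure (some ⟨y, x, d y⟩)
    else pure none
  else do
    let st ← starSteepestPath (volt v₀) d T.card T
    match st with
    | none => pure none
    | some (t₁, t₂) => pure (some ⟨t₁, t₂, d t₁ + d t₂⟩)

/-- CompHighPressGraph: the subgraph induced by the vertices through which there is a terminal path
of gradient larger than `α`. -/
def compHighPressGraph (G : WGraph V) (v₀ : V → Option ℝ) (α : ℝ) : Timed (WGraph V) := do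
  let vLow ← compVLow G v₀ α
  let vHigh ← compVHigh G v₀ α
  let V' ← select G.verts fun x => vLow x < vHigh x
  let E' ← select G.edges fun e => ∀ x ∈ e, x ∈ V'
  -- the time for building the adjacency lists
  ticks (V'.card + E'.card)
  pure ⟨V', E', G.len⟩

/-- The recursion of SteepestPath: compute steepest terminal paths through the two ends of a random
edge and through a random vertex, and recurse on the subgraph of higher pressure, if any.  The first
argument only bounds the recursion; every recursive call is on a graph with fewer vertices. -/
def steepestPathAux (v₀ : V → Option ℝ) : ℕ → WGraph V → RTimed (Option (TermPath V))
  | 0, _ => pure none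
  | f + 1, G =>
      if hG : G.edges.Nonempty ∧ G.verts.Nonempty then do
        let e ← sample G.edges hG.1
        let x₃ ← sample G.verts hG.2
        let P₁ ← vertexSteepestPath G v₀ (Quot.out e).1
        let P₂ ← vertexSteepestPath G v₀ (Quot.out e).2
        let P₃ ← vertexSteepestPath G v₀ x₃
        tick
        let P₁₂ := if pathGrad v₀ P₂ ≤ pathGrad v₀ P₁ then P₁ else P₂
        let P := if pathGrad v₀ P₃ ≤ pathGrad v₀ P₁₂ then P₁₂ else P₃
        let G' ← compHighPressGraph G v₀ (pathGrad v₀ P)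
        if G'.edges = ∅ then pure P else steepestPathAux v₀ f G'
      else do
        tick
        pure none

/-- SteepestPath: a steepest terminal path in `G` with respect to `v₀`. -/
def steepestPath (G : WGraph V) (v₀ : V → Option ℝ) : RTimed (Option (TermPath V)) :=
  steepestPathAux v₀ G.verts.card G

/-! ## Inf-minimizers and outlier removal -/

/-- CompInfMin: a complete assignment extending `v₀` of least maximum gradient.  The vertices that
cannot reach a terminal receive the value `0`. -/
def compInfMin (G : WGraph V) (v₀ : V → Option ℝ) : RTimed (V → ℝ) := do
  let D ← select G.edges fun e => ∀ x ∈ e, (v₀ x).isSome = true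
  let α₁ ←
    if hD : D.Nonempty then
      maxOver D hD fun e =>
        |volt v₀ (Quot.out e).1 - volt v₀ (Quot.out e).2| / G.len e
    else pure 0
  let E' ← select G.edges fun e => e ∉ D
  -- the time for rebuilding the adjacency lists
  ticks (G.verts.card + E'.card)
  let H : WGraph V := ⟨G.verts, E', G.len⟩
  let P ← steepestPath H v₀
  let α := max α₁ (pathGrad v₀ P)
  let vLow ← compVLow H v₀ α
  let vHigh ← compVHigh H v₀ α
  fillArray H.verts fun x =>
    match v₀ x with
    | some a => a
    | none => if vLow x = ⊤ then 0 else ((vLow x).toReal + (vHigh x).toReal) / 2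

/-- The partial assignment `v_U`, which forgets the labels on `U`. -/
def forget (v₀ : V → Option ℝ) (U : Finset V) (x : V) : Option ℝ :=
  if x ∈ U then none else v₀ x

/-- The loop of Approx-Outlier, which repeats at most `k` times: find a steepest terminal path with
respect to `v_U`, stop if its gradient is not positive, add its end points to `U`, and repeat
if `|U| ≤ 2 * k - 2`. -/
def pickLoop (G : WGraph V) (v₀ : V → Option ℝ) (k : ℕ) : ℕ → Finset V → RTimed (Finset V)
  | 0, U => pure U
  | f + 1, U => do
      let vU ← fillArray G.verts (forget v₀ U)
      let P ← steepestPath G vU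
      tick
      match P with
      | none => pure U
      | some Q =>
          if pathGrad vU (some Q) ≤ 0 then pure U
          else
            let U' := insert Q.src (insert Q.dst U)
            if U'.card + 2 ≤ 2 * k then pickLoop G v₀ k f U' else pure U'

/-- Approx-Outlier. -/
def approxOutlier (G : SimpleGraph V) [DecidableRel G.Adj] (len : Sym2 V → ℝ)
    (v₀ : V → Option ℝ) (k : ℕ) : RTimed (V → ℝ) := do
  -- the time for reading the input
  ticks (Fintype.card V + G.edgeFinset.card)
  let H : WGraph V := ⟨Finset.univ, G.edgeFinset, len⟩
  let U ← pickLoop H v₀ k k ∅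
  let vU ← fillArray H.verts (forget v₀ U)
  compInfMin H vU

/-! ## The optimization problem -/

/-- The `ℓ∞` norm of the gradient `(x, y) ↦ (v x - v y) / len (x, y)` on the (oriented) edges. -/
def gradNorm (G : SimpleGraph V) [DecidableRel G.Adj] (len : Sym2 V → ℝ) (v : V → ℝ) : ℝ :=
  ‖fun d : G.Dart => (v d.fst - v d.snd) / len d.edge‖

/-- `‖v(T) - v₀(T)‖₀`: the number of terminals at which `v` differs from `v₀`. -/
def mismatch (v₀ : V → Option ℝ) (v : V → ℝ) : ℕ :=
  (Finset.univ.filter fun t => (v₀ t).isSome = true ∧ v₀ t ≠ some (v t)).card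

/-- The objective values of the feasible points of the `k`-outlier problem. -/
def outlierValues (G : SimpleGraph V) [DecidableRel G.Adj] (len : Sym2 V → ℝ)
    (v₀ : V → Option ℝ) (k : ℕ) : Set ℝ :=
  gradNorm G len '' {v : V → ℝ | mismatch v₀ v ≤ k}

/-- The optimum value of the `k`-outlier problem. -/
def outlierOpt (G : SimpleGraph V) [DecidableRel G.Adj] (len : Sym2 V → ℝ)
    (v₀ : V → Option ℝ) (k : ℕ) : ℝ :=
  sInf (outlierValues G len v₀ k)

end Outlier

end

noncomputable section

open scoped Classical ENNReal

set_option linter.unusedSectionVars false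

namespace Outlier

/-! ## Step counting -/

namespace Timed

variable {α β : Type}

/-! Approximation. Let W be the set of terminals at which an optimal assignment departs from its
label, so |W| ≤ k. The optimal assignment is α*-Lipschitz along walks, so without the labels on W no
terminal walk has gradient above α*. Hence, as long as the current steepest path has gradient above
α*, at least one of its two end points lies in W. Each round adds two new terminals to U. Therefore
either all remaining gradients are already at most α*, or |U| ≤ 2|U ∩ W|; after k rounds the latter
forces W ⊆ U, and again the gradients are at most α* (`pickLoop_outputs`). Once the labels on U are
forgotten, the midpoint of the lower and upper McShane extensions realizes the largest remaining
gradient as its Lipschitz constant (`halfway_spec`, `compInfMin_spec`). The optimum is attained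
because the gradients of feasible assignments form a finite union of affine subspaces
(`outlierValues_isLeast`).

Steepest paths. A walk steeper than α visits only vertices of pressure larger than α, so passing to
the subgraph of high pressure loses none of the relevant walks (`steepestPathAux_outputs`). For the
running time, edges and vertices are ranked by pressure: whatever survives outranks the random
sample, and on average at most half of the elements outrank a random one (`two_mul_sum_rank_le`).
The expected costs of the rounds thus decrease geometrically, and a constant number of Dijkstra
computations dominates (`steepestPathAux_expectedSteps`). The same argument makes the star problem
at a single vertex linear (`starSteepestPath_expectedSteps`).

Dijkstra. The bound O(m + n log n) needs the amortized analysis of Fibonacci heaps: `decreaseKey`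
has constant amortized cost (`FibHeap.decreaseKey_spec`), and removal of the minimum is logarithmic
(`FibHeap.popMin_spec`), because a node of rank r has at least Fib(r + 2) descendants
(`FibHeap.fib_le_card_desc`). Correctness of the distances is the usual invariant that finished
values never exceed the keys on the heap (`DijkstraInv.step`). -/

@[simp] theorem val_pure (a : α) : (pure a : Timed α).val = a := rfl

@[simp] theorem steps_pure (a : α) : (pure a : Timed α).steps = 0 := rfl

@[simp] theorem val_bind (x : Timed α) (f : α → Timed β) : (x >>= f).val = (f x.val).val := rfl

@[simp] theorem steps_bind (x : Timed α) (f : α → Timed β) :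
    (x >>= f).steps = x.steps + (f x.val).steps := rfl

end Timed

@[simp] theorem ticks_steps (c : ℕ) : (ticks c).steps = c := rfl

@[simp] theorem tick_steps : tick.steps = 1 := rfl

/-- Invariant rule for `forEach`, with a potential function `φ`. -/
theorem forEach_spec {α σ : Type} (P : List α → σ → Prop) (φ : σ → ℕ) (c : ℕ)
    (body : σ → α → Timed σ)
    (hbody : ∀ a l s, P (a :: l) s →
      P l (body s a).val ∧ (body s a).steps + φ (body s a).val ≤ φ s + c) :
    ∀ (l : List α) (s : σ), P l s → P [] (forEach l s body).val ∧
      (forEach l s body).steps + φ (forEach l s body).val ≤ φ s + (c + 1) * l.length + 1 := by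
  intro l
  induction l with
  | nil =>
    intro s hs
    refine ⟨hs, ?_⟩
    simp [forEach]
    omega
  | cons a l ih =>
    intro s hs
    obtain ⟨h1, h2⟩ := hbody a l s hs
    obtain ⟨h3, h4⟩ := ih _ h1
    refine ⟨h3, ?_⟩
    simp only [forEach, Timed.steps_bind, Timed.val_bind, tick_steps, List.length_cons]
    rw [mul_add, mul_one]
    omega

/-! ## Fibonacci heaps -/

/-- Every entry `c` of the list has at least as large a value `r c` as there are entries
behind it. -/
def RankedList {V : Type} (r : V → ℕ) : List V → Prop
  | [] => True
  | c :: l => l.length ≤ r c ∧ RankedList r l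

theorem RankedList.mono {V : Type} {r r' : V → ℕ} : ∀ {l : List V},
    (∀ c ∈ l, r c ≤ r' c) → RankedList r l → RankedList r' l
  | [], _, _ => trivial
  | c :: l, h, hl => ⟨hl.1.trans (h c (by simp)), hl.2.mono fun d hd => h d (by simp [hd])⟩

/-- Deleting an entry can only lower the number of entries behind each of the others. This is why
cutting a child does not disturb the ranks required of its siblings. -/
theorem RankedList.erase {V : Type} [DecidableEq V] {r : V → ℕ} (x : V) : ∀ {l : List V},
    RankedList r l → RankedList r (l.erase x)
  | [], _ => trivial
  | c :: l, hl => by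
    rw [List.erase_cons]
    split_ifs
    · exact hl.2
    · exact ⟨(List.length_erase_le).trans hl.1, hl.2.erase x⟩

namespace FibHeap

variable {V : Type} [DecidableEq V]

/-- The structural invariants of a heap with item set `S`. -/
structure Forest (h : FibHeap V) (S : Finset V) : Prop where
  roots_nodup : h.roots.Nodup
  mem_roots : ∀ x, x ∈ h.roots ↔ x ∈ S ∧ h.parent x = none
  children_nodup : ∀ x, (h.children x).Nodup
  mem_children : ∀ x y, y ∈ h.children x ↔ y ∈ S ∧ h.parent y = some x
  parent_mem : ∀ x y, y ∈ S → h.parent y = some x → x ∈ S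
  acyclic : ∃ ρ : V → ℕ, ∀ x y, y ∈ S → h.parent y = some x → ρ y < ρ x

/-- The heap order. -/
def Ordered (h : FibHeap V) (S : Finset V) : Prop :=
  ∀ x y, y ∈ S → h.parent y = some x → h.key x ≤ h.key y

/-- The rank of a node, plus one if it is marked. -/
def markedRank (h : FibHeap V) (c : V) : ℕ :=
  (h.children c).length + if h.mark c = true then 1 else 0

/-- The rank invariant, up to a slack `e`. -/
def Ranked (h : FibHeap V) (e : V → ℕ) : Prop :=
  ∀ x, RankedList (fun c => h.markedRank c + e c) (h.children x)

/-- The number of marked nodes. -/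
def marked [Fintype V] (h : FibHeap V) : ℕ := (Finset.univ.filter fun x => h.mark x = true).card

/-- The potential of the amortized analysis. -/
def potential [Fintype V] (h : FibHeap V) : ℕ := 4 * h.roots.length + 6 * h.marked

/-- All invariants of a heap with item set `S`. -/
structure Valid (h : FibHeap V) (S : Finset V) : Prop where
  forest : h.Forest S
  ordered : h.Ordered S
  ranked : h.Ranked fun _ => 0

theorem Forest.parent_ne {h : FibHeap V} {S : Finset V} (hF : h.Forest S) {x p : V} (hx : x ∈ S)
    (hp : h.parent x = some p) : x ≠ p := by
  obtain ⟨ρ, hρ⟩ := hF.acyclic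
  rintro rfl
  exact lt_irrefl _ (hρ _ _ hx hp)

theorem marked_update_false [Fintype V] (m : V → Bool) (x : V) :
    (Finset.univ.filter fun y => Function.update m x false y = true).card ≤
      (Finset.univ.filter fun y => m y = true).card := by
  apply Finset.card_le_card
  intro y
  simp only [Finset.mem_filter, Finset.mem_univ, true_and, Function.update_apply]
  split_ifs <;> simp

theorem marked_update_false_lt [Fintype V] (m : V → Bool) (x : V) (hx : m x = true) :
    (Finset.univ.filter fun y => Function.update m x false y = true).card + 1 ≤
      (Finset.univ.filter fun y => m y = true).card := by
  apply Finset.card_lt_card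
  refine Finset.ssubset_iff_subset_ne.2 ⟨?_, ?_⟩
  · intro y
    simp only [Finset.mem_filter, Finset.mem_univ, true_and, Function.update_apply]
    split_ifs <;> simp
  · intro h
    have : x ∈ Finset.univ.filter fun y => Function.update m x false y = true := by
      rw [h]; simpa using hx
    simp at this

theorem marked_update_true [Fintype V] (m : V → Bool) (x : V) :
    (Finset.univ.filter fun y => Function.update m x true y = true).card ≤
      (Finset.univ.filter fun y => m y = true).card + 1 := by
  refine (Finset.card_le_card (t := Insert.insert x (Finset.univ.filter fun y => m y = true)) ?_).trans
    (Finset.card_insert_le _ _)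
  intro y
  simp only [Finset.mem_filter, Finset.mem_univ, true_and, Function.update_apply,
    Finset.mem_insert]
  split_ifs <;> simp_all

theorem empty_valid : (empty : FibHeap V).Valid ∅ := by
  refine ⟨⟨?_, ?_, ?_, ?_, ?_, ⟨fun _ => 0, ?_⟩⟩, ?_, ?_⟩ <;>
    simp [empty, Ordered, Ranked, RankedList]

theorem empty_potential [Fintype V] : (empty : FibHeap V).potential = 0 := by
  simp [empty, potential, marked]

theorem insert_spec [Fintype V] {h : FibHeap V} {S : Finset V} (hV : h.Valid S) {x : V}
    (hx : x ∉ S) (a : EReal) :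
    (h.insert x a).val.Valid (Insert.insert x S) ∧
      (h.insert x a).val.key = Function.update h.key x a ∧
      (h.insert x a).steps + (h.insert x a).val.potential ≤ h.potential + 5 := by
  obtain ⟨hF, hO, hR⟩ := hV
  have hnc : ∀ y, x ∉ h.children y := fun y hy => hx ((hF.mem_children y x).1 hy).1
  have hnp : ∀ y ∈ S, h.parent y ≠ some x := fun y hy hp => hx (hF.parent_mem _ _ hy hp)
  have hne : ∀ y ∈ S, y ≠ x := fun y hy hyx => hx (hyx ▸ hy)
  refine ⟨⟨⟨?_, ?_, ?_, ?_, ?_, ?_⟩, ?_, ?_⟩, rfl, ?_⟩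
  · simp only [insert, Timed.val_bind, Timed.val_pure, List.nodup_cons]
    exact ⟨fun hr => hx ((hF.mem_roots x).1 hr).1, hF.roots_nodup⟩
  · intro y
    simp only [insert, Timed.val_bind, Timed.val_pure, List.mem_cons, hF.mem_roots,
      Finset.mem_insert, Function.update_apply]
    by_cases hy : y = x <;> simp [hy]
  · intro y
    simp only [insert, Timed.val_bind, Timed.val_pure, Function.update_apply]
    split_ifs
    · exact List.nodup_nil
    · exact hF.children_nodup y
  · intro y z
    simp only [insert, Timed.val_bind, Timed.val_pure, Function.update_apply, Finset.mem_insert]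
    by_cases hy : y = x
    · subst hy
      by_cases hz : z = y
      · simp [hz]
      · simp only [hz, if_true, if_false, List.not_mem_nil, false_iff, false_or]
        rintro ⟨h1, h2⟩
        exact hnp z h1 h2
    · rw [if_neg hy, hF.mem_children]
      by_cases hz : z = x
      · subst hz
        simp [hx]
      · simp [hz]
  · intro y z
    simp only [insert, Timed.val_bind, Timed.val_pure, Function.update_apply, Finset.mem_insert]
    by_cases hz : z = x
    · simp [hz]
    · simp only [hz, if_false, false_or]
      exact fun h1 h2 => Or.inr (hF.parent_mem _ _ h1 h2)
  · obtain ⟨ρ, hρ⟩ := hF.acyclic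
    refine ⟨ρ, fun y z => ?_⟩
    simp only [insert, Timed.val_bind, Timed.val_pure, Function.update_apply, Finset.mem_insert]
    by_cases hz : z = x
    · simp [hz]
    · simp only [hz, if_false, false_or]
      exact fun h1 h2 => hρ _ _ h1 h2
  · intro y z
    simp only [insert, Timed.val_bind, Timed.val_pure, Function.update_apply, Finset.mem_insert]
    by_cases hz : z = x
    · simp [hz]
    · simp only [hz, if_false, false_or]
      intro h1 h2
      have hy : y ≠ x := by
        rintro rfl
        exact hnp z h1 h2
      rw [if_neg hy]
      exact hO _ _ h1 h2
  · intro y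
    simp only [insert, Timed.val_bind, Timed.val_pure, Function.update_apply]
    split_ifs with hy
    · trivial
    · refine (hR y).mono fun c hc => ?_
      have : c ≠ x := fun h => hnc y (h ▸ hc)
      simp [markedRank, this]
  · have h1 : (h.insert x a).val.marked ≤ h.marked := marked_update_false h.mark x
    have h2 : (h.insert x a).val.roots.length = h.roots.length + 1 := rfl
    have h3 : (h.insert x a).steps = 1 := rfl
    simp only [potential]
    omega

/-- The result of cutting `x` from its parent. -/
theorem cut_forest {h : FibHeap V} {S : Finset V} (hF : h.Forest S) {x p : V} (hx : x ∈ S)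
    (hp : h.parent x = some p) : (h.cut x p).val.Forest S := by
  have hxr : x ∉ h.roots := fun hr => by simp [((hF.mem_roots x).1 hr).2] at hp
  refine ⟨?_, ?_, ?_, ?_, ?_, ?_⟩
  · simp only [cut, Timed.val_bind, Timed.val_pure, List.nodup_cons]
    exact ⟨hxr, hF.roots_nodup⟩
  · intro y
    simp only [cut, Timed.val_bind, Timed.val_pure, List.mem_cons, hF.mem_roots,
      Function.update_apply]
    by_cases hy : y = x <;> simp [hy, hx]
  · intro y
    simp only [cut, Timed.val_bind, Timed.val_pure, Function.update_apply]
    split_ifs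
    · exact (hF.children_nodup p).erase x
    · exact hF.children_nodup y
  · intro y z
    simp only [cut, Timed.val_bind, Timed.val_pure, Function.update_apply]
    by_cases hz : z = x
    · subst hz
      simp only [if_true, reduceCtorEq, and_false, iff_false]
      split_ifs with hy
      · exact fun hh => ((hF.children_nodup p).mem_erase_iff.1 hh).1 rfl
      · rw [hF.mem_children, hp]
        simp only [Option.some.injEq, not_and]
        exact fun _ hh => hy hh.symm
    · rw [if_neg hz]
      split_ifs with hy
      · rw [(hF.children_nodup p).mem_erase_iff, hF.mem_children, hy]
        simp [hz]
      · exact hF.mem_children y z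
  · intro y z
    simp only [cut, Timed.val_bind, Timed.val_pure, Function.update_apply]
    split_ifs
    · simp
    · exact hF.parent_mem y z
  · obtain ⟨ρ, hρ⟩ := hF.acyclic
    refine ⟨ρ, fun y z => ?_⟩
    simp only [cut, Timed.val_bind, Timed.val_pure, Function.update_apply]
    split_ifs
    · simp
    · exact hρ y z

/-- The slack travels up the tree: `x` leaves its child list, so its own deficit no longer matters,
while `p` has lost a child and may now be one short in the list of its own parent. -/
theorem cut_ranked {h : FibHeap V} {S : Finset V} (hF : h.Forest S) {x p : V} (hx : x ∈ S)
    (hp : h.parent x = some p) (hR : h.Ranked fun c => if c = x then 1 else 0) :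
    (h.cut x p).val.Ranked fun c => if c = p then 1 else 0 := by
  have key : ∀ c, c ≠ x → h.markedRank c ≤
      (h.cut x p).val.markedRank c + if c = p then 1 else 0 := by
    intro c hc
    simp only [markedRank, cut, Timed.val_bind, Timed.val_pure, Function.update_apply, if_neg hc]
    have := List.le_length_erase (a := x) (l := h.children p)
    by_cases h2 : c = p
    · subst h2
      simp only [if_true]
      omega
    · simp [h2]
  intro y
  have hmem : ∀ c ∈ (h.cut x p).val.children y, c ≠ x := by
    intro c hc hcx
    have := ((cut_forest hF hx hp).mem_children y c).1 hc
    simp [cut, hcx] at this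
  have h1 : RankedList (fun c => h.markedRank c + if c = x then 1 else 0)
      ((h.cut x p).val.children y) := by
    simp only [cut, Timed.val_bind, Timed.val_pure, Function.update_apply]
    split_ifs
    · exact (hR p).erase x
    · exact hR y
  refine h1.mono fun c hc => ?_
  have := key c (hmem c hc)
  simp only [hmem c hc, if_false]
  exact this

theorem cut_parent {h : FibHeap V} {x p : V} (y q : V)
    (hq : (h.cut x p).val.parent y = some q) : h.parent y = some q := by
  simp only [cut, Timed.val_bind, Timed.val_pure, Function.update_apply] at hq
  split_ifs at hq
  exact hq

/-- A deficit of one at `p` is repaired in one of three ways. A root lies in no child list, an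
unmarked node makes up the deficit by being marked, and a marked node is cut, which hands the
deficit to its parent. Each further cut removes a mark, so a fuel larger than the number of marks
suffices. -/
theorem cascadingCut_spec [Fintype V] {S : Finset V} : ∀ (f : ℕ) (h : FibHeap V) (p : V),
    h.Forest S → p ∈ S → (h.Ranked fun c => if c = p then 1 else 0) → h.marked < f →
    (cascadingCut f h p).val.Forest S ∧ (cascadingCut f h p).val.Ranked (fun _ => 0) ∧
      (cascadingCut f h p).val.key = h.key ∧
      (∀ y q, (cascadingCut f h p).val.parent y = some q → h.parent y = some q) ∧
      (cascadingCut f h p).steps + (cascadingCut f h p).val.potential ≤ h.potential + 7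
  | 0, h, p, _, _, _, hf => by omega
  | f + 1, h, p, hF, hpS, hR, hf => by
    rcases hpar : h.parent p with _ | q
    · have e : cascadingCut (f + 1) h p = ⟨h, 1⟩ := by
        simp only [cascadingCut, hpar]; rfl
      rw [e]
      refine ⟨hF, ?_, rfl, fun _ _ => id, by simp; omega⟩
      intro y
      refine (hR y).mono fun c hc => ?_
      have : c ≠ p := by
        rintro rfl
        have := ((hF.mem_children y c).1 hc).2
        simp [hpar] at this
      simp [this]
    · by_cases hm : h.mark p = true
      · have e : cascadingCut (f + 1) h p =
            ⟨(cascadingCut f (h.cut p q).val q).val, 1 + (1 +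
              (cascadingCut f (h.cut p q).val q).steps)⟩ := by
          simp only [cascadingCut, hpar, hm, if_true]; rfl
        have hmk : (h.cut p q).val.marked + 1 ≤ h.marked := marked_update_false_lt _ _ hm
        obtain ⟨h1, h2, h3, h4, h5⟩ := cascadingCut_spec f (h.cut p q).val q
          (cut_forest hF hpS hpar) (hF.parent_mem _ _ hpS hpar) (cut_ranked hF hpS hpar hR)
          (by omega)
        rw [e]
        refine ⟨h1, h2, h3, fun y r hr => cut_parent _ _ (h4 y r hr), ?_⟩
        -- A cascading cut pays for itself: two steps and one new root cost 2 + 4, and the removed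
        -- mark releases 6. Only the last round, with one step and possibly a new mark, contributes
        -- the 7.
        have hr : (h.cut p q).val.roots.length = h.roots.length + 1 := rfl
        simp only [potential] at h5 ⊢
        omega
      · have e : cascadingCut (f + 1) h p =
            ⟨{ h with mark := Function.update h.mark p true }, 1⟩ := by
          simp only [cascadingCut, hpar, hm]; rfl
        rw [e]
        refine ⟨⟨hF.1, hF.2, hF.3, hF.4, hF.5, hF.6⟩, ?_, rfl, fun _ _ => id, ?_⟩
        · intro y
          refine (hR y).mono fun c _ => ?_
          simp only [markedRank, Function.update_apply]
          split_ifs <;> simp_all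
        · have := marked_update_true h.mark p
          simp only [potential, marked] at this ⊢
          omega

theorem decreaseKey_spec [Fintype V] {h : FibHeap V} {S : Finset V} (hV : h.Valid S) {x : V}
    (hx : x ∈ S) {a : EReal} (ha : a ≤ h.key x) :
    (h.decreaseKey x a).val.Valid S ∧
      (h.decreaseKey x a).val.key = Function.update h.key x a ∧
      (h.decreaseKey x a).steps + (h.decreaseKey x a).val.potential ≤ h.potential + 13 := by
  obtain ⟨hF, hO, hR⟩ := hV
  set h₁ : FibHeap V := { h with key := Function.update h.key x a } with hh₁
  have hF₁ : h₁.Forest S := ⟨hF.1, hF.2, hF.3, hF.4, hF.5, hF.6⟩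
  have hR₁ : h₁.Ranked fun _ => 0 := hR
  have hO₁ : ∀ y z, z ∈ S → h.parent z = some y → z ≠ x → h₁.key y ≤ h₁.key z := by
    intro y z hz hp hzx
    simp only [hh₁, Function.update_apply, if_neg hzx]
    have := hO _ _ hz hp
    split_ifs with hy
    · exact ha.trans (hy ▸ this)
    · exact this
  rcases hpar : h.parent x with _ | p
  · have e : h.decreaseKey x a = ⟨h₁, 1⟩ := by
      simp only [decreaseKey, hpar]; rfl
    rw [e]
    refine ⟨⟨hF₁, ?_, hR₁⟩, rfl, by simp [potential, marked, hh₁]; omega⟩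
    intro y z hz hp
    exact hO₁ y z hz hp (by rintro rfl; simp [h₁, hpar] at hp)
  · by_cases hlt : a < h.key p
    · have e : h.decreaseKey x a =
          ⟨(cascadingCut (Fintype.card V) (h₁.cut x p).val p).val, 1 + (1 +
            (cascadingCut (Fintype.card V) (h₁.cut x p).val p).steps)⟩ := by
        simp only [decreaseKey, hpar, hlt, if_true]; rfl
      have hmk : (h₁.cut x p).val.marked ≤ h.marked := marked_update_false _ _
      -- The node just cut is unmarked, so the fuel exceeds the number of marks.
      have hcard : (h₁.cut x p).val.marked < Fintype.card V := by
        apply Finset.card_lt_univ_of_notMem (x := x)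
        intro hh
        have := (Finset.mem_filter.1 hh).2
        simp [cut] at this
      obtain ⟨h1, h2, h3, h4, h5⟩ := cascadingCut_spec _ (h₁.cut x p).val p
        (cut_forest hF₁ hx hpar) (hF.parent_mem _ _ hx hpar)
        (cut_ranked hF₁ hx hpar fun y => (hR₁ y).mono fun c _ => by simp) hcard
      rw [e]
      refine ⟨⟨h1, ?_, h2⟩, h3, ?_⟩
      · intro y z hz hp
        have hp' := h4 _ _ hp
        rw [h3]
        refine hO₁ y z hz (cut_parent (p := p) _ _ hp') ?_
        rintro rfl
        simp [cut] at hp'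
      -- The constant is 13 = 2 + 4 + 7: two steps, one new root, and the cascading cut.
      · have hr : (h₁.cut x p).val.roots.length = h.roots.length + 1 := rfl
        simp only [potential] at h5 ⊢
        omega
    · have e : h.decreaseKey x a = ⟨h₁, 1⟩ := by
        simp only [decreaseKey, hpar, hlt, if_false]; rfl
      rw [e]
      refine ⟨⟨hF₁, ?_, hR₁⟩, rfl, by simp [potential, marked, hh₁]; omega⟩
      intro y z hz hp
      by_cases hzx : z = x
      · subst hzx
        have hyp : y = p := by
          have : h.parent z = some y := hp
          rw [hpar] at this
          simpa using this.symm
        subst hyp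
        have := hF.parent_ne hx hpar
        simpa [hh₁, Function.update_apply, this.symm] using hlt
      · exact hO₁ y z hz hp hzx

end FibHeap

/-- The logarithmic factor of the running times. -/
def logCard (V : Type) [Fintype V] : ℕ := Nat.log 2 (Fintype.card V) + 1

/-! ### Linking and consolidation. -/

namespace FibHeap

variable {V : Type} [DecidableEq V]

/-- Equality of the ranks is exactly what the rank invariant needs: `y` is put in front of the
children of `x`, and the number of entries behind it equals its own rank. Its mark is cleared, so
nothing has been lost since the link. -/
theorem link_valid {h : FibHeap V} {S : Finset V} (hV : h.Valid S) {x y : V} (hx : x ∈ h.roots)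
    (hy : y ∈ h.roots) (hxy : x ≠ y) (hkey : h.key x ≤ h.key y)
    (hrank : (h.children x).length = (h.children y).length) : (h.link y x).val.Valid S := by
  obtain ⟨hF, hO, hR⟩ := hV
  obtain ⟨hxS, hxp⟩ := (hF.mem_roots x).1 hx
  obtain ⟨hyS, hyp⟩ := (hF.mem_roots y).1 hy
  have hyc : ∀ z, y ∉ h.children z := fun z hz => by
    have := ((hF.mem_children z y).1 hz).2
    simp [hyp] at this
  refine ⟨⟨?_, ?_, ?_, ?_, ?_, ?_⟩, ?_, ?_⟩
  · exact hF.roots_nodup.erase y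
  · intro z
    simp only [link, Timed.val_bind, Timed.val_pure, hF.roots_nodup.mem_erase_iff, hF.mem_roots,
      Function.update_apply]
    by_cases hz : z = y <;> simp [hz]
  · intro z
    simp only [link, Timed.val_bind, Timed.val_pure, Function.update_apply]
    split_ifs
    · exact List.nodup_cons.2 ⟨hyc x, hF.children_nodup x⟩
    · exact hF.children_nodup z
  · intro z w
    simp only [link, Timed.val_bind, Timed.val_pure, Function.update_apply]
    by_cases hw : w = y
    · subst hw
      simp only [if_true, hyS, true_and, Option.some.injEq]
      split_ifs with hz
      · simp [hz]
      · simp only [hyc z, false_iff]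
        exact fun hh => hz hh.symm
    · rw [if_neg hw]
      split_ifs with hz
      · simp [hw, hz, hF.mem_children]
      · exact hF.mem_children z w
  · intro z w
    simp only [link, Timed.val_bind, Timed.val_pure, Function.update_apply]
    split_ifs
    · rintro - hz
      simp only [Option.some.injEq] at hz
      exact hz ▸ hxS
    · exact hF.parent_mem z w
  · obtain ⟨ρ, hρ⟩ := hF.acyclic
    -- Only the height of `x` is raised, above that of its new child and of its old ones. This is
    -- harmless because `x` is a root.
    refine ⟨Function.update ρ x (ρ x + ρ y + 1), fun z w => ?_⟩
    simp only [link, Timed.val_bind, Timed.val_pure, Function.update_apply]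
    split_ifs with h1 h2 h3 h4 h5
    · exact fun _ _ => absurd (h2.symm.trans h1) hxy
    · intro _ hz
      simp only [Option.some.injEq] at hz
      exact absurd hz.symm (by assumption)
    · intro _ _
      subst h1
      omega
    · intro _ hz
      simp only [Option.some.injEq] at hz
      exact absurd hz.symm (by assumption)
    all_goals intro hw hz
    all_goals first
      | (have hwx : w = x := by assumption
         rw [hwx, hxp] at hz
         simp at hz)
      | (have hzx : z = x := by assumption
         have := hρ _ _ hw hz
         rw [hzx] at this
         omega)
      | exact hρ _ _ hw hz
  · intro z w
    simp only [link, Timed.val_bind, Timed.val_pure, Function.update_apply]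
    split_ifs with h1
    · rintro - hz
      simp only [Option.some.injEq] at hz
      rw [← hz, h1]
      exact hkey
    · exact hO z w
  · have hr : ∀ c, c ≠ y → h.markedRank c + 0 ≤ (h.link y x).val.markedRank c + 0 := by
      intro c hc
      simp only [markedRank, link, Timed.val_bind, Timed.val_pure, Function.update_apply,
        if_neg hc]
      by_cases h1 : c = x
      · subst h1
        simp only [if_true, List.length_cons]
        omega
      · simp [h1]
    intro z
    by_cases hz : z = x
    · subst hz
      simp only [link, Timed.val_bind, Timed.val_pure, Function.update_self]
      refine ⟨?_, (hR z).mono fun c hc => hr c fun hcy => hyc z (hcy ▸ hc)⟩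
      simp [markedRank, hxy.symm, hrank]
    · have hch : (h.link y x).val.children z = h.children z := by
        simp [link, hz]
      rw [hch]
      exact (hR z).mono fun c hc => hr c fun hcy => hyc z (hcy ▸ hc)

theorem link_marked [Fintype V] (h : FibHeap V) (y x : V) :
    (h.link y x).val.marked ≤ h.marked :=
  marked_update_false h.mark y

/-- The table `A` and the list `w` together hold the roots, as in the loop of `consolidate`. -/
structure Table (h : FibHeap V) (w : List V) (A : ℕ → Option V) : Prop where
  entry : ∀ i x, A i = some x → x ∈ h.roots ∧ (h.children x).length = i ∧ x ∉ w
  nodup : w.Nodup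
  sub : ∀ x ∈ w, x ∈ h.roots
  cover : ∀ x ∈ h.roots, x ∈ w ∨ A (h.children x).length = some x

theorem Table.push {h : FibHeap V} {x : V} {w : List V} {A : ℕ → Option V}
    (hT : h.Table (x :: w) A) (hA : A (h.children x).length = none) :
    h.Table w (Function.update A (h.children x).length (some x)) := by
  refine ⟨?_, (List.nodup_cons.1 hT.nodup).2, fun z hz => hT.sub z (by simp [hz]), ?_⟩
  · intro i z
    rw [Function.update_apply]
    split_ifs with hi
    · rintro ⟨⟩
      exact ⟨hT.sub x (by simp), hi.symm, (List.nodup_cons.1 hT.nodup).1⟩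
    · intro hz
      obtain ⟨h1, h2, h3⟩ := hT.entry i z hz
      exact ⟨h1, h2, fun hh => h3 (by simp [hh])⟩
  · intro z hz
    rw [Function.update_apply]
    by_cases hzx : z = x
    · simp [hzx]
    rcases hT.cover z hz with h1 | h1
    · simp only [List.mem_cons, hzx, false_or] at h1
      exact Or.inl h1
    · right
      rw [if_neg]
      · exact h1
      · intro hh
        simp [hh, hA] at h1

theorem Table.link {h : FibHeap V} {a b x y : V} {w : List V} {A : ℕ → Option V}
    (hr : h.roots.Nodup) (hT : h.Table (a :: w) A) (hA : A (h.children a).length = some b)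
    (hxy : x = a ∧ y = b ∨ x = b ∧ y = a) :
    (h.link y x).val.Table (x :: w) (Function.update A (h.children a).length none) := by
  obtain ⟨hb, hrank, hbw⟩ := hT.entry _ _ hA
  have hab : a ≠ b := fun hh => hbw (by simp [hh])
  have haw := (List.nodup_cons.1 hT.nodup).1
  have hxw : x ∉ w := by
    rcases hxy with ⟨rfl, rfl⟩ | ⟨rfl, rfl⟩
    · exact haw
    · exact fun hh => hbw (by simp [hh])
  have hroot : ∀ z, z ∈ (h.link y x).val.roots ↔ z ≠ y ∧ z ∈ h.roots := fun z =>
    hr.mem_erase_iff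
  have hch : ∀ z, z ≠ x → (h.link y x).val.children z = h.children z := fun z hz => by
    simp [FibHeap.link, hz]
  refine ⟨?_, List.nodup_cons.2 ⟨hxw, (List.nodup_cons.1 hT.nodup).2⟩, ?_, ?_⟩
  · intro i z
    rw [Function.update_apply]
    split_ifs with hi
    · simp
    · intro hz
      obtain ⟨h1, h2, h3⟩ := hT.entry i z hz
      have hza : z ≠ a := fun hh => h3 (by simp [hh])
      have hzb : z ≠ b := by
        rintro rfl
        exact hi (h2.symm.trans hrank)
      have hzx : z ≠ x := by rcases hxy with ⟨rfl, rfl⟩ | ⟨rfl, rfl⟩ <;> assumption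
      have hzy : z ≠ y := by rcases hxy with ⟨rfl, rfl⟩ | ⟨rfl, rfl⟩ <;> assumption
      refine ⟨(hroot z).2 ⟨hzy, h1⟩, by rw [hch z hzx, h2], ?_⟩
      simp only [List.mem_cons, not_or] at h3 ⊢
      exact ⟨hzx, h3.2⟩
  · intro z hz
    rw [hroot]
    rcases List.mem_cons.1 hz with rfl | hz
    · rcases hxy with ⟨rfl, rfl⟩ | ⟨rfl, rfl⟩
      · exact ⟨hab, hT.sub _ (by simp)⟩
      · exact ⟨hab.symm, hb⟩
    · refine ⟨?_, hT.sub _ (by simp [hz])⟩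
      rintro rfl
      rcases hxy with ⟨rfl, rfl⟩ | ⟨rfl, rfl⟩
      · exact hbw (by simp [hz])
      · exact haw hz
  · intro z hz
    obtain ⟨hzy, hz⟩ := (hroot z).1 hz
    by_cases hzx : z = x
    · simp [hzx]
    have hza : z ≠ a := by rcases hxy with ⟨rfl, rfl⟩ | ⟨rfl, rfl⟩ <;> assumption
    have hzb : z ≠ b := by rcases hxy with ⟨rfl, rfl⟩ | ⟨rfl, rfl⟩ <;> assumption
    rw [hch z hzx, Function.update_apply]
    rcases hT.cover z hz with h1 | h1
    · left
      simp only [List.mem_cons, hza, false_or] at h1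
      simp [h1]
    · right
      rw [if_neg]
      · exact h1
      · intro hh
        rw [hh, hA] at h1
        exact hzb (Option.some.inj h1).symm

/-- Entering a root into the table takes one step and shortens `w`; a link takes two steps and
removes a root while the length of `w` stays the same. Hence w.length + 2 · roots pays for
everything, and w.length + roots bounds the number of rounds. When `w` is empty, every root sits in
the table at the index of its rank, so the ranks are distinct. -/
theorem consolidate_spec [Fintype V] {S : Finset V} : ∀ (f : ℕ) (w : List V) (h : FibHeap V)
    (A : ℕ → Option V), h.Valid S → h.Table w A → w.length + h.roots.length ≤ f →
    (consolidate f w h A).val.Valid S ∧ (consolidate f w h A).val.key = h.key ∧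
      (∀ x ∈ (consolidate f w h A).val.roots, ∀ y ∈ (consolidate f w h A).val.roots,
        ((consolidate f w h A).val.children x).length =
          ((consolidate f w h A).val.children y).length → x = y) ∧
      (consolidate f w h A).val.marked ≤ h.marked ∧
      (consolidate f w h A).steps + 2 * (consolidate f w h A).val.roots.length ≤
        w.length + 2 * h.roots.length := by
  intro f
  induction f with
  | zero =>
    intro w h A hV hT hf
    have hr : h.roots = [] := List.length_eq_zero_iff.1 (by omega)
    refine ⟨hV, rfl, ?_, le_rfl, ?_⟩
    · simp [consolidate, hr]
    · simp [consolidate]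
  | succ f ih =>
    intro w h A hV hT hf
    rcases w with _ | ⟨x, w⟩
    · refine ⟨hV, rfl, ?_, le_rfl, ?_⟩
      · intro x hx y hy hxy
        simp only [consolidate, Timed.val_pure] at hx hy hxy
        have h1 := (hT.cover x hx).resolve_left (by simp)
        have h2 := (hT.cover y hy).resolve_left (by simp)
        rw [hxy, h2] at h1
        exact (Option.some.inj h1).symm
      · simp [consolidate]
    · simp only [List.length_cons] at hf ⊢
      rcases hA : A (h.children x).length with _ | y
      · have e : consolidate (f + 1) (x :: w) h A =
            ⟨(consolidate f w h (Function.update A (h.children x).length (some x))).val,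
              1 + (consolidate f w h
                (Function.update A (h.children x).length (some x))).steps⟩ := by
          simp only [consolidate, hA]; rfl
        obtain ⟨h1, h2, h3, h4, h5⟩ := ih w h _ hV (hT.push hA) (by omega)
        rw [e]
        exact ⟨h1, h2, h3, h4, by simp only; omega⟩
      · obtain ⟨hy, hrank, hyw⟩ := hT.entry _ _ hA
        have hx : x ∈ h.roots := hT.sub x (by simp)
        have hxy : x ≠ y := fun hh => hyw (by simp [hh])
        have hlen : ∀ a b, a ∈ h.roots →
            (h.link a b).val.roots.length + 1 = h.roots.length := fun a b ha => by
          have := List.length_pos_of_mem ha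
          simp only [FibHeap.link, Timed.val_bind, Timed.val_pure,
            List.length_erase_of_mem ha]
          omega
        by_cases hk : h.key x ≤ h.key y
        · have e : consolidate (f + 1) (x :: w) h A =
              ⟨(consolidate f (x :: w) (h.link y x).val
                (Function.update A (h.children x).length none)).val,
                1 + (1 + (consolidate f (x :: w) (h.link y x).val
                  (Function.update A (h.children x).length none)).steps)⟩ := by
            simp only [consolidate, hA, hk, if_true]; rfl
          have hl := hlen y x hy
          obtain ⟨h1, h2, h3, h4, h5⟩ := ih (x :: w) (h.link y x).val _
            (link_valid hV hx hy hxy hk hrank.symm)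
            (hT.link hV.forest.roots_nodup hA (Or.inl ⟨rfl, rfl⟩))
            (by simp only [List.length_cons]; omega)
          rw [e]
          refine ⟨h1, h2, h3, h4.trans (link_marked h y x), ?_⟩
          simp only [List.length_cons] at h5 ⊢
          omega
        · have e : consolidate (f + 1) (x :: w) h A =
              ⟨(consolidate f (y :: w) (h.link x y).val
                (Function.update A (h.children x).length none)).val,
                1 + (1 + (consolidate f (y :: w) (h.link x y).val
                  (Function.update A (h.children x).length none)).steps)⟩ := by
            simp only [consolidate, hA, hk, if_false]; rfl
          have hl := hlen x y hx
          obtain ⟨h1, h2, h3, h4, h5⟩ := ih (y :: w) (h.link x y).val _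
            (link_valid hV hy hx hxy.symm (le_of_not_ge hk) hrank)
            (hT.link hV.forest.roots_nodup hA (Or.inr ⟨rfl, rfl⟩))
            (by simp only [List.length_cons]; omega)
          rw [e]
          refine ⟨h1, h2, h3, h4.trans (link_marked h x y), ?_⟩
          simp only [List.length_cons] at h5 ⊢
          omega

/-! ### The degree bound -/

/-- The descendants of `x`. -/
def desc (h : FibHeap V) (S : Finset V) (x : V) : Finset V :=
  S.filter fun y => Relation.ReflTransGen (fun a b => h.parent a = some b) y x

theorem Forest.lt_of_transGen {h : FibHeap V} {S : Finset V} (hF : h.Forest S) {ρ : V → ℕ}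
    (hρ : ∀ x y, y ∈ S → h.parent y = some x → ρ y < ρ x) {x y : V} (hy : y ∈ S)
    (hyx : Relation.ReflTransGen (fun a b => h.parent a = some b) y x) :
    x ∈ S ∧ ρ y ≤ ρ x := by
  induction hyx with
  | refl => exact ⟨hy, le_rfl⟩
  | tail _ hbc ih => exact ⟨hF.parent_mem _ _ ih.1 hbc, ih.2.trans (hρ _ _ ih.1 hbc).le⟩

/-- Parents are unique, so two ancestors of one node are comparable. A path from one sibling up to
the other would pass through their common parent `x` and then climb to a node lower than `x`. -/
theorem desc_disjoint {h : FibHeap V} {S : Finset V} (hF : h.Forest S) {x c d : V}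
    (hc : c ∈ h.children x) (hd : d ∈ h.children x) (hcd : c ≠ d) :
    Disjoint (h.desc S c) (h.desc S d) := by
  obtain ⟨ρ, hρ⟩ := hF.acyclic
  have key : ∀ c d, c ∈ h.children x → d ∈ h.children x → c ≠ d →
      ¬ Relation.ReflTransGen (fun a b => h.parent a = some b) c d := by
    intro c d hc hd hcd hh
    obtain ⟨hcS, hcx⟩ := (hF.mem_children x c).1 hc
    obtain ⟨hdS, hdx⟩ := (hF.mem_children x d).1 hd
    rcases hh.cases_head with h1 | ⟨e, h1, h2⟩
    · exact hcd h1
    · have hex : e = x := by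
        rw [hcx] at h1
        exact (Option.some.inj h1).symm
      subst hex
      have h3 := hρ _ _ hdS hdx
      have h4 := (hF.lt_of_transGen hρ (hF.parent_mem _ _ hcS hcx) h2).2
      omega
  rw [Finset.disjoint_left]
  intro y hyc hyd
  have hru : Relator.RightUnique (fun a b => h.parent a = some b) := by
    intro a b c hb hc
    exact Option.some.inj (hb.symm.trans hc)
  rcases Relation.ReflTransGen.total_of_right_unique hru (Finset.mem_filter.1 hyc).2
    (Finset.mem_filter.1 hyd).2 with h1 | h1
  · exact key c d hc hd hcd h1
  · exact key d c hd hc hcd.symm h1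

/-- The head has value at least `l.length`, so it contributes Fib(l.length + 1), and the tail
contributes Fib(l.length + 2) − 1 by induction. The Fibonacci recurrence adds them up. -/
theorem RankedList.fib_le {V : Type} {r s : V → ℕ} : ∀ {l : List V}, RankedList r l →
    (∀ c ∈ l, Nat.fib (r c + 1) ≤ s c) → Nat.fib (l.length + 2) ≤ (l.map s).sum + 1
  | [], _, _ => by simp
  | c :: l, hl, hs => by
    have h1 := RankedList.fib_le hl.2 fun d hd => hs d (by simp [hd])
    have h2 : Nat.fib (l.length + 1) ≤ s c :=
      (Nat.fib_mono (by have := hl.1; omega)).trans (hs c (by simp))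
    have h3 : Nat.fib (l.length + 3) = Nat.fib (l.length + 1) + Nat.fib (l.length + 2) :=
      Nat.fib_add_two
    simp only [List.length_cons, List.map_cons, List.sum_cons]
    have h4 : l.length + 1 + 2 = l.length + 3 := by ring
    rw [h4, h3]
    omega

/-- Induction on the height. A child of rank r has at least Fib(r + 2) descendants, and its mark
adds at most one to r, so Fib of the marked rank plus one is a valid lower bound. The subtrees of
the children are disjoint, and `x` itself supplies the missing 1 in `RankedList.fib_le`. -/
theorem fib_le_card_desc {h : FibHeap V} {S : Finset V} (hV : h.Valid S) {x : V} (hx : x ∈ S) :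
    Nat.fib ((h.children x).length + 2) ≤ (h.desc S x).card := by
  obtain ⟨hF, -, hR⟩ := hV
  obtain ⟨ρ, hρ⟩ := hF.acyclic
  induction hn : ρ x using Nat.strong_induction_on generalizing x with
  | _ n ih =>
    have h1 : ∀ c ∈ h.children x, Nat.fib (h.markedRank c + 0 + 1) ≤ (h.desc S c).card := by
      intro c hc
      obtain ⟨hcS, hcx⟩ := (hF.mem_children x c).1 hc
      have h2 := ih (ρ c) (hn ▸ hρ _ _ hcS hcx) hcS rfl
      refine le_trans (Nat.fib_mono ?_) h2
      simp only [markedRank]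
      split_ifs <;> omega
    refine (RankedList.fib_le (hR x) h1).trans ?_
    have h2 : ((h.children x).map fun c => (h.desc S c).card).sum =
        ((h.children x).toFinset.biUnion (h.desc S)).card := by
      rw [Finset.card_biUnion, List.sum_toFinset _ (hF.children_nodup x)]
      intro c hc d hd hcd
      exact desc_disjoint hF (List.mem_toFinset.1 hc) (List.mem_toFinset.1 hd) hcd
    rw [h2, ← Finset.card_insert_of_notMem (a := x)]
    · apply Finset.card_le_card
      intro y hy
      rcases Finset.mem_insert.1 hy with rfl | hy
      · exact Finset.mem_filter.2 ⟨hx, .refl⟩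
      · obtain ⟨c, hc, hyc⟩ := Finset.mem_biUnion.1 hy
        obtain ⟨hyS, hyc⟩ := Finset.mem_filter.1 hyc
        exact Finset.mem_filter.2 ⟨hyS, hyc.tail
          ((hF.mem_children x c).1 (List.mem_toFinset.1 hc)).2⟩
    · intro hy
      obtain ⟨c, hc, hyc⟩ := Finset.mem_biUnion.1 hy
      obtain ⟨hcS, hcx⟩ := (hF.mem_children x c).1 (List.mem_toFinset.1 hc)
      have h3 := hρ _ _ hcS hcx
      have h4 := (hF.lt_of_transGen hρ hx (Finset.mem_filter.1 hyc).2).2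
      omega

theorem two_pow_le_fib : ∀ k : ℕ, 2 ^ k ≤ Nat.fib (2 * k + 2)
  | 0 => by simp
  | k + 1 => by
    have h1 := two_pow_le_fib k
    have h2 : Nat.fib (2 * (k + 1) + 2) = Nat.fib (2 * k + 2) + Nat.fib (2 * k + 3) :=
      Nat.fib_add_two
    have h3 : Nat.fib (2 * k + 2) ≤ Nat.fib (2 * k + 3) := Nat.fib_mono (by omega)
    rw [pow_succ]
    omega

theorem rank_le [Fintype V] {h : FibHeap V} {S : Finset V} (hV : h.Valid S) {x : V} (hx : x ∈ S) :
    (h.children x).length + 1 ≤ 2 * logCard V := by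
  have h1 := fib_le_card_desc hV hx
  -- Fibonacci numbers at least double every two indices, whence the factor 2 before the logarithm.
  have h2 : 2 ^ ((h.children x).length / 2) ≤ Fintype.card V :=
    (two_pow_le_fib _).trans ((Nat.fib_mono (by omega)).trans (h1.trans (Finset.card_le_univ _)))
  have h3 := Nat.le_log_of_pow_le (by norm_num) h2
  unfold logCard
  omega

theorem roots_length_le [Fintype V] {h : FibHeap V} {S : Finset V} (hV : h.Valid S)
    (hd : ∀ x ∈ h.roots, ∀ y ∈ h.roots,
      (h.children x).length = (h.children y).length → x = y) :
    h.roots.length ≤ 2 * logCard V := by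
  rw [← List.toFinset_card_of_nodup hV.forest.roots_nodup,
    ← Finset.card_range (2 * logCard V)]
  refine Finset.card_le_card_of_injOn (fun x => (h.children x).length) ?_ ?_
  · intro x hx
    have := rank_le hV ((hV.forest.mem_roots x).1 (List.mem_toFinset.1 hx)).1
    simp only [Finset.coe_range, Set.mem_Iio]
    omega
  · intro x hx y hy hxy
    exact hd x (List.mem_toFinset.1 hx) y (List.mem_toFinset.1 hy) hxy

/-! ### Removal of the minimum -/

/-- Climbing to the parent never increases the key, and the climb ends because heights are bounded
on the finite item set. So scanning the roots finds the overall minimum. -/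
theorem exists_root_le {h : FibHeap V} {S : Finset V} (hV : h.Valid S) {y : V} (hy : y ∈ S) :
    ∃ x ∈ h.roots, h.key x ≤ h.key y := by
  obtain ⟨hF, hO, -⟩ := hV
  obtain ⟨ρ, hρ⟩ := hF.acyclic
  obtain ⟨N, hN⟩ : ∃ N, ∀ z ∈ S, ρ z ≤ N := ⟨S.sup ρ, fun z hz => Finset.le_sup hz⟩
  induction hn : N - ρ y using Nat.strong_induction_on generalizing y with
  | _ n ih =>
    rcases hp : h.parent y with _ | p
    · exact ⟨y, (hF.mem_roots y).2 ⟨hy, hp⟩, le_rfl⟩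
    · have hpS := hF.parent_mem _ _ hy hp
      have h1 := hρ _ _ hy hp
      have h2 := hN p hpS
      obtain ⟨x, hx, hxp⟩ := ih (N - ρ p) (by omega) hpS rfl
      exact ⟨x, hx, hxp.trans (hO _ _ hy hp)⟩

theorem minRoot_spec (key : V → EReal) : ∀ (l : List V) (r : V),
    let x := (forEach l r fun b a => pure (if key a < key b then a else b))
    x.val ∈ r :: l ∧ (∀ y ∈ r :: l, key x.val ≤ key y) ∧ x.steps = l.length + 1
  | [], r => by simp [forEach]
  | a :: l, r => by
    obtain ⟨h1, h2, h3⟩ := minRoot_spec key l (if key a < key r then a else r)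
    simp only [forEach, Timed.val_bind, Timed.steps_bind, Timed.val_pure, Timed.steps_pure,
      tick_steps, List.length_cons]
    refine ⟨?_, ?_, by rw [h3]; omega⟩
    · rcases List.mem_cons.1 h1 with h1 | h1
      · rw [h1]
        split_ifs <;> simp
      · simp [h1]
    · intro y hy
      have h4 := h2 _ List.mem_cons_self
      have h5 : key (if key a < key r then a else r) ≤ key r ∧
          key (if key a < key r then a else r) ≤ key a := by
        split_ifs with hlt
        · exact ⟨hlt.le, le_rfl⟩
        · exact ⟨le_rfl, not_lt.1 hlt⟩
      simp only [List.mem_cons] at hy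
      rcases hy with rfl | rfl | hy
      · exact h4.trans h5.1
      · exact h4.trans h5.2
      · exact h2 y (by simp [hy])

theorem promote_spec : ∀ (l : List V) (h : FibHeap V),
    (forEach l h fun g c =>
      (pure { g with parent := Function.update g.parent c none, roots := c :: g.roots } :
        Timed (FibHeap V))) =
      ⟨{ h with
          parent := fun y => if y ∈ l then none else h.parent y
          roots := l.reverse ++ h.roots }, l.length + 1⟩
  | [], h => by simp [forEach]; rfl
  | c :: l, h => by
    have ih := promote_spec l
      { h with parent := Function.update h.parent c none, roots := c :: h.roots }
    have e : (forEach (c :: l) h fun g c =>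
      (pure { g with parent := Function.update g.parent c none, roots := c :: g.roots } :
        Timed (FibHeap V))) =
      ⟨(forEach l { h with parent := Function.update h.parent c none, roots := c :: h.roots }
          fun g c => (pure { g with
            parent := Function.update g.parent c none, roots := c :: g.roots } :
              Timed (FibHeap V))).val, 1 + (0 +
        (forEach l { h with parent := Function.update h.parent c none, roots := c :: h.roots }
          fun g c => (pure { g with
            parent := Function.update g.parent c none, roots := c :: g.roots } :
              Timed (FibHeap V))).steps)⟩ := rfl
    rw [e, ih]
    simp only [List.length_cons, Timed.mk.injEq, FibHeap.mk.injEq, true_and]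
    refine ⟨⟨?_, by simp⟩, by omega⟩
    funext y
    simp only [List.mem_cons, Function.update_apply]
    split_ifs <;> simp_all

/-- The heap after removing the root `x` and before the consolidation. -/
def removeRoot (h : FibHeap V) (x : V) : FibHeap V where
  key := h.key
  parent := fun y => if y ∈ h.children x then none else h.parent y
  children := Function.update h.children x []
  mark := h.mark
  roots := (h.children x).reverse ++ h.roots.erase x

theorem removeRoot_valid {h : FibHeap V} {S : Finset V} (hV : h.Valid S) {x : V}
    (hx : x ∈ h.roots) : (h.removeRoot x).Valid (S.erase x) := by
  obtain ⟨hF, hO, hR⟩ := hV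
  obtain ⟨hxS, hxp⟩ := (hF.mem_roots x).1 hx
  have hxc : ∀ y, x ∉ h.children y := fun y hy => by
    have := ((hF.mem_children y x).1 hy).2
    simp [hxp] at this
  have hpar : ∀ y z, (h.removeRoot x).parent z = some y → h.parent z = some y := by
    intro y z
    simp only [removeRoot]
    split_ifs <;> simp
  refine ⟨⟨?_, ?_, ?_, ?_, ?_, ?_⟩, ?_, ?_⟩
  · simp only [removeRoot]
    rw [List.nodup_append']
    refine ⟨List.nodup_reverse.2 (hF.children_nodup x), hF.roots_nodup.erase x, ?_⟩
    intro y hy hy'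
    have h1 := ((hF.mem_children x y).1 (List.mem_reverse.1 hy)).2
    have h2 := ((hF.mem_roots y).1 (List.mem_of_mem_erase hy')).2
    simp [h1] at h2
  · intro y
    simp only [removeRoot, List.mem_append, List.mem_reverse, hF.roots_nodup.mem_erase_iff,
      hF.mem_roots, Finset.mem_erase]
    by_cases hy : y ∈ h.children x
    · have : y ≠ x := fun hh => hxc x (hh ▸ hy)
      simp [hy, this, ((hF.mem_children x y).1 hy).1]
    · simp [hy, and_assoc]
  · intro y
    simp only [removeRoot, Function.update_apply]
    split_ifs
    · exact List.nodup_nil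
    · exact hF.children_nodup y
  · intro y z
    simp only [removeRoot, Function.update_apply, Finset.mem_erase]
    by_cases hy : y = x
    · subst hy
      simp only [if_true, List.not_mem_nil, false_iff, not_and]
      rintro ⟨h1, h2⟩
      split_ifs with h3
      · simp
      · exact fun h4 => h3 ((hF.mem_children y z).2 ⟨h2, h4⟩)
    · rw [if_neg hy, hF.mem_children]
      by_cases hz : z ∈ h.children x
      · have := ((hF.mem_children x z).1 hz).2
        simp only [hz, if_true, reduceCtorEq, and_false, iff_false, not_and]
        rintro - h2
        rw [this] at h2
        exact hy (Option.some.inj h2).symm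
      · simp only [hz, if_false]
        constructor
        · rintro ⟨h1, h2⟩
          refine ⟨⟨?_, h1⟩, h2⟩
          rintro rfl
          simp [hxp] at h2
        · rintro ⟨⟨-, h1⟩, h2⟩
          exact ⟨h1, h2⟩
  · intro y z hz hp
    have hz' := Finset.mem_of_mem_erase hz
    refine Finset.mem_erase.2 ⟨?_, hF.parent_mem _ _ hz' (hpar _ _ hp)⟩
    rintro rfl
    have := (hF.mem_children y z).2 ⟨hz', hpar _ _ hp⟩
    simp [removeRoot, this] at hp
  · obtain ⟨ρ, hρ⟩ := hF.acyclic
    exact ⟨ρ, fun y z hz hp => hρ _ _ (Finset.mem_of_mem_erase hz) (hpar _ _ hp)⟩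
  · exact fun y z hz hp => hO _ _ (Finset.mem_of_mem_erase hz) (hpar _ _ hp)
  · intro y
    simp only [removeRoot, Function.update_apply]
    split_ifs with hy
    · trivial
    · refine (hR y).mono fun c hc => ?_
      have : c ≠ x := fun hh => hxc y (hh ▸ hc)
      simp [markedRank, this]

/-- All work proportional to the number of old roots is paid by the potential they release. What
remains is proportional to the rank of the removed node and to the number of roots after
consolidation, both logarithmic. -/
theorem popMin_spec [Fintype V] {h : FibHeap V} {S : Finset V} (hV : h.Valid S) :
    (S = ∅ → h.popMin = ⟨none, 1⟩) ∧
    (S.Nonempty → ∃ x ∈ S, ∃ h' : FibHeap V, h.popMin.val = some (x, h') ∧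
      h'.Valid (S.erase x) ∧ h'.key = h.key ∧ (∀ y ∈ S, h.key x ≤ h.key y) ∧
      h.popMin.steps + h'.potential ≤ h.potential + 20 * logCard V) := by
  constructor
  · rintro rfl
    have hr : h.roots = [] := List.eq_nil_iff_forall_not_mem.2 fun x hx => by
      simpa using ((hV.forest.mem_roots x).1 hx).1
    simp only [popMin, hr]
    rfl
  · rintro ⟨y₀, hy₀⟩
    obtain ⟨x₀, hx₀, -⟩ := exists_root_le hV hy₀
    rcases hr : h.roots with _ | ⟨r, rs⟩
    · simp [hr] at hx₀
    obtain ⟨h1, h2, h3⟩ := minRoot_spec h.key rs r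
    set m := forEach rs r fun b a => (pure (if h.key a < h.key b then a else b) : Timed V)
      with hm
    have hx : m.val ∈ h.roots := by rw [hr]; exact h1
    set h₂ := h.removeRoot m.val with hh₂
    have hV₂ : h₂.Valid (S.erase m.val) := removeRoot_valid hV hx
    have hT : h₂.Table h₂.roots fun _ => none :=
      ⟨by simp, hV₂.forest.roots_nodup, fun _ => id, fun _ => Or.inl⟩
    obtain ⟨c1, c2, c3, c4, c5⟩ := consolidate_spec (2 * h₂.roots.length) h₂.roots h₂ _ hV₂ hT
      (by omega)
    set g := consolidate (2 * h₂.roots.length) h₂.roots h₂ (fun _ => none) with hg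
    have e : h.popMin = ⟨some (m.val, g.val), 1 + (m.steps + (((h.children m.val).length + 1) +
        (g.steps + (g.val.roots.length + 0))))⟩ := by
      simp only [popMin, hr]
      rw [← hm, ← hr]
      simp only [promote_spec]
      rfl
    have hrS := ((hV.forest.mem_roots _).1 hx).1
    refine ⟨m.val, hrS, g.val, by rw [e], c1, c2, ?_, ?_⟩
    · intro y hy
      obtain ⟨z, hz, hzy⟩ := exists_root_le hV hy
      exact (h2 z (hr ▸ hz)).trans hzy
    · rw [e]
      -- With R old roots, c children of the minimum and R' final roots, the steps and the new
      -- potential come to at most 4R + 4c + 3R' plus the unchanged marks. The term 4R is released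
      -- potential; c and R' are each at most 2 · `logCard V`.
      have h6 := rank_le hV hrS
      have h7 := roots_length_le c1 c3
      have h8 : h₂.roots.length + 1 = (h.children m.val).length + h.roots.length := by
        have := List.length_pos_of_mem hx
        simp only [hh₂, removeRoot, List.length_append, List.length_reverse,
          List.length_erase_of_mem hx]
        omega
      have h9 : h.roots.length = rs.length + 1 := by rw [hr]; rfl
      have h10 : h₂.marked = h.marked := rfl
      simp only [potential]
      omega

end FibHeap

variable {V : Type} [Fintype V] [DecidableEq V]

/-! ## Walks and Dijkstra's algorithm -/

/-- Edges join vertices, and edge lengths are positive. -/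
structure WGraph.WF (G : WGraph V) : Prop where
  mem_verts : ∀ x y, s(x, y) ∈ G.edges → x ∈ G.verts
  pos : ∀ e ∈ G.edges, 0 < G.len e

/-- There is a walk of length `L` from `t` to `x`. -/
inductive WGraph.Reach (G : WGraph V) (t : V) : V → ℝ → Prop
  | refl : Reach G t t 0
  | step {x y : V} {L : ℝ} : Reach G t x L → s(x, y) ∈ G.edges → Reach G t y (L + G.len s(x, y))

namespace WGraph

theorem WF.mem_verts' {G : WGraph V} (hG : G.WF) {x y : V} (h : s(x, y) ∈ G.edges) :
    y ∈ G.verts :=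
  hG.mem_verts y x (Sym2.eq_swap ▸ h)

theorem mem_adj {G : WGraph V} (hG : G.WF) {x y : V} : y ∈ G.adj x ↔ s(x, y) ∈ G.edges := by
  simp only [adj, Finset.mem_toList, Finset.mem_filter, and_iff_right_iff_imp]
  exact fun h => hG.mem_verts' h

/-- `res x` is the minimum of `v₀ t + α * L` over the walks from terminals `t` to `x`, where `L` is
the length of the walk. -/
structure IsPotential (G : WGraph V) (v₀ : V → Option ℝ) (α : ℝ) (res : V → EReal) : Prop where
  attained : ∀ x ∈ G.verts, res x = ⊤ ∨
    ∃ t a L, v₀ t = some a ∧ G.Reach t x L ∧ res x = ((a + α * L : ℝ) : EReal)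
  terminal : ∀ x ∈ G.verts, ∀ a : ℝ, v₀ x = some a → res x ≤ (a : EReal)
  edge : ∀ x y, s(x, y) ∈ G.edges → res y ≤ res x + ((α * G.len s(x, y) : ℝ) : EReal)

end WGraph

/-- The relaxation of the edges at `x`. -/
def relax (G : WGraph V) (α : ℝ) (x : V) (d : EReal) (finished : V → Bool) (g : FibHeap V) (y : V) :
    Timed (FibHeap V) :=
  if finished y = false ∧ d + ((α * G.len s(x, y) : ℝ) : EReal) < g.key y then
    g.decreaseKey y (d + ((α * G.len s(x, y) : ℝ) : EReal))
  else pure g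

theorem relax_spec (G : WGraph V) (hG : G.WF) (α : ℝ) (x : V) (d : EReal) (finished : V → Bool)
    (S : Finset V) (hfin : ∀ y ∈ G.verts, finished y = false ↔ y ∈ S) (h : FibHeap V)
    (hV : h.Valid S) :
    let g := forEach (G.adj x) h (relax G α x d finished)
    g.val.Valid S ∧
      (∀ y ∈ S, g.val.key y ≤ h.key y ∧ (g.val.key y = h.key y ∨
        s(x, y) ∈ G.edges ∧ g.val.key y = d + ((α * G.len s(x, y) : ℝ) : EReal))) ∧
      (∀ y ∈ S, s(x, y) ∈ G.edges → g.val.key y ≤ d + ((α * G.len s(x, y) : ℝ) : EReal)) ∧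
      g.steps + g.val.potential ≤ h.potential + 14 * (G.adj x).length + 1 := by
  obtain ⟨⟨h1, h2, h3, -⟩, h4⟩ := forEach_spec (fun l (g : FibHeap V) => g.Valid S ∧
      (∀ y ∈ S, g.key y ≤ h.key y ∧ (g.key y = h.key y ∨
        s(x, y) ∈ G.edges ∧ g.key y = d + ((α * G.len s(x, y) : ℝ) : EReal))) ∧
      (∀ y ∈ S, s(x, y) ∈ G.edges → y ∈ l ∨
        g.key y ≤ d + ((α * G.len s(x, y) : ℝ) : EReal)) ∧
      ∀ y ∈ l, s(x, y) ∈ G.edges) FibHeap.potential 13 (relax G α x d finished) (by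
    rintro y l g ⟨h1, h2, h3, h4⟩
    have hy := h4 y (by simp)
    have hl : ∀ z ∈ l, s(x, z) ∈ G.edges := fun z hz => h4 z (by simp [hz])
    by_cases hc : finished y = false ∧ d + ((α * G.len s(x, y) : ℝ) : EReal) < g.key y
    · rw [relax, if_pos hc]
      have hyS := (hfin y (hG.mem_verts' hy)).1 hc.1
      obtain ⟨g1, g2, g3⟩ := FibHeap.decreaseKey_spec h1 hyS hc.2.le
      refine ⟨⟨g1, ?_, ?_, hl⟩, g3⟩
      · intro z hz
        rw [g2, Function.update_apply]
        split_ifs with hzy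
        · subst hzy
          exact ⟨hc.2.le.trans (h2 z hz).1, Or.inr ⟨hy, rfl⟩⟩
        · exact h2 z hz
      · intro z hz hxz
        rw [g2, Function.update_apply]
        split_ifs with hzy
        · subst hzy
          exact Or.inr le_rfl
        · have := h3 z hz hxz
          simpa [hzy] using this
    · rw [relax, if_neg hc]
      refine ⟨⟨h1, h2, ?_, hl⟩, by simp⟩
      intro z hz hxz
      by_cases hzy : z = y
      · subst hzy
        have := (hfin z (hG.mem_verts' hy)).2 hz
        exact Or.inr (not_lt.1 fun hlt => hc ⟨this, hlt⟩)
      · simpa [hzy] using h3 z hz hxz) (G.adj x) h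
    ⟨hV, fun y _ => ⟨le_rfl, Or.inl rfl⟩,
      fun y _ hy => Or.inl ((WGraph.mem_adj hG).2 hy), fun y hy => (WGraph.mem_adj hG).1 hy⟩
  exact ⟨h1, h2, fun y hy hxy => (h3 y hy hxy).resolve_left (by simp), h4⟩

/-- The invariant of the main loop of Dijkstra's algorithm; `S` is the set of items on the heap. -/
structure DijkstraInv (G : WGraph V) (v₀ : V → Option ℝ) (α : ℝ) (S : Finset V) (h : FibHeap V)
    (v : V → EReal) (finished : V → Bool) : Prop where
  valid : h.Valid S
  sub : S ⊆ G.verts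
  fin : ∀ x ∈ G.verts, finished x = false ↔ x ∈ S
  attained : ∀ x ∈ G.verts, (if x ∈ S then h.key x else v x) = ⊤ ∨
    ∃ t a L, v₀ t = some a ∧ G.Reach t x L ∧
      (if x ∈ S then h.key x else v x) = ((a + α * L : ℝ) : EReal)
  terminal : ∀ x ∈ G.verts, ∀ a : ℝ, v₀ x = some a →
    (if x ∈ S then h.key x else v x) ≤ (a : EReal)
  edge : ∀ x y, x ∉ S → s(x, y) ∈ G.edges →
    (if y ∈ S then h.key y else v y) ≤ v x + ((α * G.len s(x, y) : ℝ) : EReal)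
  mono : ∀ x ∈ G.verts, x ∉ S → ∀ y ∈ S, v x ≤ h.key y

/-- The greedy step: since `α` and the lengths are nonnegative, relaxing the edges at a minimum `x`
never produces a key below that of `x`. So the finished values stay below the remaining keys. -/
theorem DijkstraInv.step {G : WGraph V} (hG : G.WF) {v₀ : V → Option ℝ} {α : ℝ} (hα : 0 ≤ α)
    {S : Finset V} {h : FibHeap V} {v : V → EReal} {finished : V → Bool}
    (hI : DijkstraInv G v₀ α S h v finished) {x : V} (hx : x ∈ S) {g : FibHeap V}
    (hmin : ∀ y ∈ S, h.key x ≤ h.key y) (hg : g.Valid (S.erase x))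
    (hkey : ∀ y ∈ S.erase x, g.key y ≤ h.key y ∧ (g.key y = h.key y ∨
        s(x, y) ∈ G.edges ∧ g.key y = h.key x + ((α * G.len s(x, y) : ℝ) : EReal)))
    (hedge : ∀ y ∈ S.erase x, s(x, y) ∈ G.edges →
      g.key y ≤ h.key x + ((α * G.len s(x, y) : ℝ) : EReal)) :
    DijkstraInv G v₀ α (S.erase x) g (Function.update v x (h.key x))
      (Function.update finished x true) := by
  have hnn : ∀ y, s(x, y) ∈ G.edges →
      h.key x ≤ h.key x + ((α * G.len s(x, y) : ℝ) : EReal) := fun y hy =>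
    le_add_of_nonneg_right (by exact_mod_cast mul_nonneg hα (hG.pos _ hy).le)
  have hval : ∀ y, (if y ∈ S.erase x then g.key y else Function.update v x (h.key x) y) ≤
      (if y ∈ S then h.key y else v y) := by
    intro y
    by_cases hyx : y = x
    · subst hyx
      simp [hx]
    · by_cases hy : y ∈ S
      · have := (hkey y (Finset.mem_erase.2 ⟨hyx, hy⟩)).1
        simpa [hyx, hy] using this
      · simp [hyx, hy]
  refine ⟨hg, (Finset.erase_subset _ _).trans hI.sub, ?_, ?_, ?_, ?_, ?_⟩
  · intro y hy
    by_cases hyx : y = x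
    · simp [hyx]
    · simpa [hyx] using hI.fin y hy
  · intro y hy
    by_cases hyS : y ∈ S.erase x
    · rw [if_pos hyS]
      have hyS' := Finset.mem_of_mem_erase hyS
      rcases (hkey y hyS).2 with h1 | ⟨h1, h2⟩
      · rw [h1]
        simpa [hyS'] using hI.attained y hy
      · have h3 := hI.attained x (hI.sub hx)
        rw [if_pos hx] at h3
        rcases h3 with h3 | ⟨t, a, L, h3, h4, h5⟩
        · left
          rw [h2, h3, EReal.top_add_coe]
        · right
          refine ⟨t, a, _, h3, h4.step h1, ?_⟩
          rw [h2, h5, ← EReal.coe_add]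
          congr 1
          ring
    · rw [if_neg hyS]
      have h3 := hI.attained y hy
      by_cases hyx : y = x
      · subst hyx
        simpa [hx] using h3
      · have : y ∉ S := fun hh => hyS (Finset.mem_erase.2 ⟨hyx, hh⟩)
        simpa [hyx, this] using h3
  · exact fun y hy a ha => (hval y).trans (hI.terminal y hy a ha)
  · intro z y hz hzy
    by_cases hzx : z = x
    · subst hzx
      rw [Function.update_self]
      by_cases hy : y ∈ S.erase z
      · rw [if_pos hy]
        exact hedge y hy hzy
      · rw [if_neg hy]
        -- Edges back to finished vertices are never relaxed and need not be: such a value is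
        -- already at most the key of `z`.
        refine le_trans ?_ (hnn y hzy)
        by_cases hyz : y = z
        · simp [hyz]
        · rw [Function.update_of_ne hyz]
          exact hI.mono y (hG.mem_verts' hzy)
            (fun hh => hy (Finset.mem_erase.2 ⟨hyz, hh⟩)) z hx
    · rw [Function.update_of_ne hzx]
      exact (hval y).trans (hI.edge z y (fun hh => hz (Finset.mem_erase.2 ⟨hzx, hh⟩)) hzy)
  · intro z hz hzS y hy
    have hyS' := Finset.mem_of_mem_erase hy
    have h1 : Function.update v x (h.key x) z ≤ h.key x := by
      by_cases hzx : z = x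
      · simp [hzx]
      · rw [Function.update_of_ne hzx]
        exact hI.mono z hz (fun hh => hzS (Finset.mem_erase.2 ⟨hzx, hh⟩)) x hx
    refine h1.trans ?_
    rcases (hkey y hy).2 with h2 | ⟨h2, h3⟩
    · rw [h2]
      exact hmin y hyS'
    · rw [h3]
      exact hnn y h2

/-- The heap potential carries the credit from round to round: a round at `x` has amortized cost 20
· `logCard V` for the removal and 14 per incident edge. -/
theorem dijkstraLoop_spec (G : WGraph V) (hG : G.WF) (v₀ : V → Option ℝ) (α : ℝ) (hα : 0 ≤ α) :
    ∀ (f : ℕ) (S : Finset V) (h : FibHeap V) (v : V → EReal) (finished : V → Bool),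
    DijkstraInv G v₀ α S h v finished → S.card ≤ f →
    G.IsPotential v₀ α (dijkstraLoop G α f h v finished).val ∧
      (dijkstraLoop G α f h v finished).steps ≤ h.potential +
        ∑ x ∈ S, (20 * logCard V + 14 * (G.adj x).length + 1) + 1 := by
  have done : ∀ (h : FibHeap V) (v : V → EReal) (finished : V → Bool),
      DijkstraInv G v₀ α ∅ h v finished → G.IsPotential v₀ α v := by
    intro h v finished hI
    exact ⟨fun x hx => by simpa using hI.attained x hx,
      fun x hx a ha => by simpa using hI.terminal x hx a ha,
      fun x y hxy => by simpa using hI.edge x y (by simp) hxy⟩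
  intro f
  induction f with
  | zero =>
    intro S h v finished hI hS
    obtain rfl : S = ∅ := by simpa using hS
    exact ⟨done h v finished hI, by simp [dijkstraLoop]⟩
  | succ f ih =>
    intro S h v finished hI hS
    obtain ⟨p1, p2⟩ := FibHeap.popMin_spec hI.valid
    rcases S.eq_empty_or_nonempty with rfl | hne
    · have e : dijkstraLoop G α (f + 1) h v finished = ⟨v, 1⟩ := by
        simp only [dijkstraLoop, p1 rfl]; rfl
      rw [e]
      exact ⟨done h v finished hI, by simp⟩
    · obtain ⟨x, hx, h', hp, hV, hk, hmin, hst⟩ := p2 hne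
      set d := h.key x with hd
      set fin' := Function.update finished x true with hfin'
      set v' := Function.update v x d with hv'
      have e : dijkstraLoop G α (f + 1) h v finished =
          ⟨(dijkstraLoop G α f (forEach (G.adj x) h' (relax G α x d fin')).val v' fin').val,
            h.popMin.steps + ((forEach (G.adj x) h' (relax G α x d fin')).steps +
              (dijkstraLoop G α f (forEach (G.adj x) h'
                (relax G α x d fin')).val v' fin').steps)⟩ := by
        have hvx : v' x = d := by simp [hv']
        rcases hpm : h.popMin with ⟨val, st⟩
        rw [hpm] at hp
        simp only at hp
        subst hp
        simp only [dijkstraLoop, hpm]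
        simp only [bind, ← hfin', hk, ← hd, ← hv', hvx]
        rfl
      have hfin : ∀ y ∈ G.verts, fin' y = false ↔ y ∈ S.erase x := by
        intro y hy
        by_cases hyx : y = x
        · simp [hfin', hyx]
        · simpa [hfin', hyx] using hI.fin y hy
      obtain ⟨r1, r2, r3, r4⟩ := relax_spec G hG α x d fin' (S.erase x) hfin h' hV
      rw [hk] at r2
      have hI' : DijkstraInv G v₀ α (S.erase x) _ v' fin' :=
        hI.step hG hα hx hmin r1 r2 r3
      obtain ⟨i1, i2⟩ := ih (S.erase x) _ _ _ hI' (by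
        rw [Finset.card_erase_of_mem hx]
        omega)
      rw [e]
      refine ⟨i1, ?_⟩
      rw [← Finset.add_sum_erase S _ hx]
      simp only at r4 i2 ⊢
      omega

/-- Double counting of incidences: an edge has at most two end points. -/
theorem sum_adj_length_le (G : WGraph V) (hG : G.WF) :
    ∑ x ∈ G.verts, (G.adj x).length ≤ 2 * G.edges.card := by
  have h1 : ∀ x, (G.adj x).length = ∑ e ∈ G.edges, if x ∈ e then 1 else 0 := by
    intro x
    rw [← Finset.card_filter, WGraph.adj, Finset.length_toList]
    apply Finset.card_bij (fun y _ => s(x, y))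
    · intro y hy
      simp only [Finset.mem_filter] at hy ⊢
      exact ⟨hy.2, Sym2.mem_mk_left x y⟩
    · intro y _ z _ hyz
      exact Sym2.congr_right.1 hyz
    · intro e he
      obtain ⟨he, hxe⟩ := Finset.mem_filter.1 he
      obtain ⟨y, rfl⟩ := Sym2.mem_iff_exists.1 hxe
      exact ⟨y, Finset.mem_filter.2 ⟨hG.mem_verts' he, he⟩, rfl⟩
  simp only [h1]
  rw [Finset.sum_comm, mul_comm, ← smul_eq_mul, ← Finset.sum_const]
  refine Finset.sum_le_sum fun e _ => ?_
  rw [← Finset.card_filter]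
  induction e using Sym2.ind with
  | _ a b =>
    refine (Finset.card_le_card (t := {a, b}) ?_).trans Finset.card_le_two
    intro x hx
    simpa using (Finset.mem_filter.1 hx).2

/-- The input size that governs the running times. -/
def WGraph.size (G : WGraph V) : ℕ := G.edges.card + G.verts.card * logCard V

theorem WGraph.card_verts_le_size (G : WGraph V) : G.verts.card ≤ G.size :=
  (Nat.le_mul_of_pos_right _ (by simp [logCard])).trans (Nat.le_add_left _ _)

theorem modDijkstra_spec (G : WGraph V) (hG : G.WF) (v₀ : V → Option ℝ) {α : ℝ} (hα : 0 ≤ α) :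
    G.IsPotential v₀ α (modDijkstra G v₀ α).val ∧
      (modDijkstra G v₀ α).steps ≤ 50 * G.size + 3 := by
  obtain ⟨⟨a1, a2, -⟩, a3⟩ := forEach_spec (fun l (h : FibHeap V) =>
      h.Valid (G.verts \ l.toFinset) ∧ (∀ x, h.key x = ⊤) ∧ l.Nodup ∧ ∀ x ∈ l, x ∈ G.verts)
    FibHeap.potential 5 (fun h x => h.insert x ⊤) (by
      rintro x l h ⟨h1, h2, h3, h4⟩
      rw [List.nodup_cons] at h3
      obtain ⟨g1, g2, g3⟩ := FibHeap.insert_spec h1 (x := x) (by simp) ⊤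
      refine ⟨⟨?_, ?_, h3.2, fun y hy => h4 y (by simp [hy])⟩, g3⟩
      · convert g1 using 1
        ext y
        by_cases hyx : y = x
        · subst hyx
          simp [h4 y (by simp), h3.1]
        · simp [hyx]
      · intro y
        rw [g2, Function.update_apply]
        simp [h2]) G.verts.toList FibHeap.empty
    ⟨by simpa using FibHeap.empty_valid, fun _ => rfl, Finset.nodup_toList _, by simp⟩
  set h₀ := forEach G.verts.toList FibHeap.empty fun h x => h.insert x ⊤ with hh₀
  obtain ⟨⟨b1, b2, -⟩, b3⟩ := forEach_spec (fun l (h : FibHeap V) =>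
      h.Valid G.verts ∧
        (∀ x ∈ G.verts, h.key x = if x ∈ l then ⊤ else ((v₀ x).elim ⊤ fun a => (a : EReal))) ∧
        l.Nodup ∧ ∀ x ∈ l, x ∈ G.verts)
    FibHeap.potential 13 (fun h x => match v₀ x with
      | none => pure h
      | some a => h.decreaseKey x (a : EReal)) (by
      rintro x l h ⟨h1, h2, h3, h4⟩
      rw [List.nodup_cons] at h3
      have hl : ∀ y ∈ l, y ∈ G.verts := fun y hy => h4 y (by simp [hy])
      rcases hv : v₀ x with _ | a
      · refine ⟨⟨h1, ?_, h3.2, hl⟩, by simp⟩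
        intro y hy
        simp only [Timed.val_pure, h2 y hy, List.mem_cons]
        by_cases hyx : y = x
        · subst hyx
          simp [hv]
        · simp [hyx]
      · have hx := h4 x (by simp)
        obtain ⟨g1, g2, g3⟩ := FibHeap.decreaseKey_spec h1 hx (a := (a : EReal)) (by
          rw [h2 x hx]
          simp)
        refine ⟨⟨g1, ?_, h3.2, hl⟩, g3⟩
        intro y hy
        simp only [g2, Function.update_apply, h2 y hy, List.mem_cons]
        by_cases hyx : y = x
        · subst hyx
          simp [hv, h3.1]
        · simp [hyx]) G.verts.toList h₀.val
    ⟨by simpa using a1, fun x hx => by simp [a2, hx], Finset.nodup_toList _, by simp⟩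
  set h₁ := forEach G.verts.toList h₀.val fun h x => match v₀ x with
      | none => pure h
      | some a => h.decreaseKey x (a : EReal) with hh₁
  have hI : DijkstraInv G v₀ α G.verts h₁.val (fun _ => ⊤) (fun _ => false) := by
    refine ⟨b1, subset_rfl, fun x hx => by simp [hx], ?_, ?_, ?_, ?_⟩
    · intro x hx
      rw [if_pos hx, b2 x hx]
      rcases hv : v₀ x with _ | a
      · simp
      · right
        exact ⟨x, a, 0, hv, .refl, by simp⟩
    · intro x hx a ha
      rw [if_pos hx, b2 x hx]
      simp [ha]
    · exact fun x y hx hxy => absurd (hG.mem_verts x y hxy) hx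
    · exact fun x hx hx' => absurd hx hx'
  obtain ⟨c1, c2⟩ := dijkstraLoop_spec G hG v₀ α hα G.verts.card G.verts h₁.val _ _ hI le_rfl
  have e : modDijkstra G v₀ α =
      ⟨(dijkstraLoop G α G.verts.card h₁.val (fun _ => ⊤) (fun _ => false)).val,
        h₀.steps + (h₁.steps +
          (dijkstraLoop G α G.verts.card h₁.val (fun _ => ⊤) (fun _ => false)).steps)⟩ := rfl
  rw [e]
  refine ⟨c1, ?_⟩
  -- Per vertex: 6 for its insertion, 14 for its initial key and 20 · `logCard V` + 1 for its
  -- removal. Each edge is relaxed at most twice at cost 14. All this is below 50 · `size`.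
  have h1 := sum_adj_length_le G hG
  rw [Finset.sum_add_distrib, Finset.sum_add_distrib, ← Finset.mul_sum,
    ← Finset.mul_sum, Finset.sum_const, Finset.sum_const] at c2
  rw [FibHeap.empty_potential] at a3
  rw [Finset.length_toList] at a3 b3
  have h2 := G.card_verts_le_size
  have h3 : G.size = G.edges.card + G.verts.card * logCard V := rfl
  simp only [smul_eq_mul] at c2
  simp only
  omega

/-! ### Walks and the minimality of potentials. -/

namespace WGraph

/-- Adding up the edge inequalities along a walk shows that the value is a lower bound for all
walks; together with `attained` it is the minimum. -/
theorem IsPotential.le_of_reach {G : WGraph V} {v₀ : V → Option ℝ} {α : ℝ}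
    {res : V → EReal} (hres : G.IsPotential v₀ α res) {t x : V} {a L : ℝ} (ht : t ∈ G.verts)
    (ha : v₀ t = some a) (hx : G.Reach t x L) : res x ≤ ((a + α * L : ℝ) : EReal) := by
  induction hx with
  | refl => simpa using hres.terminal t ht a ha
  | step _ hxy ih =>
    refine (hres.edge _ _ hxy).trans ((add_le_add_left ih _).trans ?_)
    rw [← EReal.coe_add]
    exact le_of_eq (by congr 1; ring)

variable {G : WGraph V}

theorem Reach.trans {a b c : V} {L M : ℝ} (h1 : G.Reach a b L) (h2 : G.Reach b c M) :
    G.Reach a c (L + M) := by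
  induction h2 with
  | refl => simpa using h1
  | step _ hxy ih =>
    rw [← add_assoc]
    exact ih.step hxy

theorem Reach.symm {a b : V} {L : ℝ} (h : G.Reach a b L) : G.Reach b a L := by
  induction h with
  | refl => exact .refl
  | @step x y L _ hxy ih =>
    rw [Sym2.eq_swap] at hxy ⊢
    have := (Reach.refl.step hxy).trans ih
    rwa [zero_add, add_comm] at this

theorem Reach.nonneg (hG : G.WF) {a b : V} {L : ℝ} (h : G.Reach a b L) : 0 ≤ L := by
  induction h with
  | refl => exact le_rfl
  | step _ hxy ih => exact add_nonneg ih (hG.pos _ hxy).le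

theorem Reach.pos (hG : G.WF) {a b : V} {L : ℝ} (h : G.Reach a b L) (hab : a ≠ b) : 0 < L := by
  cases h with
  | refl => exact absurd rfl hab
  | step h hxy => exact add_pos_of_nonneg_of_pos (h.nonneg hG) (hG.pos _ hxy)

theorem Reach.mem_verts (hG : G.WF) {a b : V} {L : ℝ} (h : G.Reach a b L) (ha : a ∈ G.verts) :
    b ∈ G.verts := by
  cases h with
  | refl => exact ha
  | step _ hxy => exact hG.mem_verts' hxy

theorem Reach.eq_of_edges_empty {a b : V} {L : ℝ} (h : G.Reach a b L) (he : G.edges = ∅) :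
    a = b ∧ L = 0 := by
  cases h with
  | refl => exact ⟨rfl, rfl⟩
  | step _ hxy => simp [he] at hxy

theorem Reach.mono {H : WGraph V} (hsub : H.edges ⊆ G.edges) (hlen : H.len = G.len) {a b : V}
    {L : ℝ} (h : H.Reach a b L) : G.Reach a b L := by
  induction h with
  | refl => exact .refl
  | step _ hxy ih =>
    rw [hlen]
    exact ih.step (hsub hxy)

end WGraph

/-! ## Randomized computations -/

namespace RTimed

variable {α β : Type}

theorem outputs_nonempty (p : RTimed α) : p.outputs.Nonempty :=
  (PMF.support_nonempty p).image _

@[simp] theorem mem_outputs_pure {a b : α} : b ∈ (pure a : RTimed α).outputs ↔ b = a := by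
  change b ∈ Timed.val '' PMF.support (PMF.pure _) ↔ _
  simp

@[simp] theorem mem_outputs_bind {p : RTimed α} {f : α → RTimed β} {b : β} :
    b ∈ (p >>= f).outputs ↔ ∃ a ∈ p.outputs, b ∈ (f a).outputs := by
  have key : ∀ (q : PMF (Timed α)) (g : α → PMF (Timed β)),
      (∃ z : Timed β, z ∈ (q.bind fun x =>
        (g x.val).map fun y => (⟨y.val, x.steps + y.steps⟩ : Timed β)).support ∧ z.val = b) ↔
      ∃ a, (∃ x : Timed α, x ∈ q.support ∧ x.val = a) ∧
        ∃ y : Timed β, y ∈ (g a).support ∧ y.val = b := by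
    intro q g
    simp only [PMF.mem_support_bind_iff, PMF.mem_support_map_iff]
    constructor
    · rintro ⟨_, ⟨x, hx, y, hy, rfl⟩, rfl⟩
      exact ⟨x.val, ⟨x, hx, rfl⟩, y, hy, rfl⟩
    · rintro ⟨_, ⟨x, hx, rfl⟩, y, hy, rfl⟩
      exact ⟨_, ⟨x, hx, y, hy, rfl⟩, rfl⟩
  exact key p f

@[simp] theorem mem_outputs_lift {x : Timed α} {b : α} :
    b ∈ (liftM x : RTimed α).outputs ↔ b = x.val := by
  change b ∈ Timed.val '' PMF.support (PMF.pure _) ↔ _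
  simp

@[simp] theorem mem_outputs_sample {s : Finset α} {hs : s.Nonempty} {b : α} :
    b ∈ (sample s hs).outputs ↔ b ∈ s := by
  change b ∈ Timed.val '' PMF.support (PMF.map _ _) ↔ _
  simp

/-- The expected value of `g` at the result. -/
def expect (p : RTimed α) (g : α → ℝ≥0∞) : ℝ≥0∞ :=
  ∑' x : Timed α, (show PMF (Timed α) from p) x * g x.val

theorem expect_le (p : RTimed α) {g : α → ℝ≥0∞} {B : ℝ≥0∞} (h : ∀ a ∈ p.outputs, g a ≤ B) :
    p.expect g ≤ B := by
  calc p.expect g ≤ ∑' x : Timed α, (show PMF (Timed α) from p) x * B := by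
        refine ENNReal.tsum_le_tsum fun x => ?_
        by_cases hx : x ∈ PMF.support p
        · gcongr
          exact h _ ⟨x, hx, rfl⟩
        · have : (show PMF (Timed α) from p) x = 0 := by
            exact Function.notMem_support.1 hx
          rw [this]
          simp
    _ = B := by rw [ENNReal.tsum_mul_right, PMF.tsum_coe, one_mul]

theorem tsum_bind_mul {α β : Type} (p : PMF α) (f : α → PMF β) (g : β → ℝ≥0∞) :
    ∑' y, (p.bind f) y * g y = ∑' x, p x * ∑' y, f x y * g y := by
  simp only [PMF.bind_apply, ← ENNReal.tsum_mul_right, ← ENNReal.tsum_mul_left]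
  rw [ENNReal.tsum_comm]
  simp only [mul_assoc]

theorem tsum_pure_mul {α : Type} (a : α) (g : α → ℝ≥0∞) :
    ∑' y, (PMF.pure a) y * g y = g a := by
  rw [tsum_eq_single a]
  · simp
  · intro b hb
    simp [PMF.pure_apply, hb]

theorem tsum_map_mul {α β : Type} (p : PMF α) (f : α → β) (g : β → ℝ≥0∞) :
    ∑' y, (p.map f) y * g y = ∑' x, p x * g (f x) := by
  rw [PMF.map, tsum_bind_mul]
  simp only [Function.comp, tsum_pure_mul]

@[simp] theorem expectedSteps_pure (a : α) : (pure a : RTimed α).expectedSteps = 0 := by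
  change ∑' x : Timed α, (PMF.pure _) x * (x.steps : ℝ≥0∞) = 0
  rw [tsum_pure_mul]
  simp

@[simp] theorem expectedSteps_lift (x : Timed α) :
    (liftM x : RTimed α).expectedSteps = x.steps := by
  change ∑' x : Timed α, (PMF.pure _) x * (x.steps : ℝ≥0∞) = _
  rw [tsum_pure_mul]
  rfl

/-- Linearity of expectation. The continuation depends only on the result of `p`, not on the time
spent, which is what lets the second term be an `expect` over results. -/
theorem expectedSteps_bind (p : RTimed α) (f : α → RTimed β) :
    (p >>= f).expectedSteps = p.expectedSteps + p.expect fun a => (f a).expectedSteps := by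
  have key : ∀ (q : PMF (Timed α)) (g : α → PMF (Timed β)),
      ∑' z, (q.bind fun x => (g x.val).map fun y =>
        (⟨y.val, x.steps + y.steps⟩ : Timed β)) z * (z.steps : ℝ≥0∞) =
      ∑' x, q x * (x.steps : ℝ≥0∞) + ∑' x, q x * ∑' y, g x.val y * (y.steps : ℝ≥0∞) := by
    intro q g
    simp only [tsum_bind_mul, tsum_map_mul, Nat.cast_add, mul_add, ENNReal.tsum_add,
      ENNReal.tsum_mul_right, PMF.tsum_coe, one_mul]
  exact key p f

theorem expectedSteps_bind_le {p : RTimed α} {f : α → RTimed β} {A B : ℝ≥0∞}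
    (hp : p.expectedSteps ≤ A) (hf : ∀ a ∈ p.outputs, (f a).expectedSteps ≤ B) :
    (p >>= f).expectedSteps ≤ A + B := by
  rw [expectedSteps_bind]
  exact add_le_add hp (p.expect_le hf)

@[simp] theorem expectedSteps_lift_bind (x : Timed α) (f : α → RTimed β) :
    ((liftM x : RTimed α) >>= f).expectedSteps = x.steps + (f x.val).expectedSteps := by
  rw [expectedSteps_bind, expectedSteps_lift]
  congr 1
  exact tsum_pure_mul _ _

@[simp] theorem mem_outputs_lift_bind {x : Timed α} {f : α → RTimed β} {b : β} :
    b ∈ ((liftM x : RTimed α) >>= f).outputs ↔ b ∈ (f x.val).outputs := by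
  simp

theorem expectedSteps_sample_bind (s : Finset α) (hs : s.Nonempty) (f : α → RTimed β) :
    (sample s hs >>= f).expectedSteps = 1 + (∑ a ∈ s, (f a).expectedSteps) / s.card := by
  rw [expectedSteps_bind]
  congr 1
  · change ∑' x : Timed α, (PMF.map _ _) x * (x.steps : ℝ≥0∞) = _
    rw [tsum_map_mul]
    simp only [Nat.cast_one, mul_one, PMF.tsum_coe]
  · change ∑' x : Timed α, (PMF.map _ _) x * _ = _
    rw [tsum_map_mul, ENNReal.div_eq_inv_mul, Finset.mul_sum, tsum_eq_sum (s := s)]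
    · refine Finset.sum_congr rfl fun a ha => ?_
      rw [PMF.uniformOfFinset_apply_of_mem hs ha]
    · intro a ha
      rw [PMF.uniformOfFinset_apply_of_notMem hs ha, zero_mul]

end RTimed

/-- Ordered pairs with p x < p y and those with p y < p x are equally many and disjoint, inside s ×
s. Ties only help. -/
theorem two_mul_sum_rank_le {α : Type} (s : Finset α) (p : α → ℝ) :
    2 * ∑ x ∈ s, (s.filter fun y => p x < p y).card ≤ s.card * s.card := by
  have h1 : ∑ x ∈ s, (s.filter fun y => p x < p y).card =
      ∑ x ∈ s, (s.filter fun y => p y < p x).card := by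
    simp only [Finset.card_filter]
    rw [Finset.sum_comm]
  rw [two_mul]
  nth_rewrite 2 [h1]
  rw [← Finset.sum_add_distrib, ← smul_eq_mul, ← Finset.sum_const]
  refine Finset.sum_le_sum fun x _ => ?_
  rw [← Finset.card_union_of_disjoint]
  · exact Finset.card_le_card
      (Finset.union_subset (Finset.filter_subset _ _) (Finset.filter_subset _ _))
  · rw [Finset.disjoint_filter]
    exact fun y _ h2 h3 => lt_asymm h2 h3

/-- On average at most half of the elements are ranked higher than a random one. -/
theorem RTimed.expectedSteps_sample_bind_le {α β : Type} {s : Finset α} {hs : s.Nonempty}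
    {f : α → RTimed β} (p : α → ℝ) {A B : ℝ≥0∞}
    (hf : ∀ a ∈ s, (f a).expectedSteps ≤ A + 2 * B * (s.filter fun y => p a < p y).card) :
    (sample s hs >>= f).expectedSteps ≤ 1 + (A + B * s.card) := by
  rw [expectedSteps_sample_bind]
  refine add_le_add le_rfl (ENNReal.div_le_of_le_mul ?_)
  refine (Finset.sum_le_sum hf).trans ?_
  rw [Finset.sum_add_distrib, Finset.sum_const, ← Finset.mul_sum, nsmul_eq_mul, add_mul,
    mul_comm A]
  refine add_le_add le_rfl ?_
  have := two_mul_sum_rank_le s p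
  calc 2 * B * ∑ a ∈ s, ((s.filter fun y => p a < p y).card : ℝ≥0∞)
      = B * ((2 * ∑ x ∈ s, (s.filter fun y => p x < p y).card : ℕ) : ℝ≥0∞) := by
        push_cast
        ring
    _ ≤ B * ((s.card * s.card : ℕ) : ℝ≥0∞) := by gcongr
    _ = B * s.card * s.card := by push_cast; ring

/-! ## Steepest paths in stars -/

theorem argmax_spec {α : Type} (s : Finset α) (hs : s.Nonempty) (f : α → ℝ) :
    (argmax s hs f).val ∈ s ∧ ∀ x ∈ s, f x ≤ f (argmax s hs f).val :=
  (s.exists_max_image f hs).choose_spec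

/-- The largest quotient of a pair containing `t`. -/
def starPressure {α : Type} (v d : α → ℝ) (T : Finset α) (hT : T.Nonempty) (t : α) : ℝ :=
  T.sup' hT fun s => |v t - v s| / (d t + d s)

theorem argmax_starPressure {α : Type} (v d : α → ℝ) (T : Finset α) (hT : T.Nonempty) (t : α) :
    |v t - v (argmax T hT fun s => |v t - v s| / (d t + d s)).val| /
      (d t + d (argmax T hT fun s => |v t - v s| / (d t + d s)).val) =
      starPressure v d T hT t := by
  obtain ⟨h1, h2⟩ := argmax_spec T hT fun s => |v t - v s| / (d t + d s)
  refine le_antisymm (Finset.le_sup' (fun s => |v t - v s| / (d t + d s)) h1) ?_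
  exact Finset.sup'_le _ _ h2

theorem lt_starPressure {α : Type} {v d : α → ℝ} {T : Finset α} {hT : T.Nonempty}
    (hd : ∀ t ∈ T, 0 < d t) {t : α} (ht : t ∈ T) {β : ℝ} :
    β < starPressure v d T hT t ↔ ∃ s ∈ T, β * (d t + d s) < |v t - v s| := by
  simp only [starPressure, Finset.lt_sup'_iff]
  refine exists_congr fun s => and_congr_right fun hs => ?_
  rw [lt_div_iff₀ (add_pos (hd t ht) (hd s hs))]

@[simp] theorem select_steps {α : Type} (s : Finset α) (p : α → Prop) :
    (select s p).steps = s.card + 1 := rfl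

theorem mem_select {α : Type} {s : Finset α} {p : α → Prop} {a : α} :
    a ∈ (select s p).val ↔ a ∈ s ∧ p a :=
  Finset.mem_filter

@[simp] theorem fillArray_steps {α β : Type} (s : Finset α) (f : α → β) :
    (fillArray s f).steps = s.card + 1 := rfl

@[simp] theorem fillArray_val {α β : Type} (s : Finset α) (f : α → β) :
    (fillArray s f).val = f := rfl

@[simp] theorem argmax_steps {α : Type} (s : Finset α) (hs : s.Nonempty) (f : α → ℝ) :
    (argmax s hs f).steps = s.card + 1 := rfl

@[simp] theorem minOver_steps {α : Type} (s : Finset α) (hs : s.Nonempty) (f : α → ℝ) :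
    (minOver s hs f).steps = s.card + 1 := rfl

@[simp] theorem maxOver_steps {α : Type} (s : Finset α) (hs : s.Nonempty) (f : α → ℝ) :
    (maxOver s hs f).steps = s.card + 1 := rfl

/-- According to the sign of v t − v s, the inequality |v t − v s| > β (d t + d s) separates into a
part in `t` and a part in `s`. Existence of a partner `s` is thus a comparison with one minimum or
one maximum, and two linear scans replace the search over pairs. -/
theorem star_select {α : Type} {v d : α → ℝ} {T : Finset α} {hT : T.Nonempty}
    (hd : ∀ t ∈ T, 0 < d t) (β : ℝ) :
    (select T fun t =>
      t ∈ (select T fun t => (minOver T hT fun t => v t + β * d t).val + β * d t < v t).val ∨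
      t ∈ (select T fun t =>
        v t < (maxOver T hT fun t => v t - β * d t).val - β * d t).val).val =
      T.filter fun t => β < starPressure v d T hT t := by
  ext t
  simp only [mem_select, Finset.mem_filter]
  refine and_congr_right fun ht => ?_
  rw [lt_starPressure hd ht]
  simp only [ht, true_and, minOver, maxOver, lt_abs]
  constructor
  · rintro (h | h)
    · obtain ⟨s, hs, h⟩ := (Finset.inf'_lt_iff hT).1 (lt_sub_iff_add_lt.2 h)
      exact ⟨s, hs, Or.inl (by linarith)⟩
    · obtain ⟨s, hs, h⟩ := (Finset.lt_sup'_iff hT).1 (lt_sub_iff_add_lt.1 h)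
      exact ⟨s, hs, Or.inr (by linarith)⟩
  · rintro ⟨s, hs, h | h⟩
    · exact Or.inl (lt_sub_iff_add_lt.1 ((Finset.inf'_lt_iff hT).2 ⟨s, hs, by linarith⟩))
    · exact Or.inr (lt_sub_iff_add_lt.2 ((Finset.lt_sup'_iff hT).2 ⟨s, hs, by linarith⟩))

/-- The survivors are precisely the terminals ranked above the sample by `starPressure`, on average
at most half of them, so the linear costs of the rounds form a geometric series. -/
theorem starSteepestPath_expectedSteps (v d : V → ℝ) : ∀ (f : ℕ) (T : Finset V),
    (∀ t ∈ T, 0 < d t) → (starSteepestPath v d f T).expectedSteps ≤ 1 + 26 * (T.card : ℝ≥0∞)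
  | 0, T, _ => by simp [starSteepestPath]
  | f + 1, T, hd => by
    by_cases hT : T.Nonempty
    · simp only [starSteepestPath, dif_pos hT]
      -- Six scans and the constant of the recursive call take 6|T| + 7 ≤ 13|T| steps. The recursion
      -- adds 26|T'|, which averages to at most 13|T|.
      refine (RTimed.expectedSteps_sample_bind_le (starPressure v d T hT)
        (A := 13 * T.card) (B := 13) ?_).trans (le_of_eq (by ring))
      intro t₁ ht₁
      simp only [RTimed.expectedSteps_lift_bind]
      simp only [argmax_starPressure, star_select hd, select_steps, argmax_steps, minOver_steps,
        maxOver_steps]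
      set T' := T.filter fun t => starPressure v d T hT t₁ < starPressure v d T hT t with hT'
      have h0 : (1 : ℝ≥0∞) ≤ T.card := by exact_mod_cast hT.card_pos
      have h2 : ∀ r : RTimed (Option (V × V)), r.expectedSteps ≤ 1 + 26 * (T'.card : ℝ≥0∞) →
          ((T.card + 1 : ℕ) : ℝ≥0∞) + (((T.card + 1 : ℕ) : ℝ≥0∞) + (((T.card + 1 : ℕ) : ℝ≥0∞) +
            (((T.card + 1 : ℕ) : ℝ≥0∞) + (((T.card + 1 : ℕ) : ℝ≥0∞) +
              (((T.card + 1 : ℕ) : ℝ≥0∞) + r.expectedSteps))))) ≤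
          13 * T.card + 2 * 13 * (T'.card : ℝ≥0∞) := by
        intro r hr
        calc _ ≤ ((T.card + 1 : ℕ) : ℝ≥0∞) + (((T.card + 1 : ℕ) : ℝ≥0∞) +
              (((T.card + 1 : ℕ) : ℝ≥0∞) + (((T.card + 1 : ℕ) : ℝ≥0∞) +
              (((T.card + 1 : ℕ) : ℝ≥0∞) + (((T.card + 1 : ℕ) : ℝ≥0∞) +
                (1 + 26 * (T'.card : ℝ≥0∞))))))) := by gcongr
          _ = (6 * T.card + 7) + 26 * (T'.card : ℝ≥0∞) := by push_cast; ring
          _ ≤ (6 * T.card + 7 * T.card) + 26 * (T'.card : ℝ≥0∞) := by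
            gcongr
            exact le_mul_of_one_le_right (by simp) h0
          _ = _ := by ring
      apply h2
      split_ifs
      · simp
      · simp
      · exact starSteepestPath_expectedSteps v d f T' fun t ht => hd t (Finset.mem_filter.1 ht).1
    · simp only [starSteepestPath, dif_neg hT]
      simp [RTimed.expectedSteps_lift_bind]

/-- A pair with an element outside T' has quotient at most β. Both members of a pair with quotient
above β lie in T', so if T' is nonempty the recursion finds a quotient larger than β and dominates
every discarded pair. The sample itself is discarded, which bounds the depth by the number of
terminals. -/
theorem starSteepestPath_outputs (v d : V → ℝ) : ∀ (f : ℕ) (T : Finset V), T.card ≤ f →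
    (∀ t ∈ T, 0 < d t) → ∀ r ∈ (starSteepestPath v d f T).outputs,
      T = ∅ ∧ r = none ∨ ∃ t₁ ∈ T, ∃ t₂ ∈ T, r = some (t₁, t₂) ∧ v t₂ ≤ v t₁ ∧
        ∀ s ∈ T, ∀ t ∈ T, |v s - v t| ≤ (v t₁ - v t₂) / (d t₁ + d t₂) * (d s + d t)
  | 0, T, hf, _ => by
    intro r hr
    simp only [starSteepestPath, RTimed.mem_outputs_pure] at hr
    exact Or.inl ⟨by simpa using hf, hr⟩
  | f + 1, T, hf, hd => by
    intro r hr
    by_cases hT : T.Nonempty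
    · right
      simp only [starSteepestPath, dif_pos hT, RTimed.mem_outputs_bind (p := sample T hT),
        RTimed.mem_outputs_sample] at hr
      obtain ⟨t₁, ht₁, hr⟩ := hr
      simp only [RTimed.mem_outputs_lift_bind] at hr
      simp only [argmax_starPressure, star_select hd] at hr
      set β := starPressure v d T hT t₁ with hβ
      set T' := T.filter fun t => β < starPressure v d T hT t with hT'
      obtain ⟨h1, -⟩ := argmax_spec T hT fun s => |v t₁ - v s| / (d t₁ + d s)
      have h2 := argmax_starPressure v d T hT t₁
      rw [← hβ] at h2
      set t₂ := (argmax T hT fun s => |v t₁ - v s| / (d t₁ + d s)).val with ht₂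
      have hle : ∀ t ∈ T, t ∉ T' → ∀ s ∈ T, |v t - v s| ≤ β * (d t + d s) := by
        intro t ht htT' s hs
        by_contra! hlt
        exact htT' (Finset.mem_filter.2 ⟨ht, (lt_starPressure hd ht).2 ⟨s, hs, hlt⟩⟩)
      by_cases hE : T' = ∅
      · rw [if_pos hE] at hr
        have hle' : ∀ s ∈ T, ∀ t ∈ T, |v s - v t| ≤ β * (d s + d t) :=
          fun s hs t ht => hle s hs (by simp [hE]) t ht
        split_ifs at hr with hv
        · rw [RTimed.mem_outputs_pure] at hr
          rw [abs_of_nonneg (sub_nonneg.2 hv)] at h2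
          exact ⟨t₁, ht₁, t₂, h1, hr, hv, by rwa [h2]⟩
        · rw [RTimed.mem_outputs_pure] at hr
          rw [abs_sub_comm, abs_of_nonneg (sub_nonneg.2 (le_of_not_ge hv)), add_comm] at h2
          exact ⟨t₂, h1, t₁, ht₁, hr, le_of_not_ge hv, by rwa [h2]⟩
      · rw [if_neg hE] at hr
        have hsub : T' ⊆ T := Finset.filter_subset _ _
        have hcard : T'.card ≤ f := by
          have : T'.card < T.card := Finset.card_lt_card (Finset.ssubset_iff_subset_ne.2 ⟨hsub, by
            intro hh
            have : t₁ ∈ T' := hh ▸ ht₁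
            exact lt_irrefl _ (Finset.mem_filter.1 this).2⟩)
          omega
        rcases starSteepestPath_outputs v d f T' hcard (fun t ht => hd t (hsub ht)) r hr with
          h3 | ⟨a, ha, b, hb, hab, hv, h3⟩
        · exact absurd h3.1 hE
        refine ⟨a, hsub ha, b, hsub hb, hab, hv, ?_⟩
        have hβ' : β < (v a - v b) / (d a + d b) := by
          obtain ⟨t, ht⟩ := Finset.nonempty_iff_ne_empty.2 hE
          obtain ⟨htT, hβt⟩ := Finset.mem_filter.1 ht
          obtain ⟨s, hs, hst⟩ := (lt_starPressure hd htT).1 hβt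
          have hsT' : s ∈ T' := by
            by_contra hsT'
            have := hle s hs hsT' t htT
            rw [abs_sub_comm, add_comm] at this
            linarith
          have h4 := hst.trans_le (h3 t ht s hsT')
          exact lt_of_mul_lt_mul_right h4 (add_pos (hd t htT) (hd s hs)).le
        intro s hs t ht
        by_cases hsT' : s ∈ T'
        · by_cases htT' : t ∈ T'
          · exact h3 s hsT' t htT'
          · have := hle t ht htT' s hs
            rw [abs_sub_comm, add_comm] at this
            refine this.trans (mul_le_mul_of_nonneg_right hβ'.le ?_)
            exact (add_pos (hd s hs) (hd t ht)).le
        · refine (hle s hs hsT' t ht).trans (mul_le_mul_of_nonneg_right hβ'.le ?_)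
          exact (add_pos (hd s hs) (hd t ht)).le
    · left
      simp only [starSteepestPath, dif_neg hT, RTimed.mem_outputs_lift_bind,
        RTimed.mem_outputs_pure] at hr
      exact ⟨Finset.not_nonempty_iff_eq_empty.1 hT, hr⟩

/-! ## Graphs of high pressure -/

theorem volt_of_eq_some {v₀ : V → Option ℝ} {x : V} {a : ℝ} (h : v₀ x = some a) :
    volt v₀ x = a := by
  simp [volt, h]

theorem eq_some_volt {v₀ : V → Option ℝ} {x : V} (h : (v₀ x).isSome = true) :
    v₀ x = some (volt v₀ x) := by
  obtain ⟨a, ha⟩ := Option.isSome_iff_exists.1 h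
  rw [ha, volt_of_eq_some ha]

/-- There is a terminal walk through `x` of gradient larger than `α`. -/
def WGraph.HighPressure (G : WGraph V) (v₀ : V → Option ℝ) (α : ℝ) (x : V) : Prop :=
  ∃ s t L M, (v₀ s).isSome = true ∧ (v₀ t).isSome = true ∧ G.Reach s x L ∧ G.Reach t x M ∧
    α * (L + M) < volt v₀ s - volt v₀ t

/-- `res x` is the maximum of `v₀ t - α * L` over the walks from terminals `t` to `x`, where `L` is
the length of the walk. -/
structure WGraph.IsUpperPotential (G : WGraph V) (v₀ : V → Option ℝ) (α : ℝ) (res : V → EReal) :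
    Prop where
  attained : ∀ x ∈ G.verts, res x = ⊥ ∨
    ∃ t a L, v₀ t = some a ∧ G.Reach t x L ∧ res x = ((a - α * L : ℝ) : EReal)
  terminal : ∀ x ∈ G.verts, ∀ a : ℝ, v₀ x = some a → (a : EReal) ≤ res x
  le_of_reach : ∀ t ∈ G.verts, ∀ x a L, v₀ t = some a → G.Reach t x L →
    ((a - α * L : ℝ) : EReal) ≤ res x

/-- Negating the labels turns the maximum of v₀ t − αL into minus a minimum of the form that
`modDijkstra` computes. -/
theorem compVHigh_spec (G : WGraph V) (hG : G.WF) (v₀ : V → Option ℝ) {α : ℝ} (hα : 0 ≤ α) :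
    G.IsUpperPotential v₀ α (compVHigh G v₀ α).val ∧
      (compVHigh G v₀ α).steps ≤ 52 * G.size + 5 := by
  obtain ⟨h1, h2⟩ := modDijkstra_spec G hG (fun x => (v₀ x).map fun a => -a) hα
  have hsize := G.card_verts_le_size
  set d := modDijkstra G (fun x => (v₀ x).map fun a => -a) α with hd
  have e : compVHigh G v₀ α =
      ⟨fun x => -d.val x, (G.verts.card + 1) + (d.steps + (G.verts.card + 1))⟩ := rfl
  rw [e]
  have hle : ∀ t ∈ G.verts, ∀ x a L, v₀ t = some a → G.Reach t x L →
      ((a - α * L : ℝ) : EReal) ≤ -d.val x := by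
    intro t ht x a L ha hx
    have h3 := h1.le_of_reach (a := -a) ht (by simp [ha]) hx
    rw [EReal.le_neg, ← EReal.coe_neg]
    refine h3.trans (le_of_eq ?_)
    congr 1
    ring
  refine ⟨⟨?_, ?_, hle⟩, by simp only; omega⟩
  · intro x hx
    rcases h1.attained x hx with h3 | ⟨t, a, L, h3, h4, h5⟩
    · left
      simp [h3]
    · right
      obtain ⟨b, hb, rfl⟩ := Option.map_eq_some_iff.1 h3
      refine ⟨t, b, L, hb, h4, ?_⟩
      simp only [h5]
      rw [← EReal.coe_neg]
      congr 1
      ring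
  · intro x hx a ha
    simpa using hle x hx x a 0 ha .refl

/-- Both extremes are attained by walks into `x`; joined at `x`, these form a terminal walk, and the
inequality says that its gradient exceeds `α`. The values ⊤ and ⊥, where no terminal is reachable,
rule out strict inequality. -/
theorem vLow_lt_vHigh_iff {G : WGraph V} (hG : G.WF) {v₀ : V → Option ℝ} {α : ℝ}
    {vLow vHigh : V → EReal} (hl : G.IsPotential v₀ α vLow) (hh : G.IsUpperPotential v₀ α vHigh)
    {x : V} (hx : x ∈ G.verts) : vLow x < vHigh x ↔ G.HighPressure v₀ α x := by
  constructor
  · intro hlt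
    rcases hl.attained x hx with h1 | ⟨t, b, M, ht, htx, h1⟩
    · simp [h1] at hlt
    rcases hh.attained x hx with h2 | ⟨s, a, L, hs, hsx, h2⟩
    · simp [h2] at hlt
    rw [h1, h2, EReal.coe_lt_coe_iff] at hlt
    refine ⟨s, t, L, M, by simp [hs], by simp [ht], hsx, htx, ?_⟩
    rw [volt_of_eq_some hs, volt_of_eq_some ht]
    linarith
  · rintro ⟨s, t, L, M, hs, ht, hsx, htx, hlt⟩
    have h1 := hl.le_of_reach (htx.symm.mem_verts hG hx) (eq_some_volt ht) htx
    have h2 := hh.le_of_reach s (hsx.symm.mem_verts hG hx) x _ _ (eq_some_volt hs) hsx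
    refine h1.trans_lt (lt_of_lt_of_le ?_ h2)
    rw [EReal.coe_lt_coe_iff]
    linarith

/-- The subgraph induced by the vertices of high pressure. -/
def WGraph.highPress (G : WGraph V) (v₀ : V → Option ℝ) (α : ℝ) : WGraph V where
  verts := G.verts.filter fun x => G.HighPressure v₀ α x
  edges := G.edges.filter fun e => ∀ x ∈ e, G.HighPressure v₀ α x
  len := G.len

theorem compHighPressGraph_spec (G : WGraph V) (hG : G.WF) (v₀ : V → Option ℝ) {α : ℝ}
    (hα : 0 ≤ α) : (compHighPressGraph G v₀ α).val = G.highPress v₀ α ∧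
      (compHighPressGraph G v₀ α).steps ≤ 106 * G.size + 10 := by
  obtain ⟨h1, h2⟩ := modDijkstra_spec G hG v₀ hα
  obtain ⟨h3, h4⟩ := compVHigh_spec G hG v₀ hα
  set vLow := modDijkstra G v₀ α
  set vHigh := compVHigh G v₀ α
  have hsize := G.card_verts_le_size
  have hsize' : G.size = G.edges.card + G.verts.card * logCard V := rfl
  have hV : (select G.verts fun x => vLow.val x < vHigh.val x).val =
      G.verts.filter fun x => G.HighPressure v₀ α x := by
    ext x
    rw [mem_select, Finset.mem_filter]
    exact and_congr_right fun hx => vLow_lt_vHigh_iff hG h1 h3 hx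
  have hE : (select G.edges fun e => ∀ x ∈ e,
      x ∈ (select G.verts fun x => vLow.val x < vHigh.val x).val).val =
      G.edges.filter fun e => ∀ x ∈ e, G.HighPressure v₀ α x := by
    ext e
    rw [mem_select, Finset.mem_filter]
    refine and_congr_right fun he => forall₂_congr fun x hx => ?_
    rw [hV, Finset.mem_filter, and_iff_right_iff_imp]
    intro _
    obtain ⟨y, rfl⟩ := Sym2.mem_iff_exists.1 hx
    exact hG.mem_verts _ _ he
  have e : compHighPressGraph G v₀ α =
      ⟨⟨(select G.verts fun x => vLow.val x < vHigh.val x).val,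
        (select G.edges fun e => ∀ x ∈ e,
          x ∈ (select G.verts fun x => vLow.val x < vHigh.val x).val).val, G.len⟩,
        vLow.steps + (vHigh.steps + ((G.verts.card + 1) + ((G.edges.card + 1) +
          (((select G.verts fun x => vLow.val x < vHigh.val x).val.card +
            (select G.edges fun e => ∀ x ∈ e,
              x ∈ (select G.verts fun x => vLow.val x < vHigh.val x).val).val.card) + 0))))⟩ := rfl
  rw [e, hE, hV]
  refine ⟨rfl, ?_⟩
  have h5 := Finset.card_filter_le G.verts fun x => G.HighPressure v₀ α x
  have h6 := Finset.card_filter_le G.edges fun e => ∀ x ∈ e, G.HighPressure v₀ α x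
  simp only
  omega

/-! ## Steepest terminal paths through a vertex -/

/-- `P` is a terminal path in `G`, or no path. -/
def WGraph.IsTermPath (G : WGraph V) (v₀ : V → Option ℝ) (P : Option (TermPath V)) : Prop :=
  ∀ Q, P = some Q → (v₀ Q.src).isSome = true ∧ (v₀ Q.dst).isSome = true ∧ G.Reach Q.src Q.dst Q.len

/-- `α` bounds the gradients of all terminal walks through `x`. -/
def WGraph.PressureLE (G : WGraph V) (v₀ : V → Option ℝ) (x : V) (α : ℝ) : Prop :=
  ∀ s t L M, (v₀ s).isSome = true → (v₀ t).isSome = true → G.Reach s x L → G.Reach t x M →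
    volt v₀ s - volt v₀ t ≤ α * (L + M)

theorem WGraph.pressureLE_iff {G : WGraph V} {v₀ : V → Option ℝ} {x : V} {α : ℝ} :
    G.PressureLE v₀ x α ↔ ¬ G.HighPressure v₀ α x := by
  simp only [WGraph.PressureLE, WGraph.HighPressure, not_exists, not_and, not_lt]

theorem WGraph.PressureLE.mono {G : WGraph V} (hG : G.WF) {v₀ : V → Option ℝ} {x : V} {α β : ℝ}
    (h : G.PressureLE v₀ x α) (hαβ : α ≤ β) : G.PressureLE v₀ x β :=
  fun s t L M hs ht hsx htx => (h s t L M hs ht hsx htx).trans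
    (mul_le_mul_of_nonneg_right hαβ (add_nonneg (hsx.nonneg hG) (htx.nonneg hG)))

/-- `P` is a steepest terminal path through `x`. -/
structure WGraph.IsSteepestAt (G : WGraph V) (v₀ : V → Option ℝ) (x : V)
    (P : Option (TermPath V)) : Prop where
  nonneg : 0 ≤ pathGrad v₀ P
  bound : G.PressureLE v₀ x (pathGrad v₀ P)
  through : ∀ Q, P = some Q → (v₀ Q.src).isSome = true ∧ (v₀ Q.dst).isSome = true ∧
    ∃ L M, G.Reach Q.src x L ∧ G.Reach Q.dst x M ∧ Q.len = L + M

theorem WGraph.IsSteepestAt.isTermPath {G : WGraph V} {v₀ : V → Option ℝ} {x : V}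
    {P : Option (TermPath V)} (h : G.IsSteepestAt v₀ x P) : G.IsTermPath v₀ P := by
  intro Q hQ
  obtain ⟨h1, h2, L, M, h3, h4, h5⟩ := h.through Q hQ
  exact ⟨h1, h2, h5 ▸ h3.trans h4.symm⟩

theorem WGraph.IsSteepestAt.grad_le {G : WGraph V} (hG : G.WF) {v₀ : V → Option ℝ} {x : V}
    {P : Option (TermPath V)} (h : G.IsSteepestAt v₀ x P) {α : ℝ} (hα : 0 ≤ α)
    (hx : G.PressureLE v₀ x α) : pathGrad v₀ P ≤ α := by
  rcases P with _ | Q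
  · exact hα
  · obtain ⟨h1, h2, L, M, h3, h4, h5⟩ := h.through Q rfl
    have h6 := hx _ _ _ _ h1 h2 h3 h4
    -- This form of the division lemma also covers length 0, where the quotient is 0 by convention
    -- and `0 ≤ α` is needed.
    exact div_le_of_le_mul₀ (h5 ▸ add_nonneg (h3.nonneg hG) (h4.nonneg hG)) hα (h5 ▸ h6)

/-- The data that `vertexSteepestPath` computes from the distances. -/
structure WGraph.IsDist (G : WGraph V) (x : V) (dist : V → EReal) : Prop where
  reach : ∀ t ∈ G.verts, dist t ≠ ⊤ → G.Reach x t (dist t).toReal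
  le : ∀ t L, G.Reach x t L → dist t ≠ ⊤ ∧ (dist t).toReal ≤ L

theorem WGraph.IsPotential.isDist {G : WGraph V} (hG : G.WF) {x : V} (hx : x ∈ G.verts)
    {dist : V → EReal}
    (h : G.IsPotential (fun y => if y = x then some (0 : ℝ) else none) 1 dist) :
    G.IsDist x dist := by
  have key : ∀ t ∈ G.verts, dist t ≠ ⊤ → ∃ L, G.Reach x t L ∧ dist t = (L : EReal) := by
    intro t ht hne
    obtain ⟨s, a, L, hs, hL, h1⟩ := (h.attained t ht).resolve_left hne
    split_ifs at hs with hsx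
    subst hsx
    obtain rfl := Option.some.inj hs
    exact ⟨L, hL, by simpa using h1⟩
  refine ⟨?_, ?_⟩
  · intro t ht hne
    obtain ⟨L, h1, h2⟩ := key t ht hne
    rw [h2]
    exact h1
  · intro t L hL
    have h1 := h.le_of_reach (t := x) (a := 0) hx (by simp) hL
    have hne : dist t ≠ ⊤ := fun hh => by
      rw [hh, top_le_iff] at h1
      exact EReal.coe_ne_top _ h1
    obtain ⟨M, -, h2⟩ := key t (hL.mem_verts hG hx) hne
    refine ⟨hne, ?_⟩
    rw [h2, EReal.coe_le_coe_iff] at h1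
    rw [h2]
    simpa using h1

/-- When `x` is a terminal, a terminal walk through `x` splits there into two terminal walks, and
its gradient is a weighted mean of theirs. Hence paths that end at `x` suffice. -/
theorem isSteepestAt_of_terminal {G : WGraph V} {v₀ : V → Option ℝ} {x : V}
    {P : Option (TermPath V)} (h0 : 0 ≤ pathGrad v₀ P)
    (hb : ∀ t L, (v₀ t).isSome = true → G.Reach x t L →
      |volt v₀ x - volt v₀ t| ≤ pathGrad v₀ P * L)
    (hP : ∀ Q, P = some Q → (v₀ Q.src).isSome = true ∧ (v₀ Q.dst).isSome = true ∧
      G.Reach Q.src Q.dst Q.len ∧ (Q.src = x ∨ Q.dst = x)) : G.IsSteepestAt v₀ x P := by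
  refine ⟨h0, ?_, ?_⟩
  · intro s t L M hs ht hsx htx
    have h1 := neg_abs_le (volt v₀ x - volt v₀ s)
    have h2 := le_abs_self (volt v₀ x - volt v₀ t)
    have h3 := hb s L hs hsx.symm
    have h4 := hb t M ht htx.symm
    rw [mul_add]
    linarith
  · intro Q hQ
    obtain ⟨h1, h2, h3, h4 | h4⟩ := hP Q hQ
    · exact ⟨h1, h2, 0, Q.len, h4 ▸ .refl, by rw [← h4]; exact h3.symm, by ring⟩
    · exact ⟨h1, h2, Q.len, 0, by rw [← h4]; exact h3, h4 ▸ .refl, by ring⟩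

/-- Shortening the two legs of a walk to distances from `x` can only steepen a nonnegative gradient,
so the graph may be replaced by the star of its reachable terminals around `x`. At a nonterminal `x`
all these distances are positive, as the star algorithm requires. -/
theorem vertexSteepestPath_spec (G : WGraph V) (hG : G.WF) (v₀ : V → Option ℝ) {x : V}
    (hx : x ∈ G.verts) :
    (∀ P ∈ (vertexSteepestPath G v₀ x).outputs, G.IsSteepestAt v₀ x P) ∧
      (vertexSteepestPath G v₀ x).expectedSteps ≤ ((80 * G.size + 10 : ℕ) : ℝ≥0∞) := by
  obtain ⟨h1, h2⟩ := modDijkstra_spec G hG (fun y => if y = x then some (0 : ℝ) else none)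
    (zero_le_one (α := ℝ))
  have hdist := h1.isDist hG hx
  have hsize := G.card_verts_le_size
  simp only [vertexSteepestPath, RTimed.mem_outputs_lift_bind, RTimed.expectedSteps_lift_bind,
    fillArray_val, fillArray_steps, select_steps]
  set dist := modDijkstra G (fun y => if y = x then some (0 : ℝ) else none) 1
  set T := (select G.verts fun t => (v₀ t).isSome = true ∧ dist.val t ≠ ⊤).val with hT
  have hmemT : ∀ t, t ∈ T ↔ t ∈ G.verts ∧ (v₀ t).isSome = true ∧ dist.val t ≠ ⊤ := fun t =>
    mem_select
  have hTcard : T.card ≤ G.verts.card :=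
    Finset.card_le_card fun t ht => ((hmemT t).1 ht).1
  have hreach : ∀ t L, (v₀ t).isSome = true → G.Reach x t L → t ∈ T := fun t L ht hL =>
    (hmemT t).2 ⟨hL.mem_verts hG hx, ht, (hdist.le t L hL).1⟩
  set d : V → ℝ := fun t => (dist.val t).toReal with hd
  have hdT : ∀ t ∈ T, G.Reach x t (d t) := fun t ht =>
    hdist.reach t ((hmemT t).1 ht).1 ((hmemT t).1 ht).2.2
  have hsomeT : ∀ t ∈ T, (v₀ t).isSome = true := fun t ht => ((hmemT t).1 ht).2.1
  by_cases hvx : (v₀ x).isSome = true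
  · simp only [if_pos hvx, RTimed.mem_outputs_lift_bind, RTimed.expectedSteps_lift_bind,
      select_steps]
    set S := (select T fun t => t ≠ x).val with hS
    have hmemS : ∀ t, t ∈ S ↔ t ∈ T ∧ t ≠ x := fun t => mem_select
    have hScard : S.card ≤ T.card := Finset.card_le_card fun t ht => ((hmemS t).1 ht).1
    constructor
    · intro P hP
      by_cases hSn : S.Nonempty
      · rw [dif_pos hSn, RTimed.mem_outputs_lift_bind] at hP
        obtain ⟨a1, a2⟩ := argmax_spec S hSn fun y => |volt v₀ x - volt v₀ y| / d y
        set y := (argmax S hSn fun y => |volt v₀ x - volt v₀ y| / d y).val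
        obtain ⟨hyT, hyx⟩ := (hmemS y).1 a1
        have hgrad : pathGrad v₀ P = |volt v₀ x - volt v₀ y| / d y ∧
            ∀ Q, P = some Q → (v₀ Q.src).isSome = true ∧ (v₀ Q.dst).isSome = true ∧
              G.Reach Q.src Q.dst Q.len ∧ (Q.src = x ∨ Q.dst = x) := by
          split_ifs at hP with hv <;> rw [RTimed.mem_outputs_pure] at hP <;> subst hP
          · refine ⟨by rw [pathGrad, abs_of_nonneg (sub_nonneg.2 hv)], ?_⟩
            rintro Q ⟨⟩
            exact ⟨hvx, hsomeT y hyT, hdT y hyT, Or.inl rfl⟩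
          · refine ⟨by rw [pathGrad, abs_sub_comm,
              abs_of_nonneg (sub_nonneg.2 (le_of_not_ge hv))], ?_⟩
            rintro Q ⟨⟩
            exact ⟨hsomeT y hyT, hvx, (hdT y hyT).symm, Or.inr rfl⟩
        have h0 : 0 ≤ pathGrad v₀ P := by
          rw [hgrad.1]
          exact div_nonneg (abs_nonneg _) ((hdT y hyT).nonneg hG)
        refine isSteepestAt_of_terminal h0 ?_ hgrad.2
        intro t L ht hL
        by_cases htx : t = x
        · subst htx
          simpa using mul_nonneg h0 (hL.nonneg hG)
        · have htT := hreach t L ht hL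
          have h3 := a2 t ((hmemS t).2 ⟨htT, htx⟩)
          rw [← hgrad.1, div_le_iff₀ ((hdT t htT).pos hG (Ne.symm htx))] at h3
          exact h3.trans (mul_le_mul_of_nonneg_left (hdist.le t L hL).2 h0)
      · rw [dif_neg hSn, RTimed.mem_outputs_pure] at hP
        subst hP
        refine isSteepestAt_of_terminal le_rfl ?_ (by simp)
        intro t L ht hL
        have htx : t = x := by
          by_contra htx
          exact hSn ⟨t, (hmemS t).2 ⟨hreach t L ht hL, htx⟩⟩
        subst htx
        simp [pathGrad]
    · have h3 : ∀ r : RTimed (Option (TermPath V)), r.expectedSteps ≤ ((S.card + 1 : ℕ) : ℝ≥0∞) →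
          ((G.verts.card + 1 : ℕ) : ℝ≥0∞) + ((dist.steps : ℝ≥0∞) +
            (((G.verts.card + 1 : ℕ) : ℝ≥0∞) + (((G.verts.card + 1 : ℕ) : ℝ≥0∞) +
              (((T.card + 1 : ℕ) : ℝ≥0∞) + r.expectedSteps)))) ≤
          ((80 * G.size + 10 : ℕ) : ℝ≥0∞) := by
        intro r hr
        calc _ ≤ ((G.verts.card + 1 : ℕ) : ℝ≥0∞) + ((dist.steps : ℝ≥0∞) +
            (((G.verts.card + 1 : ℕ) : ℝ≥0∞) + (((G.verts.card + 1 : ℕ) : ℝ≥0∞) +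
              (((T.card + 1 : ℕ) : ℝ≥0∞) + ((S.card + 1 : ℕ) : ℝ≥0∞))))) := by gcongr
          _ = (((G.verts.card + 1) + (dist.steps + ((G.verts.card + 1) + ((G.verts.card + 1) +
              ((T.card + 1) + (S.card + 1))))) : ℕ) : ℝ≥0∞) := by push_cast; ring
          _ ≤ _ := by
            rw [Nat.cast_le]
            omega
      apply h3
      split_ifs with hSn
      · rw [RTimed.expectedSteps_lift_bind, argmax_steps]
        split_ifs <;> simp
      · simp
  · simp only [if_neg hvx]
    have hdpos : ∀ t ∈ T, 0 < d t := fun t ht => (hdT t ht).pos hG (by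
      rintro rfl
      exact hvx (hsomeT _ ht))
    constructor
    · intro P hP
      rw [RTimed.mem_outputs_bind] at hP
      obtain ⟨r, hr, hP⟩ := hP
      rcases starSteepestPath_outputs (volt v₀) d T.card T le_rfl hdpos r hr with
        ⟨hTe, rfl⟩ | ⟨t₁, ht₁, t₂, ht₂, rfl, hv, hb⟩
      · simp only [RTimed.mem_outputs_pure] at hP
        subst hP
        refine ⟨le_rfl, ?_, by simp⟩
        intro s t L M hs _ hsx _
        have := hreach s L hs hsx.symm
        rw [hTe] at this
        simp at this
      · simp only [RTimed.mem_outputs_pure] at hP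
        subst hP
        have h0 : 0 ≤ (volt v₀ t₁ - volt v₀ t₂) / (d t₁ + d t₂) :=
          div_nonneg (sub_nonneg.2 hv) (add_pos (hdpos t₁ ht₁) (hdpos t₂ ht₂)).le
        refine ⟨h0, ?_, ?_⟩
        · intro s t L M hs ht hsx htx
          have h3 := hb s (hreach s L hs hsx.symm) t (hreach t M ht htx.symm)
          refine (le_abs_self _).trans (h3.trans (mul_le_mul_of_nonneg_left ?_ h0))
          exact add_le_add (hdist.le s L hsx.symm).2 (hdist.le t M htx.symm).2
        · rintro Q ⟨⟩
          exact ⟨hsomeT t₁ ht₁, hsomeT t₂ ht₂, d t₁, d t₂, (hdT t₁ ht₁).symm, (hdT t₂ ht₂).symm,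
            rfl⟩
    · have h3 : ((starSteepestPath (volt v₀) d T.card T >>= fun st =>
          match st with
          | none => (pure none : RTimed (Option (TermPath V)))
          | some (t₁, t₂) => pure (some ⟨t₁, t₂, d t₁ + d t₂⟩))).expectedSteps ≤
          (1 + 26 * (T.card : ℝ≥0∞)) + 0 := by
        refine RTimed.expectedSteps_bind_le
          (starSteepestPath_expectedSteps (volt v₀) d T.card T hdpos) ?_
        rintro (_ | ⟨t₁, t₂⟩) _ <;> simp
      refine (add_le_add le_rfl (add_le_add le_rfl (add_le_add le_rfl
        (add_le_add le_rfl h3)))).trans ?_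
      calc _ = (((G.verts.card + 1) + (dist.steps + ((G.verts.card + 1) + ((G.verts.card + 1) +
              (1 + 26 * T.card)))) : ℕ) : ℝ≥0∞) := by push_cast; ring
        _ ≤ _ := by
          rw [Nat.cast_le]
          omega

/-! ## Steepest terminal paths -/

/-- `α` bounds the gradients of all terminal walks. -/
def WGraph.GradLE (G : WGraph V) (v₀ : V → Option ℝ) (α : ℝ) : Prop :=
  ∀ s t L, (v₀ s).isSome = true → (v₀ t).isSome = true → G.Reach s t L →
    volt v₀ s - volt v₀ t ≤ α * L

theorem WGraph.GradLE.grad_le {G : WGraph V} (hG : G.WF) {v₀ : V → Option ℝ} {α : ℝ}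
    (h : G.GradLE v₀ α) (hα : 0 ≤ α) {P : Option (TermPath V)} (hP : G.IsTermPath v₀ P) :
    pathGrad v₀ P ≤ α := by
  rcases P with _ | Q
  · exact hα
  · obtain ⟨h1, h2, h3⟩ := hP Q rfl
    exact div_le_of_le_mul₀ (h3.nonneg hG) hα (h _ _ _ h1 h2 h3)

/-- `P` is a steepest terminal path. -/
structure WGraph.IsSteepest (G : WGraph V) (v₀ : V → Option ℝ) (P : Option (TermPath V)) :
    Prop where
  nonneg : 0 ≤ pathGrad v₀ P
  bound : G.GradLE v₀ (pathGrad v₀ P)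
  path : G.IsTermPath v₀ P

theorem WGraph.highPress_wf {G : WGraph V} (hG : G.WF) (v₀ : V → Option ℝ) (α : ℝ) :
    (G.highPress v₀ α).WF := by
  refine ⟨?_, ?_⟩
  · intro x y hxy
    obtain ⟨h1, h2⟩ := Finset.mem_filter.1 hxy
    exact Finset.mem_filter.2 ⟨hG.mem_verts x y h1, h2 x (Sym2.mem_mk_left x y)⟩
  · exact fun e he => hG.pos e (Finset.mem_filter.1 he).1

theorem WGraph.Reach.of_highPress {G : WGraph V} {v₀ : V → Option ℝ} {α : ℝ} {a b : V} {L : ℝ}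
    (h : (G.highPress v₀ α).Reach a b L) : G.Reach a b L :=
  h.mono (H := G.highPress v₀ α) (G := G) (Finset.filter_subset _ _) rfl

/-- A walk of gradient larger than `α` stays within the subgraph of high pressure. -/
theorem WGraph.Reach.highPress {G : WGraph V} {v₀ : V → Option ℝ} {α : ℝ} {s t : V}
    (hs : (v₀ s).isSome = true) (ht : (v₀ t).isSome = true) {z : V} {L : ℝ} (h : G.Reach s z L) :
    ∀ M, G.Reach t z M → α * (L + M) < volt v₀ s - volt v₀ t →
      (G.highPress v₀ α).Reach s z L := by
  induction h with
  | refl => exact fun _ _ _ => .refl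
  | @step x y L hsx hxy ih =>
    intro M hty hlt
    have htx := hty.step (Sym2.eq_swap (a := x) ▸ hxy)
    rw [Sym2.eq_swap] at htx
    have hlt' : α * (L + (M + G.len s(x, y))) < volt v₀ s - volt v₀ t := by
      refine lt_of_eq_of_lt ?_ hlt
      ring
    refine (ih _ htx hlt').step (Finset.mem_filter.2 ⟨hxy, ?_⟩)
    intro z hz
    rcases Sym2.mem_iff.1 hz with rfl | rfl
    · exact ⟨s, t, _, _, hs, ht, hsx, htx, hlt'⟩
    · exact ⟨s, t, _, _, hs, ht, hsx.step hxy, hty, hlt⟩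

/-- The better of three steepest paths through vertices. -/
theorem bestOfThree {v₀ : V → Option ℝ} (P₁ P₂ P₃ : Option (TermPath V))
    {q : Option (TermPath V) → Prop}
    (h1 : q P₁) (h2 : q P₂) (h3 : q P₃) :
    let P₁₂ := if pathGrad v₀ P₂ ≤ pathGrad v₀ P₁ then P₁ else P₂
    let P := if pathGrad v₀ P₃ ≤ pathGrad v₀ P₁₂ then P₁₂ else P₃
    q P ∧ pathGrad v₀ P₁ ≤ pathGrad v₀ P ∧ pathGrad v₀ P₂ ≤ pathGrad v₀ P ∧
      pathGrad v₀ P₃ ≤ pathGrad v₀ P := by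
  intro P₁₂ P
  have h4 : q P₁₂ ∧ pathGrad v₀ P₁ ≤ pathGrad v₀ P₁₂ ∧ pathGrad v₀ P₂ ≤ pathGrad v₀ P₁₂ := by
    simp only [P₁₂]
    split_ifs with h
    · exact ⟨h1, le_rfl, h⟩
    · exact ⟨h2, le_of_not_ge h, le_rfl⟩
  obtain ⟨h4, h5, h6⟩ := h4
  simp only [P]
  split_ifs with h
  · exact ⟨h4, h5, h6, h⟩
  · exact ⟨h3, h5.trans (le_of_not_ge h), h6.trans (le_of_not_ge h), le_rfl⟩

theorem WGraph.WF.out_mem {G : WGraph V} (hG : G.WF) {e : Sym2 V} (he : e ∈ G.edges) :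
    (Quot.out e).1 ∈ G.verts ∧ (Quot.out e).2 ∈ G.verts := by
  have h : s((Quot.out e).1, (Quot.out e).2) = e := Quot.out_eq e
  rw [← h] at he
  exact ⟨hG.mem_verts _ _ he, hG.mem_verts' he⟩

/-- Let α be the best gradient of the three sampled paths. Walks steeper than α survive in the
subgraph of high pressure, and walks there are walks of `G`, so the recursive answer is also right
for `G`. The third sampled vertex has pressure at most α and drops out, so the number of vertices is
enough fuel. -/
theorem steepestPathAux_outputs (v₀ : V → Option ℝ) : ∀ (f : ℕ) (G : WGraph V), G.WF →
    G.verts.card ≤ f → ∀ P ∈ (steepestPathAux v₀ f G).outputs, G.IsSteepest v₀ P := by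
  have base : ∀ G : WGraph V, G.edges = ∅ → G.IsSteepest v₀ none := by
    intro G hE
    refine ⟨le_rfl, ?_, by simp [WGraph.IsTermPath]⟩
    intro s t L _ _ h
    obtain ⟨rfl, rfl⟩ := h.eq_of_edges_empty hE
    simp
  intro f
  induction f with
  | zero =>
    intro G hG hf P hP
    simp only [steepestPathAux, RTimed.mem_outputs_pure] at hP
    subst hP
    apply base
    rw [Finset.eq_empty_iff_forall_notMem]
    intro e he
    have hV : G.verts = ∅ := by simpa using hf
    have := (hG.out_mem he).1
    simp [hV] at this
  | succ f ih =>
    intro G hG hf P hP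
    by_cases hne : G.edges.Nonempty ∧ G.verts.Nonempty
    · simp only [steepestPathAux, dif_pos hne] at hP
      rw [RTimed.mem_outputs_bind] at hP
      obtain ⟨e, he, hP⟩ := hP
      rw [RTimed.mem_outputs_bind] at hP
      obtain ⟨x, hx, hP⟩ := hP
      rw [RTimed.mem_outputs_sample] at he hx
      obtain ⟨hx₁, hx₂⟩ := hG.out_mem he
      rw [RTimed.mem_outputs_bind] at hP
      obtain ⟨P₁, hP₁, hP⟩ := hP
      rw [RTimed.mem_outputs_bind] at hP
      obtain ⟨P₂, hP₂, hP⟩ := hP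
      rw [RTimed.mem_outputs_bind] at hP
      obtain ⟨P₃, hP₃, hP⟩ := hP
      have s1 := (vertexSteepestPath_spec G hG v₀ hx₁).1 P₁ hP₁
      have s2 := (vertexSteepestPath_spec G hG v₀ hx₂).1 P₂ hP₂
      have s3 := (vertexSteepestPath_spec G hG v₀ hx).1 P₃ hP₃
      obtain ⟨⟨hp, h0⟩, -, -, h3⟩ := bestOfThree (v₀ := v₀) P₁ P₂ P₃
        (q := fun P => G.IsTermPath v₀ P ∧ 0 ≤ pathGrad v₀ P) ⟨s1.isTermPath, s1.nonneg⟩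
        ⟨s2.isTermPath, s2.nonneg⟩ ⟨s3.isTermPath, s3.nonneg⟩
      simp only [RTimed.mem_outputs_lift_bind] at hP
      set R := if pathGrad v₀ P₃ ≤
        pathGrad v₀ (if pathGrad v₀ P₂ ≤ pathGrad v₀ P₁ then P₁ else P₂) then
          (if pathGrad v₀ P₂ ≤ pathGrad v₀ P₁ then P₁ else P₂) else P₃
      rw [(compHighPressGraph_spec G hG v₀ h0).1] at hP
      set α := pathGrad v₀ R
      have hin : ∀ s t L, (v₀ s).isSome = true → (v₀ t).isSome = true → G.Reach s t L →
          α * L < volt v₀ s - volt v₀ t → (G.highPress v₀ α).Reach s t L :=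
        fun s t L hs ht h hlt => h.highPress hs ht 0 .refl (by rwa [add_zero])
      split_ifs at hP with hE
      · rw [RTimed.mem_outputs_pure] at hP
        subst hP
        refine ⟨h0, ?_, hp⟩
        intro s t L hs ht h
        -- A walk steeper than `α` would lie in a graph without edges, hence be trivial and have
        -- gradient 0.
        by_contra! hlt
        obtain ⟨rfl, rfl⟩ := (hin s t L hs ht h hlt).eq_of_edges_empty hE
        simp at hlt
      · have hWF := G.highPress_wf hG v₀ α
        have hcard : (G.highPress v₀ α).verts.card < G.verts.card := by
          refine Finset.card_lt_card (Finset.ssubset_iff_subset_ne.2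
            ⟨Finset.filter_subset _ _, fun hh => ?_⟩)
          have hx' : x ∈ (G.highPress v₀ α).verts := hh ▸ hx
          exact WGraph.pressureLE_iff.1 (s3.bound.mono hG h3) (Finset.mem_filter.1 hx').2
        have hP' := ih (G.highPress v₀ α) hWF (by omega) P hP
        obtain ⟨e', he'⟩ := Finset.nonempty_iff_ne_empty.2 hE
        -- An end of a surviving edge witnesses a walk steeper than `α`. It lies in the subgraph, so
        -- the path found recursively is at least as steep.
        have hα : α ≤ pathGrad v₀ P := by
          obtain ⟨s, t, L, M, hs, ht, hsx, htx, hlt⟩ :=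
            (Finset.mem_filter.1 (hWF.out_mem he').1).2
          have hst := hsx.trans htx.symm
          have h5 := hP'.bound s t _ hs ht (hin s t _ hs ht hst hlt)
          exact (lt_of_mul_lt_mul_right (hlt.trans_le h5) (hst.nonneg hG)).le
        refine ⟨hP'.nonneg, ?_, fun Q hQ => ?_⟩
        · intro s t L hs ht h
          by_cases hlt : α * L < volt v₀ s - volt v₀ t
          · exact hP'.bound s t L hs ht (hin s t L hs ht h hlt)
          · exact (not_lt.1 hlt).trans (mul_le_mul_of_nonneg_right hα (h.nonneg hG))
        · obtain ⟨h5, h6, h7⟩ := hP'.path Q hQ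
          exact ⟨h5, h6, h7.of_highPress⟩
    · simp only [steepestPathAux, dif_neg hne, RTimed.mem_outputs_lift_bind,
        RTimed.mem_outputs_pure] at hP
      subst hP
      apply base
      by_contra hE
      obtain ⟨e, he⟩ := Finset.nonempty_iff_ne_empty.2 hE
      exact hne ⟨⟨e, he⟩, ⟨_, (hG.out_mem he).1⟩⟩

/-- Two steepest paths through the same vertex have equal gradients whatever the random choices. So
pressure is a deterministic ranking, as the sampling argument requires. -/
theorem exists_pressure (G : WGraph V) (hG : G.WF) (v₀ : V → Option ℝ) :
    ∃ p : V → ℝ, ∀ x ∈ G.verts, ∀ P ∈ (vertexSteepestPath G v₀ x).outputs,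
      pathGrad v₀ P = p x := by
  refine ⟨fun x => pathGrad v₀ (RTimed.outputs_nonempty (vertexSteepestPath G v₀ x)).some, ?_⟩
  intro x hx P hP
  have h1 := (vertexSteepestPath_spec G hG v₀ hx).1 P hP
  have h2 := (vertexSteepestPath_spec G hG v₀ hx).1 _
    (RTimed.outputs_nonempty (vertexSteepestPath G v₀ x)).some_mem
  exact le_antisymm (h1.grad_le hG h2.nonneg h2.bound) (h2.grad_le hG h1.nonneg h1.bound)

/-- Everything that survives has pressure above that of all three sampled vertices. Independent
samples of an edge and of a vertex halve, in expectation, the numbers of edges and of vertices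
respectively, and hence `size`. Its logarithmic factor refers to the fixed type `V`, so it stays
constant through the recursion. -/
theorem steepestPathAux_expectedSteps (v₀ : V → Option ℝ) : ∀ (f : ℕ) (G : WGraph V), G.WF →
    (steepestPathAux v₀ f G).expectedSteps ≤ 1 + 800 * (G.size : ℝ≥0∞)
  | 0, G, _ => by simp [steepestPathAux]
  | f + 1, G, hG => by
    by_cases hne : G.edges.Nonempty ∧ G.verts.Nonempty
    · simp only [steepestPathAux, dif_pos hne]
      obtain ⟨p, hp⟩ := exists_pressure G hG v₀
      -- An edge survives only if both ends do, so it is ranked by the smaller of its two pressures.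
      set pe : Sym2 V → ℝ := fun e => min (p (Quot.out e).1) (p (Quot.out e).2) with hpe
      have hsize : (G.size : ℝ≥0∞) = G.edges.card + G.verts.card * (logCard V : ℝ≥0∞) := by
        simp [WGraph.size]
      have hsize2 : (2 : ℝ≥0∞) ≤ G.size := by
        have h1 := hne.1.card_pos
        have h2 := hne.2.card_pos
        have h3 := G.card_verts_le_size
        have h4 : 0 < G.verts.card * logCard V := Nat.mul_pos h2 (Nat.succ_pos _)
        have h5 : G.size = G.edges.card + G.verts.card * logCard V := rfl
        exact_mod_cast (by omega : 2 ≤ G.size)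
      have hfin : (2 : ℝ≥0∞) + (42 + 346 * G.size + 400 * (G.verts.card * logCard V)) +
          400 * G.edges.card ≤ 1 + 800 * (G.size : ℝ≥0∞) := by
        calc _ = 1 + (43 + 346 * (G.size : ℝ≥0∞) +
              400 * (G.edges.card + G.verts.card * (logCard V : ℝ≥0∞))) := by ring
          _ = 1 + (43 + 746 * (G.size : ℝ≥0∞)) := by rw [← hsize]; ring
          _ ≤ 1 + (27 * 2 + 746 * (G.size : ℝ≥0∞)) := by gcongr; norm_num
          _ ≤ 1 + (27 * G.size + 746 * (G.size : ℝ≥0∞)) := by gcongr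
          _ = 1 + 773 * (G.size : ℝ≥0∞) := by ring
          _ ≤ _ := by gcongr; norm_num
      -- Three vertex computations and one subgraph take 3(80 · `size` + 10) + 106 · `size` + 10
      -- steps; one tick and the constant of the recursive call make this 346 · `size` + 42. The
      -- recursive bound 800 · `size` is halved to 400, for the edges by the outer sample and for
      -- the vertices by the inner one.
      refine (RTimed.expectedSteps_sample_bind_le pe (B := 400)
        (A := 1 + (42 + 346 * G.size + 400 * (G.verts.card * logCard V))) ?_).trans
          (le_of_eq_of_le (by ring) hfin)
      intro e he
      obtain ⟨hx₁, hx₂⟩ := hG.out_mem he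
      refine (RTimed.expectedSteps_sample_bind_le p (B := 400 * logCard V)
        (A := 42 + 346 * G.size + 800 * (G.edges.filter fun e' => pe e < pe e').card) ?_).trans
          (le_of_eq (by ring))
      intro x hx
      have v1 := vertexSteepestPath_spec G hG v₀ hx₁
      have v2 := vertexSteepestPath_spec G hG v₀ hx₂
      have v3 := vertexSteepestPath_spec G hG v₀ hx
      have hrest : ∀ P₁ ∈ (vertexSteepestPath G v₀ (Quot.out e).1).outputs,
          ∀ P₂ ∈ (vertexSteepestPath G v₀ (Quot.out e).2).outputs,
          ∀ P₃ ∈ (vertexSteepestPath G v₀ x).outputs, ∀ R,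
          0 ≤ pathGrad v₀ R → pathGrad v₀ P₁ ≤ pathGrad v₀ R → pathGrad v₀ P₂ ≤ pathGrad v₀ R →
          pathGrad v₀ P₃ ≤ pathGrad v₀ R →
          ((compHighPressGraph G v₀ (pathGrad v₀ R)).steps : ℝ≥0∞) +
            (if (compHighPressGraph G v₀ (pathGrad v₀ R)).val.edges = ∅ then
              (pure R : RTimed (Option (TermPath V)))
            else steepestPathAux v₀ f
              (compHighPressGraph G v₀ (pathGrad v₀ R)).val).expectedSteps ≤
          ((106 * G.size + 10 : ℕ) : ℝ≥0∞) +
            (1 + 800 * ((G.edges.filter fun e' => pe e < pe e').card +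
              (G.verts.filter fun y => p x < p y).card * (logCard V : ℝ≥0∞))) := by
        intro P₁ hP₁ P₂ hP₂ P₃ hP₃ R h0 h1 h2 h3
        rw [hp _ hx₁ P₁ hP₁] at h1
        rw [hp _ hx₂ P₂ hP₂] at h2
        rw [hp _ hx P₃ hP₃] at h3
        obtain ⟨c1, c2⟩ := compHighPressGraph_spec G hG v₀ h0
        rw [c1]
        set α := pathGrad v₀ R
        have hhigh : ∀ y ∈ G.verts, G.HighPressure v₀ α y → α < p y := by
          intro y hy hyα
          obtain ⟨P, hP⟩ := RTimed.outputs_nonempty (vertexSteepestPath G v₀ y)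
          have h4 := ((vertexSteepestPath_spec G hG v₀ hy).1 P hP).bound
          rw [hp y hy P hP] at h4
          by_contra! hle
          exact WGraph.pressureLE_iff.1 (h4.mono hG hle) hyα
        have hVc : (G.highPress v₀ α).verts.card ≤
            (G.verts.filter fun y => p x < p y).card := by
          refine Finset.card_le_card fun y hy => ?_
          obtain ⟨hy, hyα⟩ := Finset.mem_filter.1 hy
          exact Finset.mem_filter.2 ⟨hy, h3.trans_lt (hhigh y hy hyα)⟩
        have hEc : (G.highPress v₀ α).edges.card ≤
            (G.edges.filter fun e' => pe e < pe e').card := by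
          refine Finset.card_le_card fun e' he' => ?_
          obtain ⟨he', heα⟩ := Finset.mem_filter.1 he'
          obtain ⟨h5, h6⟩ := hG.out_mem he'
          have h7 : s((Quot.out e').1, (Quot.out e').2) = e' := Quot.out_eq e'
          refine Finset.mem_filter.2 ⟨he', (min_le_left _ _).trans_lt (lt_min ?_ ?_)⟩
          · exact h1.trans_lt (hhigh _ h5 (heα _ (Sym2.mem_iff_exists.2 ⟨_, h7.symm⟩)))
          · exact h1.trans_lt (hhigh _ h6 (heα _ (Sym2.mem_iff_exists.2 ⟨_, h7.symm.trans Sym2.eq_swap⟩)))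
        refine add_le_add (by exact_mod_cast c2) ?_
        have hb : 1 + 800 * ((G.highPress v₀ α).size : ℝ≥0∞) ≤
            1 + 800 * ((G.edges.filter fun e' => pe e < pe e').card +
              (G.verts.filter fun y => p x < p y).card * (logCard V : ℝ≥0∞)) := by
          rw [WGraph.size]
          push_cast
          gcongr
        refine le_trans ?_ hb
        split_ifs
        · simp
        · exact steepestPathAux_expectedSteps v₀ f _ (G.highPress_wf hG v₀ α)
      refine (RTimed.expectedSteps_bind_le v1.2 fun P₁ hP₁ =>
        RTimed.expectedSteps_bind_le v2.2 fun P₂ hP₂ =>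
        RTimed.expectedSteps_bind_le v3.2 (B := 1 + (((106 * G.size + 10 : ℕ) : ℝ≥0∞) +
            (1 + 800 * ((G.edges.filter fun e' => pe e < pe e').card +
              (G.verts.filter fun y => p x < p y).card * (logCard V : ℝ≥0∞))))) fun P₃ hP₃ =>
                ?_).trans ?_
      · obtain ⟨h0, h1, h2, h3⟩ := bestOfThree (v₀ := v₀) P₁ P₂ P₃
          (q := fun P => 0 ≤ pathGrad v₀ P) (v1.1 P₁ hP₁).nonneg (v2.1 P₂ hP₂).nonneg
          (v3.1 P₃ hP₃).nonneg
        simp only [RTimed.expectedSteps_lift_bind, tick_steps, Nat.cast_one]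
        exact add_le_add le_rfl (hrest P₁ hP₁ P₂ hP₂ P₃ hP₃ _ h0 h1 h2 h3)
      · push_cast
        refine le_of_eq ?_
        ring
    · simp only [steepestPathAux, dif_neg hne, RTimed.expectedSteps_lift_bind]
      simp

theorem steepestPath_outputs (v₀ : V → Option ℝ) {G : WGraph V} (hG : G.WF) :
    ∀ P ∈ (steepestPath G v₀).outputs, G.IsSteepest v₀ P :=
  steepestPathAux_outputs v₀ _ G hG le_rfl

theorem steepestPath_expectedSteps (v₀ : V → Option ℝ) {G : WGraph V} (hG : G.WF) :
    (steepestPath G v₀).expectedSteps ≤ ((1 + 800 * G.size : ℕ) : ℝ≥0∞) := by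
  refine (steepestPathAux_expectedSteps v₀ _ G hG).trans (le_of_eq ?_)
  push_cast
  ring

/-! ## Inf-minimizers -/

/-- Both extensions change by at most α · length along an edge, hence so does their mean. At a
terminal the label lies between `vLow` and `vHigh`, while the gradient bound gives vHigh ≤ vLow; all
three coincide, so keeping the label is consistent with the midpoint rule. -/
theorem halfway_spec {H : WGraph V} (hH : H.WF) (hverts : ∀ x, x ∈ H.verts) {v₀ : V → Option ℝ}
    {α : ℝ} (hα : 0 ≤ α) (hgrad : H.GradLE v₀ α) {vLow vHigh : V → EReal}
    (hl : H.IsPotential v₀ α vLow) (hh : H.IsUpperPotential v₀ α vHigh) {v : V → ℝ}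
    (hv : ∀ x, v x = match v₀ x with
      | some a => a
      | none => if vLow x = ⊤ then 0 else ((vLow x).toReal + (vHigh x).toReal) / 2)
    {x y : V} (hxy : s(x, y) ∈ H.edges) : |v x - v y| ≤ α * H.len s(x, y) := by
  have hc := mul_nonneg hα (hH.pos _ hxy).le
  have key : ∀ z, vLow z ≠ ⊤ → ∃ l u : ℝ, vLow z = l ∧ vHigh z = u ∧ v z = (l + u) / 2 := by
    intro z hz
    obtain ⟨t, b, M, ht, htz, h1⟩ := (hl.attained z (hverts z)).resolve_left hz
    have h2 := hh.le_of_reach t (hverts t) z b M ht htz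
    have hbot : vHigh z ≠ ⊥ := fun hb => by
      rw [hb, le_bot_iff] at h2
      exact EReal.coe_ne_bot _ h2
    obtain ⟨s, a, L, hs, hsz, h3⟩ := (hh.attained z (hverts z)).resolve_left hbot
    refine ⟨_, _, h1, h3, ?_⟩
    have h4 := hgrad s t (L + M) (by simp [hs]) (by simp [ht]) (hsz.trans htz.symm)
    rw [volt_of_eq_some hs, volt_of_eq_some ht] at h4
    rw [hv z]
    rcases hvz : v₀ z with _ | c
    · simp only
      rw [if_neg hz, h1, h3, EReal.toReal_coe, EReal.toReal_coe]
    · have h5 := hl.terminal z (hverts z) c hvz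
      have h6 := hh.terminal z (hverts z) c hvz
      rw [h1, EReal.coe_le_coe_iff] at h5
      rw [h3, EReal.coe_le_coe_iff] at h6
      simp only
      linarith
  have hxy' : s(y, x) ∈ H.edges := Sym2.eq_swap ▸ hxy
  have hlen : H.len s(y, x) = H.len s(x, y) := by rw [Sym2.eq_swap]
  have e1 := hl.edge x y hxy
  have e2 := hl.edge y x hxy'
  rw [hlen] at e2
  by_cases hx : vLow x = ⊤
  -- Being out of reach of all terminals propagates along edges, so the default value 0 is taken at
  -- both ends.
  · have hy : vLow y = ⊤ := by
      by_contra hy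
      obtain ⟨l, u, h1, -, -⟩ := key y hy
      rw [hx, h1, ← EReal.coe_add, top_le_iff] at e2
      exact EReal.coe_ne_top _ e2
    have hzero : ∀ z, vLow z = ⊤ → v z = 0 := by
      intro z hz
      rw [hv z]
      rcases hvz : v₀ z with _ | c
      · simp [hz]
      · have h5 := hl.terminal z (hverts z) c hvz
        rw [hz, top_le_iff] at h5
        exact absurd h5 (EReal.coe_ne_top _)
    rw [hzero x hx, hzero y hy]
    simpa using hc
  · have hy : vLow y ≠ ⊤ := by
      intro hy
      obtain ⟨l, u, h1, -, -⟩ := key x hx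
      rw [hy, h1, ← EReal.coe_add, top_le_iff] at e1
      exact EReal.coe_ne_top _ e1
    obtain ⟨l, u, h1, h2, h3⟩ := key x hx
    obtain ⟨l', u', h1', h2', h3'⟩ := key y hy
    have hstep : ∀ (x y : V) (u u' : ℝ), s(x, y) ∈ H.edges → vHigh x = u → vHigh y = u' →
        u ≤ u' + α * H.len s(x, y) := by
      intro x y u u' hxy hu hu'
      obtain ⟨s, a, L, hs, hsx, h4⟩ := (hh.attained x (hverts x)).resolve_left
        (by rw [hu]; exact EReal.coe_ne_bot _)
      have h5 := hh.le_of_reach s (hverts s) y a _ hs (hsx.step hxy)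
      rw [hu', EReal.coe_le_coe_iff] at h5
      rw [hu, EReal.coe_eq_coe_iff] at h4
      rw [mul_add] at h5
      linarith
    have e3 := hstep x y u u' hxy h2 h2'
    have e4 := hstep y x u' u hxy' h2' h2
    rw [hlen] at e4
    rw [h1, h1', ← EReal.coe_add, EReal.coe_le_coe_iff] at e1 e2
    rw [h3, h3', abs_le]
    constructor <;> linarith

/-- CompInfMin after the computation of the largest gradient `α₁` on the set `D` of the edges
between terminals. -/
def compInfMinTail (G : WGraph V) (v₀ : V → Option ℝ) (D : Finset (Sym2 V)) (α₁ : ℝ) :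
    RTimed (V → ℝ) := do
  let E' ← select G.edges fun e => e ∉ D
  ticks (G.verts.card + E'.card)
  let H : WGraph V := ⟨G.verts, E', G.len⟩
  let P ← steepestPath H v₀
  let α := max α₁ (pathGrad v₀ P)
  let vLow ← compVLow H v₀ α
  let vHigh ← compVHigh H v₀ α
  fillArray H.verts fun x =>
    match v₀ x with
    | some a => a
    | none => if vLow x = ⊤ then 0 else ((vLow x).toReal + (vHigh x).toReal) / 2

/-- The hypotheses on `α₁` express that it controls the edges in `D` and is forced by them. Since
the remaining graph has only walks of `G`, the final α is at most any bound on the terminal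
gradients of `G`; edges in `D` obey it through `α₁`, all others by `halfway_spec`. -/
theorem compInfMinTail_spec {G : WGraph V} (hG : G.WF) (hverts : ∀ x, x ∈ G.verts)
    (v₀ : V → Option ℝ) {D : Finset (Sym2 V)}
    (hD : ∀ e ∈ D, ∀ x ∈ e, (v₀ x).isSome = true) {α₁ : ℝ} (hα₁ : 0 ≤ α₁)
    (hle : ∀ x y, s(x, y) ∈ D → |volt v₀ x - volt v₀ y| ≤ α₁ * G.len s(x, y))
    (hmin : ∀ β, 0 ≤ β → G.GradLE v₀ β → α₁ ≤ β) :
    (∀ v ∈ (compInfMinTail G v₀ D α₁).outputs, (∀ x a, v₀ x = some a → v x = a) ∧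
      ∀ β, 0 ≤ β → G.GradLE v₀ β → ∀ x y, s(x, y) ∈ G.edges →
        |v x - v y| ≤ β * G.len s(x, y)) ∧
      (compInfMinTail G v₀ D α₁).expectedSteps ≤ ((907 * G.size + 12 : ℕ) : ℝ≥0∞) := by
  simp only [compInfMinTail, RTimed.mem_outputs_lift_bind, RTimed.expectedSteps_lift_bind,
    select_steps, ticks_steps]
  set E' := (select G.edges fun e => e ∉ D).val with hE'
  have hmemE : ∀ e, e ∈ E' ↔ e ∈ G.edges ∧ e ∉ D := fun e => mem_select
  set H : WGraph V := ⟨G.verts, E', G.len⟩ with hHdef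
  have hH : H.WF := ⟨fun x y hxy => hG.mem_verts x y ((hmemE _).1 hxy).1,
    fun e he => hG.pos e ((hmemE _).1 he).1⟩
  have hsub : H.edges ⊆ G.edges := fun e he => ((hmemE e).1 he).1
  have hα : ∀ P : Option (TermPath V), 0 ≤ max α₁ (pathGrad v₀ P) := fun P =>
    le_max_of_le_left hα₁
  constructor
  · intro v hv
    rw [RTimed.mem_outputs_bind] at hv
    obtain ⟨P, hP, hv⟩ := hv
    rw [RTimed.mem_outputs_lift_bind, RTimed.mem_outputs_lift_bind, RTimed.mem_outputs_lift,
      fillArray_val] at hv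
    have hPs := steepestPath_outputs v₀ hH P hP
    have hgrad : H.GradLE v₀ (max α₁ (pathGrad v₀ P)) := fun s t L hs ht h =>
      (hPs.bound s t L hs ht h).trans
        (mul_le_mul_of_nonneg_right (le_max_right _ _) (h.nonneg hH))
    have hvx := congrFun hv
    refine ⟨?_, ?_⟩
    · intro x a ha
      rw [hvx x, ha]
    · intro β hβ hGβ x y hxy
      have hαβ : max α₁ (pathGrad v₀ P) ≤ β := by
        refine max_le (hmin β hβ hGβ) ?_
        refine hGβ.grad_le hG hβ fun Q hQ => ?_
        obtain ⟨a1, a2, a3⟩ := hPs.path Q hQ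
        exact ⟨a1, a2, a3.mono hsub rfl⟩
      have hlen := (hG.pos _ hxy).le
      refine le_trans ?_ (mul_le_mul_of_nonneg_right hαβ hlen)
      by_cases hxyD : s(x, y) ∈ D
      · have hx := eq_some_volt (hD _ hxyD x (Sym2.mem_mk_left x y))
        have hy := eq_some_volt (hD _ hxyD y (Sym2.mem_mk_right x y))
        rw [hvx x, hvx y, hx, hy]
        exact (hle x y hxyD).trans (mul_le_mul_of_nonneg_right (le_max_left _ _) hlen)
      · exact halfway_spec hH hverts (hα P) hgrad (modDijkstra_spec H hH v₀ (hα P)).1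
          (compVHigh_spec H hH v₀ (hα P)).1 hvx ((hmemE _).2 ⟨hxy, hxyD⟩)
  · refine (add_le_add le_rfl (add_le_add le_rfl (RTimed.expectedSteps_bind_le
      (steepestPath_expectedSteps v₀ hH) (B := ((102 * H.size + 8 + (G.verts.card + 1) : ℕ) :
        ℝ≥0∞)) fun P _ => ?_))).trans ?_
    · rw [RTimed.expectedSteps_lift_bind, RTimed.expectedSteps_lift_bind,
        RTimed.expectedSteps_lift, fillArray_steps]
      have h1 : (compVLow H v₀ (max α₁ (pathGrad v₀ P))).steps ≤ 50 * H.size + 3 :=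
        (modDijkstra_spec H hH v₀ (hα P)).2
      have h2 := (compVHigh_spec H hH v₀ (hα P)).2
      have h3 : H.verts.card = G.verts.card := rfl
      norm_cast
      omega
    · have hEcard : E'.card ≤ G.edges.card := Finset.card_le_card hsub
      have hsizeH : H.size ≤ G.size := Nat.add_le_add_right hEcard _
      have hsize : G.size = G.edges.card + G.verts.card * logCard V := rfl
      have hsize' := G.card_verts_le_size
      norm_cast
      omega

theorem compInfMin_spec {G : WGraph V} (hG : G.WF) (hverts : ∀ x, x ∈ G.verts)
    (v₀ : V → Option ℝ) :
    (∀ v ∈ (compInfMin G v₀).outputs, (∀ x a, v₀ x = some a → v x = a) ∧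
      ∀ β, 0 ≤ β → G.GradLE v₀ β → ∀ x y, s(x, y) ∈ G.edges →
        |v x - v y| ≤ β * G.len s(x, y)) ∧
      (compInfMin G v₀).expectedSteps ≤ ((909 * G.size + 14 : ℕ) : ℝ≥0∞) := by
  have hsize : G.size = G.edges.card + G.verts.card * logCard V := rfl
  have hmem : ∀ e, e ∈ (select G.edges fun e => ∀ x ∈ e, (v₀ x).isSome = true).val ↔
    e ∈ G.edges ∧ ∀ x ∈ e, (v₀ x).isSome = true := fun e => mem_select
  unfold compInfMin
  rw [RTimed.expectedSteps_lift_bind, select_steps]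
  simp only [RTimed.mem_outputs_lift_bind]
  generalize (select G.edges fun e => ∀ x ∈ e, (v₀ x).isSome = true).val = D at hmem ⊢
  have hDcard : D.card ≤ G.edges.card := Finset.card_le_card fun e he => ((hmem e).1 he).1
  have hterm : ∀ e ∈ D, ∀ x ∈ e, (v₀ x).isSome = true := fun e he => ((hmem e).1 he).2
  by_cases hDn : D.Nonempty
  · rw [dif_pos hDn]
    set m := maxOver D hDn fun e =>
      |volt v₀ (Quot.out e).1 - volt v₀ (Quot.out e).2| / G.len e with hm
    have h1 : ∀ e ∈ D, |volt v₀ (Quot.out e).1 - volt v₀ (Quot.out e).2| / G.len e ≤ m.val :=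
      fun e he => Finset.le_sup' (fun e => |volt v₀ (Quot.out e).1 - volt v₀ (Quot.out e).2| /
          G.len e) he
    have h0 : 0 ≤ m.val := by
      obtain ⟨e, he⟩ := hDn
      exact (div_nonneg (abs_nonneg _) (hG.pos _ ((hmem _).1 he).1).le).trans (h1 e he)
    have hle : ∀ x y, s(x, y) ∈ D → |volt v₀ x - volt v₀ y| ≤ m.val * G.len s(x, y) := by
      intro x y hxy
      have h2 := h1 _ hxy
      have h3 : |volt v₀ (Quot.out s(x, y)).1 - volt v₀ (Quot.out s(x, y)).2| =
          |volt v₀ x - volt v₀ y| := by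
        have h4 : s((Quot.out s(x, y)).1, (Quot.out s(x, y)).2) = s(x, y) := Quot.out_eq _
        rcases Sym2.eq_iff.1 h4 with ⟨h5, h6⟩ | ⟨h5, h6⟩
        · rw [h5, h6]
        · rw [h5, h6, abs_sub_comm]
      rwa [h3, div_le_iff₀ (hG.pos _ ((hmem _).1 hxy).1)] at h2
    have hmin : ∀ β, 0 ≤ β → G.GradLE v₀ β → m.val ≤ β := by
      intro β _ hβ
      refine Finset.sup'_le hDn _ fun e he => ?_
      obtain ⟨he, hterm⟩ := (hmem e).1 he
      have h4 : s((Quot.out e).1, (Quot.out e).2) = e := Quot.out_eq _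
      have h5 := hterm _ (Sym2.mem_iff_exists.2 ⟨_, h4.symm⟩)
      have h6 := hterm _ (Sym2.mem_iff_exists.2 ⟨_, h4.symm.trans Sym2.eq_swap⟩)
      -- An edge between terminals is itself a terminal walk, used in both directions to bound the
      -- absolute value.
      have h7 : G.Reach (Quot.out e).1 (Quot.out e).2 (G.len e) := by
        have h8 : s((Quot.out e).1, (Quot.out e).2) ∈ G.edges := h4.symm ▸ he
        have := (WGraph.Reach.refl (G := G)).step h8
        rwa [zero_add, h4] at this
      rw [div_le_iff₀ (hG.pos e he), abs_le]
      have h9 := hβ _ _ _ h5 h6 h7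
      have h10 := hβ _ _ _ h6 h5 h7.symm
      constructor <;> linarith
    obtain ⟨h2, h3⟩ := compInfMinTail_spec hG hverts v₀ hterm h0 hle hmin
    constructor
    · intro v hv
      rw [RTimed.mem_outputs_lift_bind] at hv
      exact h2 v hv
    · rw [RTimed.expectedSteps_lift_bind]
      refine (add_le_add le_rfl (add_le_add le_rfl h3)).trans ?_
      rw [hm, maxOver_steps]
      norm_cast
      omega
  · rw [dif_neg hDn]
    obtain ⟨h2, h3⟩ := compInfMinTail_spec hG hverts v₀ hterm le_rfl
      (fun x y hxy => absurd ⟨_, hxy⟩ hDn) fun β hβ _ => hβ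
    constructor
    · intro v hv
      rw [RTimed.mem_outputs_bind] at hv
      obtain ⟨α₁, h4, hv⟩ := hv
      rw [RTimed.mem_outputs_pure] at h4
      subst h4
      exact h2 v hv
    · refine (add_le_add le_rfl (RTimed.expectedSteps_bind_le (A := 0) (by simp)
        fun α₁ h4 => ?_)).trans (b := ((G.edges.card + 1 : ℕ) : ℝ≥0∞) +
          (0 + ((907 * G.size + 12 : ℕ) : ℝ≥0∞))) ?_
      · rw [RTimed.mem_outputs_pure] at h4
        subst h4
        exact h3
      · norm_cast
        omega

/-! ## Outlier removal -/

theorem forget_isSome {v₀ : V → Option ℝ} {U : Finset V} {x : V} :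
    (forget v₀ U x).isSome = true ↔ x ∉ U ∧ (v₀ x).isSome = true := by
  unfold forget
  split_ifs with h <;> simp [h]

theorem volt_forget {v₀ : V → Option ℝ} {U : Finset V} {x : V} (hx : x ∉ U) :
    volt (forget v₀ U) x = volt v₀ x := by
  simp [volt, forget, hx]

theorem WGraph.GradLE.forget_mono {G : WGraph V} {v₀ : V → Option ℝ} {U W : Finset V} {α : ℝ}
    (hUW : U ⊆ W) (h : G.GradLE (forget v₀ U) α) : G.GradLE (forget v₀ W) α := by
  intro s t L hs ht hst
  rw [forget_isSome] at hs ht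
  have hsU : s ∉ U := fun hh => hs.1 (hUW hh)
  have htU : t ∉ U := fun hh => ht.1 (hUW hh)
  rw [volt_forget hs.1, volt_forget ht.1, ← volt_forget hsU, ← volt_forget htU]
  exact h s t L (forget_isSome.2 ⟨hsU, hs.2⟩) (forget_isSome.2 ⟨htU, ht.2⟩) hst

/-- The charging argument against the set `W` of an optimal solution. The invariant is a
disjunction: either the gradients are already bounded by `α`, which persists when more labels are
forgotten, or at least half of the chosen terminals lie in `W`. The fuel `f` counts the pairs still
to be chosen. -/
theorem pickLoop_outputs {G : WGraph V} (hG : G.WF) (v₀ : V → Option ℝ) {k : ℕ} {α : ℝ}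
    (hα : 0 ≤ α) {W : Finset V} (hWk : W.card ≤ k) (hW : G.GradLE (forget v₀ W) α) :
    ∀ (f : ℕ) (U : Finset V), U.card + 2 * f = 2 * k →
      (G.GradLE (forget v₀ U) α ∨ U.card ≤ 2 * (U ∩ W).card) →
      ∀ U' ∈ (pickLoop G v₀ k f U).outputs, U'.card ≤ 2 * k ∧ G.GradLE (forget v₀ U') α := by
  have done : ∀ U : Finset V, 2 * k ≤ U.card →
      (G.GradLE (forget v₀ U) α ∨ U.card ≤ 2 * (U ∩ W).card) → G.GradLE (forget v₀ U) α := by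
    rintro U hU (h | h)
    · exact h
    -- With 2k terminals chosen, U ∩ W has at least k ≥ |W| elements, so all of `W` has been
    -- forgotten.
    · have h1 : U ∩ W = W := Finset.eq_of_subset_of_card_le Finset.inter_subset_right (by omega)
      exact hW.forget_mono (Finset.inter_eq_right.1 h1)
  intro f
  induction f with
  | zero =>
    intro U hU hI U' hU'
    simp only [pickLoop, RTimed.mem_outputs_pure] at hU'
    subst hU'
    exact ⟨by omega, done U' (by omega) hI⟩
  | succ f ih =>
    intro U hU hI U' hU'
    rw [pickLoop, RTimed.mem_outputs_lift_bind, RTimed.mem_outputs_bind] at hU'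
    obtain ⟨P, hP, hU'⟩ := hU'
    rw [RTimed.mem_outputs_lift_bind] at hU'
    have hPs : G.IsSteepest (forget v₀ U) P := steepestPath_outputs _ hG P hP
    have hmono : ∀ β, pathGrad (forget v₀ U) P ≤ β → G.GradLE (forget v₀ U) β :=
      fun β hβ s t L hs ht h => (hPs.bound s t L hs ht h).trans
        (mul_le_mul_of_nonneg_right hβ (h.nonneg hG))
    rcases P with _ | Q
    · rw [RTimed.mem_outputs_pure] at hU'
      subst hU'
      exact ⟨by omega, hmono α hα⟩
    simp only at hU'
    split_ifs at hU' with hQ hcard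
    · replace hQ : pathGrad (forget v₀ U) (some Q) ≤ 0 := hQ
      rw [RTimed.mem_outputs_pure] at hU'
      subst hU'
      exact ⟨by omega, hmono α (hQ.trans hα)⟩
    all_goals
      obtain ⟨hs, ht, hst⟩ := hPs.path Q rfl
      rw [forget_isSome] at hs ht
      -- A path of positive gradient has distinct end points, so each round enlarges `U` by exactly
      -- two.
      have hne : Q.src ≠ Q.dst := by
        intro hh
        apply hQ
        change pathGrad (forget v₀ U) (some Q) ≤ 0
        simp [pathGrad, hh]
      have hUc : (insert Q.src (insert Q.dst U)).card = U.card + 2 := by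
        rw [Finset.card_insert_of_notMem (by simp [hne, hs.1]),
          Finset.card_insert_of_notMem ht.1]
      have hI' : G.GradLE (forget v₀ (insert Q.src (insert Q.dst U))) α ∨
          (insert Q.src (insert Q.dst U)).card ≤
            2 * (insert Q.src (insert Q.dst U) ∩ W).card := by
        have hsub : U ⊆ insert Q.src (insert Q.dst U) :=
          (Finset.subset_insert _ _).trans (Finset.subset_insert _ _)
        rcases hI with hI | hI
        · exact Or.inl (hI.forget_mono hsub)
        by_cases hQW : Q.src ∈ W ∨ Q.dst ∈ W
        · right
          have hlt : (U ∩ W).card < (insert Q.src (insert Q.dst U) ∩ W).card := by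
            refine Finset.card_lt_card (Finset.ssubset_iff_subset_ne.2
              ⟨Finset.inter_subset_inter_right hsub, fun hh => ?_⟩)
            rcases hQW with h | h
            · have h1 : Q.src ∈ U ∩ W := by rw [hh]; simp [h]
              exact hs.1 (Finset.mem_inter.1 h1).1
            · have h1 : Q.dst ∈ U ∩ W := by rw [hh]; simp [h]
              exact ht.1 (Finset.mem_inter.1 h1).1
          omega
        -- If the steepest path avoids `W`, its end points are still labelled after forgetting `W`,
        -- so its gradient, the largest for `U`, is at most `α`.
        · left
          rw [not_or] at hQW
          refine (hmono α ?_).forget_mono hsub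
          have h1 := hW.grad_le hG hα (P := some Q) (by
            rintro _ ⟨⟩
            exact ⟨forget_isSome.2 ⟨hQW.1, hs.2⟩, forget_isSome.2 ⟨hQW.2, ht.2⟩, hst⟩)
          rw [pathGrad, volt_forget hQW.1, volt_forget hQW.2] at h1
          rw [pathGrad, volt_forget hs.1, volt_forget ht.1]
          exact h1
    · exact ih _ (by omega) hI' U' hU'
    · rw [RTimed.mem_outputs_pure] at hU'
      rw [hU']
      exact ⟨by omega, done _ (by omega) hI'⟩

theorem pickLoop_expectedSteps {G : WGraph V} (hG : G.WF) (v₀ : V → Option ℝ) (k : ℕ) :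
    ∀ (f : ℕ) (U : Finset V),
      (pickLoop G v₀ k f U).expectedSteps ≤ ((f * (801 * G.size + 3) : ℕ) : ℝ≥0∞)
  | 0, U => by simp [pickLoop]
  | f + 1, U => by
    have hsize := G.card_verts_le_size
    simp only [pickLoop, RTimed.expectedSteps_lift_bind, fillArray_steps]
    refine (add_le_add le_rfl (RTimed.expectedSteps_bind_le (steepestPath_expectedSteps _ hG)
      (B := ((1 + f * (801 * G.size + 3) : ℕ) : ℝ≥0∞)) fun P _ => ?_)).trans ?_
    · rw [RTimed.expectedSteps_lift_bind, tick_steps, Nat.cast_add]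
      refine add_le_add le_rfl ?_
      rcases P with _ | Q
      · simp
      · simp only
        split_ifs
        · simp
        · exact pickLoop_expectedSteps hG v₀ k f _
        · simp
    · norm_cast
      have := Nat.add_one_mul f (801 * G.size + 3)
      omega

/-! ## The optimization problem -/

theorem mismatch_le_of_forget {v₀ : V → Option ℝ} {U : Finset V} {v : V → ℝ}
    (h : ∀ x a, forget v₀ U x = some a → v x = a) : mismatch v₀ v ≤ U.card := by
  refine Finset.card_le_card fun x hx => ?_
  obtain ⟨-, h1, h2⟩ := Finset.mem_filter.1 hx
  by_contra hxU
  have h3 := eq_some_volt (forget_isSome.2 ⟨hxU, h1⟩)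
  rw [← h x _ h3] at h3
  apply h2
  rw [← h3]
  simp [forget, hxU]

/-! ### Attainment of the optimum and the guarantees of the algorithm. -/

variable (G : SimpleGraph V) [DecidableRel G.Adj] (len : Sym2 V → ℝ)

theorem gradNorm_nonneg (v : V → ℝ) : 0 ≤ gradNorm G len v := norm_nonneg _

theorem gradNorm_le_iff (hlen : ∀ e ∈ G.edgeSet, 0 < len e) {v : V → ℝ} {α : ℝ} (hα : 0 ≤ α) :
    gradNorm G len v ≤ α ↔ ∀ x y, G.Adj x y → |v x - v y| ≤ α * len s(x, y) := by
  rw [gradNorm, pi_norm_le_iff_of_nonneg hα]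
  have key : ∀ x y, G.Adj x y →
      (‖(v x - v y) / len s(x, y)‖ ≤ α ↔ |v x - v y| ≤ α * len s(x, y)) := by
    intro x y hxy
    have hpos : 0 < len s(x, y) := hlen _ hxy
    rw [Real.norm_eq_abs, abs_div, abs_of_pos hpos, div_le_iff₀ hpos]
  constructor
  · exact fun h x y hxy => (key x y hxy).1 (h ⟨(x, y), hxy⟩)
  · exact fun h d => (key _ _ d.adj).2 (h _ _ d.adj)

/-- The linear map `v ↦ grad v`. -/
def gradMap : (V → ℝ) →ₗ[ℝ] (G.Dart → ℝ) where
  toFun v := fun d => (v d.fst - v d.snd) / len d.edge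
  map_add' v w := by
    funext d
    simp only [Pi.add_apply]
    ring
  map_smul' c v := by
    funext d
    simp only [Pi.smul_apply, smul_eq_mul, RingHom.id_apply]
    ring

/-- The feasible set is unbounded and the gradient norm ignores constants, so compactness is not
directly available. Minimization is done in gradient space instead: the gradients of feasible points
form a closed set, and a nearest point to the origin exists in finite dimension. -/
theorem outlierValues_isLeast (v₀ : V → Option ℝ) (k : ℕ) :
    IsLeast (outlierValues G len v₀ k) (outlierOpt G len v₀ k) := by
  set K : Set (G.Dart → ℝ) := gradMap G len '' {v : V → ℝ | mismatch v₀ v ≤ k} with hK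
  have hne : K.Nonempty := by
    refine ⟨_, volt v₀, ?_, rfl⟩
    have : mismatch v₀ (volt v₀) ≤ (∅ : Finset V).card :=
      mismatch_le_of_forget fun x a ha => volt_of_eq_some (by simpa [forget] using ha)
    simp only [Finset.card_empty] at this
    exact this.trans (Nat.zero_le _)
  -- For each set `W` of at most k terminals, the assignments that agree with the labels off `W`
  -- form an affine subspace with base point `volt v₀`. Its image under `gradMap` is a translated
  -- subspace.
  have hunion : K = ⋃ W ∈ (Finset.univ : Finset V).powerset.filter (fun W => W.card ≤ k),
      (fun z => z - gradMap G len (volt v₀)) ⁻¹'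
        ((Submodule.map (gradMap G len)
          (Submodule.pi {t | (v₀ t).isSome = true ∧ t ∉ W} fun _ => (⊥ : Submodule ℝ ℝ)) :
            Submodule ℝ (G.Dart → ℝ)) : Set (G.Dart → ℝ)) := by
    ext z
    simp only [hK, Set.mem_image, Set.mem_ofPred_eq, Finset.mem_filter, Finset.mem_powerset,
      Finset.subset_univ, true_and, Set.mem_iUnion, Set.mem_preimage, SetLike.mem_coe,
      Submodule.mem_map, Submodule.mem_pi, Submodule.mem_bot, exists_prop]
    constructor
    · rintro ⟨v, hv, rfl⟩
      refine ⟨_, hv, v - volt v₀, ?_, map_sub _ _ _⟩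
      rintro t ⟨ht, htW⟩
      have h1 : v₀ t = some (v t) := by
        by_contra h
        exact htW (Finset.mem_filter.2 ⟨Finset.mem_univ _, ht, h⟩)
      simp [volt_of_eq_some h1]
    · rintro ⟨W, hW, u, hu, huz⟩
      refine ⟨u + volt v₀, (mismatch_le_of_forget (U := W) ?_).trans hW, by simp [huz]⟩
      intro x a ha
      have h1 := forget_isSome.1 (by rw [ha]; rfl : (forget v₀ W x).isSome = true)
      have h2 := hu x ⟨h1.2, h1.1⟩
      have h3 : v₀ x = some a := by simpa [forget, h1.1] using ha
      simp [h2, volt_of_eq_some h3]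
  have hclosed : IsClosed K := by
    rw [hunion]
    refine Set.Finite.isClosed_biUnion (Finset.finite_toSet _) fun W _ => ?_
    exact (Submodule.closed_of_finiteDimensional _).preimage (by fun_prop)
  -- The distance to 0 in the sup norm is the gradient norm.
  obtain ⟨_, ⟨v, hv, rfl⟩, hd⟩ := hclosed.exists_infDist_eq_dist hne 0
  have hleast : IsLeast (outlierValues G len v₀ k) (gradNorm G len v) := by
    refine ⟨⟨v, hv, rfl⟩, ?_⟩
    rintro _ ⟨w, hw, rfl⟩
    have h1 := Metric.infDist_le_dist_of_mem (x := (0 : G.Dart → ℝ)) (s := K) ⟨w, hw, rfl⟩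
    rw [hd, dist_zero_left, dist_zero_left] at h1
    exact h1
  rw [outlierOpt, hleast.csInf_eq]
  exact hleast

/-- The input graph as the programs handle it. -/
def inputGraph : WGraph V := ⟨Finset.univ, G.edgeFinset, len⟩

theorem inputGraph_wf (hlen : ∀ e ∈ G.edgeSet, 0 < len e) : (inputGraph G len).WF := by
  refine ⟨fun x _ _ => Finset.mem_univ x, ?_⟩
  · exact fun e he => hlen e (SimpleGraph.mem_edgeFinset.1 he)

theorem abs_sub_le_of_reach {v : V → ℝ} {α : ℝ}
    (hv : ∀ x y, G.Adj x y → |v x - v y| ≤ α * len s(x, y)) {s t : V} {L : ℝ}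
    (h : (inputGraph G len).Reach s t L) : |v s - v t| ≤ α * L := by
  induction h with
  | refl => simp
  | @step x y L _ hxy ih =>
    have h1 := hv x y (SimpleGraph.mem_edgeFinset.1 hxy)
    have h2 := abs_sub_le (v s) (v x) (v y)
    have h3 : (inputGraph G len).len s(x, y) = len s(x, y) := rfl
    rw [h3, mul_add]
    linarith

theorem approxOutlier_outputs (hlen : ∀ e ∈ G.edgeSet, 0 < len e) (v₀ : V → Option ℝ) (k : ℕ) :
    ∀ v ∈ (approxOutlier G len v₀ k).outputs,
      mismatch v₀ v ≤ 2 * k ∧ gradNorm G len v ≤ outlierOpt G len v₀ k := by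
  intro v hv
  have hWF := inputGraph_wf G len hlen
  simp only [approxOutlier, RTimed.mem_outputs_lift_bind] at hv
  rw [RTimed.mem_outputs_bind] at hv
  obtain ⟨U, hU, hv⟩ := hv
  rw [RTimed.mem_outputs_lift_bind, fillArray_val] at hv
  obtain ⟨⟨w, hw, hwα⟩, -⟩ := outlierValues_isLeast G len v₀ k
  have hα : 0 ≤ outlierOpt G len v₀ k := hwα ▸ gradNorm_nonneg G len w
  have hw' := (gradNorm_le_iff G len hlen hα).1 hwα.le
  -- Off its mismatch set the optimal `w` equals the labels, and it is Lipschitz along walks with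
  -- constant the optimum.
  have hW : (inputGraph G len).GradLE (forget v₀
      (Finset.univ.filter fun t => (v₀ t).isSome = true ∧ v₀ t ≠ some (w t)))
      (outlierOpt G len v₀ k) := by
    have key : ∀ s, s ∉ (Finset.univ.filter fun t => (v₀ t).isSome = true ∧ v₀ t ≠ some (w t)) →
        (v₀ s).isSome = true → volt v₀ s = w s := by
      intro s hs hs'
      apply volt_of_eq_some
      by_contra h
      exact hs (Finset.mem_filter.2 ⟨Finset.mem_univ _, hs', h⟩)
    intro s t L hs ht hst
    rw [forget_isSome] at hs ht
    rw [volt_forget hs.1, volt_forget ht.1, key s hs.1 hs.2, key t ht.1 ht.2]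
    exact (le_abs_self _).trans (abs_sub_le_of_reach G len hw' hst)
  obtain ⟨h1, h2⟩ := pickLoop_outputs hWF v₀ hα hw hW k ∅ (by simp) (Or.inr (by simp)) U hU
  obtain ⟨h3, h4⟩ := (compInfMin_spec hWF (fun x => Finset.mem_univ x) (forget v₀ U)).1 v hv
  refine ⟨(mismatch_le_of_forget h3).trans h1, (gradNorm_le_iff G len hlen hα).2 ?_⟩
  exact fun x y hxy => h4 _ hα h2 x y (SimpleGraph.mem_edgeFinset.2 hxy)

theorem approxOutlier_expectedSteps (hlen : ∀ e ∈ G.edgeSet, 0 < len e) (v₀ : V → Option ℝ)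
    {k : ℕ} (hk : 0 < k) (hV : 0 < Fintype.card V) :
    (approxOutlier G len v₀ k).expectedSteps ≤
      ((2000 * k * (inputGraph G len).size : ℕ) : ℝ≥0∞) := by
  have hWF := inputGraph_wf G len hlen
  simp only [approxOutlier, RTimed.expectedSteps_lift_bind, ticks_steps]
  refine (add_le_add le_rfl (RTimed.expectedSteps_bind_le
    (pickLoop_expectedSteps hWF v₀ k k ∅)
    (B := ((Fintype.card V + 1 + (909 * (inputGraph G len).size + 14) : ℕ) : ℝ≥0∞))
    fun U _ => ?_)).trans ?_
  · rw [RTimed.expectedSteps_lift_bind, fillArray_steps, fillArray_val,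
      Nat.cast_add (Fintype.card V + 1)]
    exact add_le_add le_rfl
      (compInfMin_spec hWF (fun x => Finset.mem_univ x) (forget v₀ U)).2
  · norm_cast
    have h1 : (inputGraph G len).size =
        G.edgeFinset.card + Fintype.card V * logCard V := rfl
    have h2 : Fintype.card V ≤ Fintype.card V * logCard V :=
      Nat.le_mul_of_pos_right _ (Nat.succ_pos _)
    generalize (inputGraph G len).size = N at h1 ⊢
    have h3 : 1 ≤ N := by omega
    have h4 : N ≤ k * N := Nat.le_mul_of_pos_left _ hk
    have h5 : k ≤ k * N := Nat.le_mul_of_pos_right _ h3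
    have h6 : k * (801 * N + 3) = 801 * (k * N) + 3 * k := by ring
    have h7 : 2000 * k * N = 2000 * (k * N) := by ring
    rw [h6, h7]
    omega

/-- For n ≥ 2 the added 1 is at most ⌊log₂ n⌋, so the left side is at most 2 log₂ n, and 2 ≤ 3 ln 2.
-/
theorem logCard_le (hV : 2 ≤ Fintype.card V) :
    (logCard V : ℝ) ≤ 3 * Real.log (Fintype.card V) := by
  have h1 : 1 ≤ Nat.log 2 (Fintype.card V) := Nat.log_pos (by norm_num) hV
  have h2 : (2 : ℝ) ^ Nat.log 2 (Fintype.card V) ≤ Fintype.card V := by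
    exact_mod_cast Nat.pow_log_le_self 2 (by omega)
  have h3 := Real.log_le_log (by positivity) h2
  rw [Real.log_pow] at h3
  have h4 : (1 : ℝ) ≤ Nat.log 2 (Fintype.card V) := by exact_mod_cast h1
  have h5 := Real.log_two_gt_d9
  rw [logCard]
  push_cast
  nlinarith

end Outlier

end

/-! ### The main theorem. -/

theorem mainTheorem8 :
    (∀ (V : Type) [Fintype V] [DecidableEq V] (G : SimpleGraph V) [DecidableRel G.Adj]
        (len : Sym2 V → ℝ) (v₀ : V → Option ℝ) (k : ℕ),
        (∀ e ∈ G.edgeSet, 0 < len e) → 0 < k →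
          IsLeast (Outlier.outlierValues G len v₀ k) (Outlier.outlierOpt G len v₀ k) ∧
          ∀ v ∈ (Outlier.approxOutlier G len v₀ k).outputs,
            Outlier.mismatch v₀ v ≤ 2 * k ∧
            Outlier.gradNorm G len v ≤ Outlier.outlierOpt G len v₀ k) ∧
    (∃ C : ℝ, ∀ (V : Type) [Fintype V] [DecidableEq V] (G : SimpleGraph V) [DecidableRel G.Adj]
        (len : Sym2 V → ℝ) (v₀ : V → Option ℝ) (k : ℕ),
        (∀ e ∈ G.edgeSet, 0 < len e) → 0 < k → 2 ≤ Fintype.card V →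
          (Outlier.approxOutlier G len v₀ k).expectedSteps ≤
            ENNReal.ofReal (C * (k * (G.edgeFinset.card +
              Fintype.card V * Real.log (Fintype.card V))))) := by
  -- The constant is 6000 = 2000 · 3: the step bound times the factor from passing to the natural
  -- logarithm.
  refine ⟨fun V _ _ G _ len v₀ k hlen _ => ⟨Outlier.outlierValues_isLeast G len v₀ k,
    Outlier.approxOutlier_outputs G len hlen v₀ k⟩, 6000, ?_⟩
  intro V _ _ G _ len v₀ k hlen hk hV
  refine (Outlier.approxOutlier_expectedSteps G len hlen v₀ hk (by omega)).trans ?_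
  rw [← ENNReal.ofReal_natCast]
  refine ENNReal.ofReal_le_ofReal ?_
  have h1 : (Outlier.inputGraph G len).size =
      G.edgeFinset.card + Fintype.card V * Outlier.logCard V := rfl
  rw [h1]
  push_cast
  have h2 := mul_le_mul_of_nonneg_left (Outlier.logCard_le hV) (Nat.cast_nonneg' (Fintype.card V))
  have h3 : (0 : ℝ) ≤ G.edgeFinset.card := Nat.cast_nonneg' _
  calc (2000 * k * (G.edgeFinset.card + Fintype.card V * Outlier.logCard V) : ℝ)
      ≤ 2000 * k * (3 * G.edgeFinset.card +
          Fintype.card V * (3 * Real.log (Fintype.card V))) := by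
        refine mul_le_mul_of_nonneg_left ?_ (by positivity)
        linarith
    _ = _ := by ring
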